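/- Let $d=2$ and fix $\epsilon,\beta\ge 0$, $\mu>0$, $T>0$. Spaces: $H^n=H^n(\mathbb R^2)$ is the usual Sobolev space; $\dot H^n=\{b\in L^2_{\rm loc}(\mathbb R^2):\nabla b\in (H^{n-1})^2\}$; $X^0=\{\mathbf u\in L^2(\mathbb R^2)^2:\nabla\cdot\mathbf u\in L^2\}$ with $\|\mathbf u\|_{X^0}^2=\|\mathbf u\|_{L^2}^2+\mu\|\nabla\cdot\mathbf u\|_{L^2}^2$, and $(X^0)'$ is its topological dual; $X^n$ (resp. $Y^n$) is the space of $\mathbf u\in X^0$ (resp. $\mathbf v\in (X^0)'$) with $\partial^\alpha\mathbf u\in X^0$ (resp. $\partial^\alpha\mathbf v\in(X^0)'$) for all $|\alpha|\le n$, with norm squared $\sum_{|\alpha|\le n}\|\partial^\alpha\mathbf u\|_{X^0}^2$ (resp. $\sum_{|\alpha|\le n}\|\partial^\alpha\mathbf v\|_{(X^0)'}^2$). For $h=1+\epsilon\zeta-\beta b$ set $$\mathcal T[h,\beta b]\mathbf u=-\frac1{3h}\nabla(h^3\nabla\cdot\mathbf u)+\frac1{2h}\Big(\nabla\big(h^2(\beta\nabla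 b)\cdot\mathbf u\big)-h^2(\beta\nabla b)\nabla\cdot\mathbf u\Big)+\beta^2(\nabla b\cdot\mathbf u)\nabla b,$$ $$\mathfrak T[h,\beta b]\mathbf u=h\mathbf u+\mu h\mathcal T[h,\beta b]\mathbf u,$$ $$\mathcal Q[h,\mathbf u]=-\frac1{3h}\nabla\Big(h^3\big((\mathbf u\cdot\nabla)(\nabla\cdot\mathbf u)-(\nabla\cdot\mathbf u)^2\big)\Big),$$ $$\mathcal Q_b[h,\beta b,\mathbf u]=\frac{\beta}{2h}\Big(\nabla\big(h^2(\mathbf u\cdot\nabla)^2b\big)-h^2\big((\mathbf u\cdot\nabla)(\nabla\cdot\mathbf u)-(\nabla\cdot\mathbf u)^2\big)\nabla b\Big)+\beta^2\big((\mathbf u\cdot\nabla)^2b\big)\nabla b,$$ $$\mathcal R[h,\mathbf u]=\frac{\mathbf u}{3h}\cdot\nabla(h^3\nabla\cdot\mathbf u)+\frac12h^2(\nabla\cdot\mathbf u)^2,$$ $$\mathcal R_b[h,\beta b,\mathbf u]=-\frac12\Big(\frac{\mathbf u}{h}\cdot\nabla\big(h^2(\beta\nabla b\cdot\mathbf u)\big)+h(\beta\nabla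 b\cdot\mathbf u)\nabla\cdot\mathbf u+(\beta\nabla b\cdot\mathbf u)^2\Big),$$ where $(\mathbf u\cdot\nabla)^2b=\mathbf u\cdot\nabla(\mathbf u\cdot\nabla b)$. Let also $\mathbf u^\perp=(-u_2,u_1)$ and $\operatorname{curl}\mathbf v=\partial_1v_2-\partial_2v_1$. Consider on $[0,T]$ the systems $$\text{(GN-u)}\quad\begin{cases}\partial_t\zeta+\nabla\cdot(h\mathbf u)=0,\\ (\mathrm{Id}+\mu\mathcal T[h,\beta b])\partial_t\mathbf u+\nabla\zeta+\epsilon(\mathbf u\cdot\nabla)\mathbf u+\mu\epsilon(\mathcal Q[h,\mathbf u]+\mathcal Q_b[h,\beta b,\mathbf u])=0,\end{cases}$$ $$\text{(GN-v)}\quad\begin{cases}\partial_t\zeta+\nabla\cdot(h\mathbf u)=0,\\ (\partial_t+\epsilon\mathbf u^\perp\operatorname{curl})\mathbf v+\nabla\zeta+\frac\epsilon2\nabla(|\mathbf u|^2)=\mu\epsilon\nabla\big(\mathcal R[h,\mathbf u]+\mathcal R_b[h,\beta b,\mathbf u]\big),\end{cases}\quad\text{with }\mathbf u=\mathfrak T[h,\beta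 b]^{-1}(h\mathbf v).$$ Solutions are strong: at every $t\in[0,T]$ the time derivatives of $\zeta,\mathbf u,\mathbf v$ exist in $L^2$, $X^0$, $(X^0)'$ respectively, and the second equation of each system holds in $(X^0)'$. **Proposition.** Let $b\in\dot H^5(\mathbb R^2)$ and $\zeta\in C^0([0,T];H^4(\mathbb R^2))$ be such that, for some constants $h_\star,h^\star$, $0<h_\star<h(t,x)<h^\star<\infty$ for all $t\in[0,T]$ and almost every $x\in\mathbb R^2$. 1. If $\mathbf u\in C^0([0,T];X^4)$ is such that $(\zeta,\mathbf u)$ satisfies (GN-u), then $\mathbf v=h^{-1}\mathfrak T[h,\beta b]\mathbf u$ is uniquely defined (for each $t\in[0,T]$ it is the unique $\mathbf v\in(X^0)'$ with $h\mathbf v=\mathfrak T[h,\beta b]\mathbf u$), $\mathbf v\in C^0([0,T];Y^4)$, and $(\zeta,\mathbf v)$ satisfies (GN-v). 2. If $\mathbf v\in C^0([0,T];Y^4)$ is such that $(\zeta,\mathbf v)$ satisfies (GN-v), then $\mathbf u=\mathfrak T[h,\beta b]^{-1}(h\mathbf v)$ is uniquely defined (for each $t\in[0,T]$ it is the unique $\mathbf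 u\in X^0$ with $\mathfrak T[h,\beta b]\mathbf u=h\mathbf v$), $\mathbf u\in C^0([0,T];X^4)$, and $(\zeta,\mathbf u)$ satisfies (GN-u). -/

import Mathlib

open MeasureTheory Set
open scoped ContDiff

noncomputable section

/-! ## The plane, test functions and weak derivatives -/

/-- The horizontal space `ℝ²`. -/
abbrev Plane : Type := EuclideanSpace ℝ (Fin 2)

/-- Classical partial derivative `∂ᵢ φ`. -/
def pd {F : Type*} [NormedAddCommGroup F] [NormedSpace ℝ F] (i : Fin 2) (φ : Plane → F) :
    Plane → F :=
  fun x => fderiv ℝ φ x (EuclideanSpace.single i 1)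

/-- Classical derivative `∂^α φ` for a multi-index `α ∈ ℕ²`. -/
def mderiv {F : Type*} [NormedAddCommGroup F] [NormedSpace ℝ F] (α : Fin 2 → ℕ) (φ : Plane → F) :
    Plane → F :=
  (pd 0)^[α 0] ((pd 1)^[α 1] φ)

/-- Test functions: smooth with compact support. -/
def IsTest {F : Type*} [NormedAddCommGroup F] [NormedSpace ℝ F] (φ : Plane → F) : Prop :=
  ContDiff ℝ ∞ φ ∧ HasCompactSupport φ

/-- `g = ∂^α f` in the sense of distributions (both locally integrable). -/
def HasWeakDeriv (α : Fin 2 → ℕ) (f g : Plane → ℝ) : Prop :=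
  LocallyIntegrable f volume ∧ LocallyIntegrable g volume ∧
    ∀ φ : Plane → ℝ, IsTest φ →
      ∫ x, f x * mderiv α φ x = (-1 : ℝ) ^ (∑ i, α i) * ∫ x, g x * φ x

/-- `d = ∇ ⬝ w` in the sense of distributions (both locally integrable). -/
def HasWeakDiv (w : Plane → Plane) (d : Plane → ℝ) : Prop :=
  LocallyIntegrable w volume ∧ LocallyIntegrable d volume ∧
    ∀ φ : Plane → ℝ, IsTest φ → ∫ x, ∑ i, w x i * pd i φ x = -∫ x, d x * φ x

open Classical in
/-- The weak partial derivative `∂ᵢ f` (determined up to a null set; `0` if there is none). -/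
def wderiv (i : Fin 2) (f : Plane → ℝ) : Plane → ℝ :=
  if h : ∃ g, HasWeakDeriv (Pi.single i 1) f g then h.choose else 0

/-- The weak gradient of a scalar function. -/
def wgrad (f : Plane → ℝ) : Plane → Plane := fun x => !₂[wderiv 0 f x, wderiv 1 f x]

/-- Euclidean scalar product of two vector fields. -/
def dotp (u w : Plane → Plane) : Plane → ℝ := fun x => inner ℝ (u x) (w x)

/-- `(u ⬝ ∇) f` for a scalar function `f`. -/
def adv (u : Plane → Plane) (f : Plane → ℝ) : Plane → ℝ := dotp u (wgrad f)

/-- `(u ⬝ ∇) w` for a vector field `w`. -/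
def advV (u w : Plane → Plane) : Plane → Plane :=
  fun x => !₂[adv u (fun y => w y 0) x, adv u (fun y => w y 1) x]

/-- `(u₁, u₂)^⊥ = (-u₂, u₁)`. -/
def perp (u : Plane → Plane) : Plane → Plane := fun x => !₂[-(u x 1), u x 0]

theorem IsTest.pderiv {F : Type*} [NormedAddCommGroup F] [NormedSpace ℝ F] {φ : Plane → F}
    (h : IsTest φ) (i : Fin 2) : IsTest (pd i φ) := by
  refine ⟨?_, h.2.fderiv_apply ℝ _⟩
  exact (h.1.fderiv_right (m := ∞) (by norm_cast)).clm_apply contDiff_const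

theorem IsTest.multideriv {F : Type*} [NormedAddCommGroup F] [NormedSpace ℝ F] {φ : Plane → F}
    (h : IsTest φ) (α : Fin 2 → ℕ) : IsTest (mderiv α φ) := by
  have key : ∀ (i : Fin 2) (n : ℕ) (ψ : Plane → F), IsTest ψ → IsTest ((pd i)^[n] ψ) := by
    intro i n
    induction n with
    | zero => intro ψ hψ; exact hψ
    | succ n ih => intro ψ hψ; exact ih _ (hψ.pderiv i)
  exact key 0 _ _ (key 1 _ _ h)

theorem IsTest.comp_apply {φ : Plane → Plane} (h : IsTest φ) (i : Fin 2) :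
    IsTest (fun x => φ x i) := by
  refine ⟨contDiff_euclidean.1 h.1 i, ?_⟩
  exact h.2.comp_left (g := fun y : Plane => y i) rfl

theorem IsTest.memLp {F : Type*} [NormedAddCommGroup F] [NormedSpace ℝ F] {φ : Plane → F}
    (h : IsTest φ) : MemLp φ 2 (volume : Measure Plane) :=
  h.1.continuous.memLp_of_hasCompactSupport h.2

theorem IsTest.add {F : Type*} [NormedAddCommGroup F] [NormedSpace ℝ F] {φ ψ : Plane → F}
    (h : IsTest φ) (h' : IsTest ψ) : IsTest (fun x => φ x + ψ x) :=
  ⟨h.1.add h'.1, h.2.add h'.2⟩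

/-! ## The spaces `Hⁿ`, `Ḣⁿ`, `Xⁿ`, `Yⁿ` -/

/-- `L²(ℝ²)`. -/
abbrev L2 : Type := Lp ℝ 2 (volume : Measure Plane)

/-- `L²(ℝ²)²`. -/
abbrev L2V : Type := Lp Plane 2 (volume : Measure Plane)

/-- `f ∈ Hⁿ(ℝ²)`. -/
def MemH (n : ℕ) (f : Plane → ℝ) : Prop :=
  ∀ α : Fin 2 → ℕ, ∑ i, α i ≤ n →
    ∃ g, MemLp g 2 (volume : Measure Plane) ∧ HasWeakDeriv α f g

/-- `b ∈ Ḣⁿ⁺¹(ℝ²)`: `b ∈ L²_loc` and `∇b ∈ (Hⁿ)²`. -/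
def MemHdotSucc (n : ℕ) (b : Plane → ℝ) : Prop :=
  (∀ K : Set Plane, IsCompact K → MemLp b 2 (volume.restrict K)) ∧
    ∀ i : Fin 2, ∃ g, HasWeakDeriv (Pi.single i 1) b g ∧ MemH n g

/-- `ζ ∈ C⁰([0,T]; Hⁿ)`: all `∂^α ζ`, `|α| ≤ n`, are continuous from `[0,T]` to `L²`. -/
def ContH (n : ℕ) (T : ℝ) (ζ : ℝ → L2) : Prop :=
  ∀ α : Fin 2 → ℕ, ∑ i, α i ≤ n → ∃ D : ℝ → L2, ContinuousOn D (Icc 0 T) ∧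
    ∀ t ∈ Icc 0 T, HasWeakDeriv α (ζ t) (D t)

theorem HasWeakDiv.add {w w' : Plane → Plane} {d d' : Plane → ℝ}
    (h : HasWeakDiv w d) (h' : HasWeakDiv w' d') :
    HasWeakDiv (fun x => w x + w' x) (fun x => d x + d' x) := by
  refine ⟨h.1.add h'.1, h.2.1.add h'.2.1, fun φ hφ => ?_⟩
  have int1 : ∀ (v : Plane → Plane), LocallyIntegrable v volume →
      Integrable (fun x => ∑ i, v x i * pd i φ x) volume := by
    intro v hv
    refine integrable_finsetSum _ fun i _ => ?_
    have hi : LocallyIntegrable (fun x => v x i) volume := fun x => by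
      obtain ⟨s, hs, hs'⟩ := hv x
      exact ⟨s, hs, (EuclideanSpace.proj (𝕜 := ℝ) i).integrable_comp hs'⟩
    have := hi.integrable_smul_right_of_hasCompactSupport (hφ.pderiv i).1.continuous (hφ.pderiv i).2
    simpa [smul_eq_mul] using this
  have int2 : ∀ (v : Plane → ℝ), LocallyIntegrable v volume →
      Integrable (fun x => v x * φ x) volume := by
    intro v hv
    have := hv.integrable_smul_right_of_hasCompactSupport hφ.1.continuous hφ.2
    simpa [smul_eq_mul] using this
  have e1 : (fun x => ∑ i, (w x + w' x) i * pd i φ x)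
      = fun x => (∑ i, w x i * pd i φ x) + ∑ i, w' x i * pd i φ x := by
    funext x
    rw [← Finset.sum_add_distrib]
    exact Finset.sum_congr rfl fun i _ => by simp [add_mul]
  have e2 : (fun x => (d x + d' x) * φ x) = fun x => d x * φ x + d' x * φ x := by
    funext x; ring
  rw [e1, e2, integral_add (int1 w h.1) (int1 w' h'.1),
    integral_add (int2 d h.2.1) (int2 d' h'.2.1), h.2.2 φ hφ, h'.2.2 φ hφ]
  ring

theorem HasWeakDiv.const_smul {w : Plane → Plane} {d : Plane → ℝ} (c : ℝ)
    (h : HasWeakDiv w d) : HasWeakDiv (fun x => c • w x) (fun x => c * d x) := by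
  refine ⟨h.1.smul c, h.2.1.smul c, fun φ hφ => ?_⟩
  have e1 : (fun x => ∑ i, (c • w x) i * pd i φ x) = fun x => c * ∑ i, w x i * pd i φ x := by
    funext x
    rw [Finset.mul_sum]
    exact Finset.sum_congr rfl fun i _ => by simp [mul_assoc]
  have e2 : (fun x => c * d x * φ x) = fun x => c * (d x * φ x) := by
    funext x; ring
  rw [e1, e2, integral_const_mul, integral_const_mul, h.2.2 φ hφ]
  ring

theorem HasWeakDiv.congr {w w' : Plane → Plane} {d d' : Plane → ℝ} (h : HasWeakDiv w d)
    (hw : w =ᵐ[volume] w') (hd : d =ᵐ[volume] d') : HasWeakDiv w' d' := by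
  refine ⟨h.1.congr hw, h.2.1.congr hd, fun φ hφ => ?_⟩
  have e1 : ∫ x, ∑ i, w' x i * pd i φ x = ∫ x, ∑ i, w x i * pd i φ x :=
    integral_congr_ae (hw.mono fun x hx => by simp only [hx])
  have e2 : ∫ x, d' x * φ x = ∫ x, d x * φ x :=
    integral_congr_ae (hd.mono fun x hx => by simp only [hx])
  rw [e1, e2, h.2.2 φ hφ]

/-- The Hilbert space `X⁰ = {u ∈ L²(ℝ²)² : √μ ∇⬝u ∈ L²(ℝ²)}`, realised as the space of pairs
`(u, √μ ∇⬝u)` in `L²(ℝ²)² × L²(ℝ²)`, so that `‖u‖² = ‖u‖²_{L²} + μ ‖∇⬝u‖²_{L²}`. -/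
def X0sub (μ : ℝ) : Submodule ℝ (WithLp 2 (L2V × L2)) where
  carrier := {p | HasWeakDiv (fun x => √μ • p.fst x) p.snd}
  add_mem' := by
    intro p q hp hq
    refine (HasWeakDiv.add hp hq).congr ?_ ?_
    · filter_upwards [Lp.coeFn_add p.fst q.fst] with x hx
      rw [WithLp.add_fst, hx, Pi.add_apply, smul_add]
    · filter_upwards [Lp.coeFn_add p.snd q.snd] with x hx
      rw [WithLp.add_snd, hx, Pi.add_apply]
  zero_mem' := by
    have h0 : HasWeakDiv (fun _ => 0) (fun _ => 0) :=
      ⟨locallyIntegrable_const 0, locallyIntegrable_const 0, fun φ _ => by simp⟩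
    refine h0.congr ?_ ?_
    · filter_upwards [Lp.coeFn_zero Plane 2 (volume : Measure Plane)] with x hx
      rw [WithLp.zero_fst, hx, Pi.zero_apply, smul_zero]
    · filter_upwards [Lp.coeFn_zero ℝ 2 (volume : Measure Plane)] with x hx
      rw [WithLp.zero_snd, hx, Pi.zero_apply]
  smul_mem' := by
    intro c p hp
    refine (HasWeakDiv.const_smul c hp).congr ?_ ?_
    · filter_upwards [Lp.coeFn_smul c p.fst] with x hx
      rw [WithLp.smul_fst, hx, Pi.smul_apply, smul_comm]
    · filter_upwards [Lp.coeFn_smul c p.snd] with x hx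
      rw [WithLp.smul_snd, hx, Pi.smul_apply, smul_eq_mul]

/-- The space `X⁰`. -/
abbrev X0 (μ : ℝ) : Type := X0sub μ

/-- The space `Y⁰ = (X⁰)'`, the topological dual. -/
abbrev Y0 (μ : ℝ) : Type := StrongDual ℝ (X0 μ)

/-- The underlying field `u ∈ L²(ℝ²)²` of an element of `X⁰`. -/
def velX (μ : ℝ) : X0 μ →L[ℝ] L2V := (WithLp.fstL 2 ℝ L2V L2).comp (X0sub μ).subtypeL

/-- The divergence `∇⬝u ∈ L²(ℝ²)` of an element of `X⁰` (for `μ > 0`). -/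
def divX (μ : ℝ) : X0 μ →L[ℝ] L2 :=
  (√μ)⁻¹ • (WithLp.sndL 2 ℝ L2V L2).comp (X0sub μ).subtypeL

/-- `u ∈ C⁰([0,T]; Xⁿ)`: all `∂^α u`, `|α| ≤ n`, are continuous from `[0,T]` to `X⁰`. -/
def ContX (μ : ℝ) (n : ℕ) (T : ℝ) (u : ℝ → X0 μ) : Prop :=
  ∀ α : Fin 2 → ℕ, ∑ i, α i ≤ n → ∃ D : ℝ → X0 μ, ContinuousOn D (Icc 0 T) ∧
    ∀ t ∈ Icc 0 T, ∀ i : Fin 2,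
      HasWeakDeriv α (fun x => velX μ (u t) x i) (fun x => velX μ (D t) x i)

theorem IsTest.hasWeakDiv {φ : Plane → Plane} (h : IsTest φ) :
    HasWeakDiv φ (fun x => ∑ i, pd i (fun y => φ y i) x) := by
  have hd : ∀ i, IsTest (pd i (fun y => φ y i)) := fun i => (h.comp_apply i).pderiv i
  refine ⟨h.1.continuous.locallyIntegrable, ?_, fun ψ hψ => ?_⟩
  · exact (continuous_finsetSum _ fun i _ => (hd i).1.continuous).locallyIntegrable
  · have intg : ∀ f g : Plane → ℝ, IsTest f → IsTest g →
        Integrable (fun x => f x * g x) volume := fun f g hf hg =>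
      (hf.1.continuous.mul hg.1.continuous).integrable_of_hasCompactSupport hf.2.mul_right
    simp_rw [Finset.sum_mul]
    rw [integral_finsetSum _ fun i _ => intg _ _ (h.comp_apply i) (hψ.pderiv i),
      integral_finsetSum _ fun i _ => intg _ _ (hd i) hψ, ← Finset.sum_neg_distrib]
    refine Finset.sum_congr rfl fun i _ => ?_
    exact integral_mul_fderiv_eq_neg_fderiv_mul_of_integrable (intg _ _ (hd i) hψ)
      (intg _ _ (h.comp_apply i) (hψ.pderiv i)) (intg _ _ (h.comp_apply i) hψ)
      (fun x _ => ((h.comp_apply i).1.differentiable (by simp)).differentiableAt)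
      (fun x _ => (hψ.1.differentiable (by simp)).differentiableAt)

theorem IsTest.memLp_div {φ : Plane → Plane} (h : IsTest φ) :
    MemLp (fun x => ∑ i, pd i (fun y => φ y i) x) 2 (volume : Measure Plane) :=
  memLp_finsetSum _ fun i _ => ((h.comp_apply i).pderiv i).memLp

/-- A test vector field as an element of `X⁰`. -/
def testX (μ : ℝ) (φ : Plane → Plane) (h : IsTest φ) : X0 μ :=
  ⟨WithLp.toLp 2 (h.memLp.toLp φ, √μ • h.memLp_div.toLp _), by
    refine (HasWeakDiv.const_smul (√μ) h.hasWeakDiv).congr ?_ ?_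
    · filter_upwards [h.memLp.coeFn_toLp] with x hx
      rw [WithLp.toLp_fst, hx]
    · filter_upwards [h.memLp_div.coeFn_toLp,
        Lp.coeFn_smul (√μ) (h.memLp_div.toLp _)] with x hx hx'
      rw [WithLp.toLp_snd, hx', Pi.smul_apply, hx, smul_eq_mul]⟩

/-- `w = ∂^α v` in the sense of distributions, for `v, w ∈ (X⁰)'`. -/
def HasDerivY (μ : ℝ) (α : Fin 2 → ℕ) (v w : Y0 μ) : Prop :=
  ∀ (φ : Plane → Plane) (h : IsTest φ),
    w (testX μ φ h) = (-1 : ℝ) ^ (∑ i, α i) * v (testX μ (mderiv α φ) (h.multideriv α))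

/-- `v ∈ C⁰([0,T]; Yⁿ)`: all `∂^α v`, `|α| ≤ n`, are continuous from `[0,T]` to `(X⁰)'`. -/
def ContY (μ : ℝ) (n : ℕ) (T : ℝ) (v : ℝ → Y0 μ) : Prop :=
  ∀ α : Fin 2 → ℕ, ∑ i, α i ≤ n → ∃ D : ℝ → Y0 μ, ContinuousOn D (Icc 0 T) ∧
    ∀ t ∈ Icc 0 T, HasDerivY μ α (v t) (D t)

/-! ## Elements of `(X⁰)'` and operations on them -/

open Classical in
/-- An `L²` vector field `f` as the element `w ↦ ∫ f ⬝ w` of `(X⁰)'`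
(`0` if `f` is not in `L²`). -/
def toY (μ : ℝ) (f : Plane → Plane) : Y0 μ :=
  if h : MemLp f 2 (volume : Measure Plane) then (innerSL ℝ (h.toLp f)).comp (velX μ) else 0

open Classical in
/-- The distributional gradient `∇F ∈ (X⁰)'` of an `L²` function, `w ↦ -∫ F ∇⬝w`
(`0` if `F` is not in `L²`). -/
def gradY (μ : ℝ) (F : Plane → ℝ) : Y0 μ :=
  if h : MemLp F 2 (volume : Measure Plane) then -(innerSL ℝ (h.toLp F)).comp (divX μ) else 0

open Classical in
/-- Multiplication by `f` as a bounded operator on `X⁰` (`0` if `f` is not a multiplier). -/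
def mulX (μ : ℝ) (f : Plane → ℝ) : X0 μ →L[ℝ] X0 μ :=
  if h : ∃ M : X0 μ →L[ℝ] X0 μ, ∀ w, velX μ (M w) =ᵐ[volume] fun x => f x • velX μ w x
  then h.choose else 0

/-- Multiplication of `v ∈ (X⁰)'` by `f`, that is `⟨f v, w⟩ = ⟨v, f w⟩`. -/
def mulY (μ : ℝ) (f : Plane → ℝ) (v : Y0 μ) : Y0 μ := v.comp (mulX μ f)

theorem IsTest.rotGrad {φ : Plane → ℝ} (h : IsTest φ) :
    IsTest (fun x => (!₂[pd 1 φ x, -pd 0 φ x] : Plane)) := by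
  have e : (fun x => (!₂[pd 1 φ x, -pd 0 φ x] : Plane))
      = fun x => pd 1 φ x • EuclideanSpace.single (0 : Fin 2) (1 : ℝ)
        + pd 0 φ x • (-EuclideanSpace.single (1 : Fin 2) (1 : ℝ)) := by
    funext x; ext i; fin_cases i <;> simp
  rw [e]
  exact IsTest.add ⟨(h.pderiv 1).1.smul contDiff_const, (h.pderiv 1).2.smul_right⟩
    ⟨(h.pderiv 0).1.smul contDiff_const, (h.pderiv 0).2.smul_right⟩

/-- `κ = curl v = ∂₁ v₂ - ∂₂ v₁` in the sense of distributions, for `v ∈ (X⁰)'`. -/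
def HasCurl (μ : ℝ) (v : Y0 μ) (κ : Plane → ℝ) : Prop :=
  LocallyIntegrable κ volume ∧ ∀ (φ : Plane → ℝ) (h : IsTest φ),
    ∫ x, κ x * φ x = v (testX μ _ h.rotGrad)

open Classical in
/-- The function `curl v` (determined up to a null set; `0` if it is not a function). -/
def curlY (μ : ℝ) (v : Y0 μ) : Plane → ℝ := if h : ∃ κ, HasCurl μ v κ then h.choose else 0

/-! ## The operators of the Green-Naghdi systems

`h` is the water depth, `b` the bottom, `β` and `μ` are parameters. -/

/-- `β ∇b`. -/
def bslope (β : ℝ) (b : Plane → ℝ) : Plane → Plane := fun x => β • wgrad b x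

/-- The water depth `h = 1 + ε ζ - β b`. -/
def depth (ε β : ℝ) (b : Plane → ℝ) (z : L2) : Plane → ℝ := fun x => 1 + ε * z x - β * b x

/-- `𝒯[h,βb]u = -1/(3h) ∇(h³ ∇⬝u) + 1/(2h) (∇(h² (β∇b)⬝u) - h² (β∇b) ∇⬝u) + β² (∇b⬝u) ∇b`,
as an operator from `X⁰` to `(X⁰)'`. -/
def opT (μ β : ℝ) (b h : Plane → ℝ) (u : X0 μ) : Y0 μ :=
  -(1 / 3 : ℝ) • mulY μ h⁻¹ (gradY μ (h ^ 3 * divX μ u))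
    + (1 / 2 : ℝ) • mulY μ h⁻¹ (gradY μ (h ^ 2 * dotp (bslope β b) (velX μ u))
        - toY μ ((h ^ 2 * divX μ u) • bslope β b))
    + β ^ 2 • toY μ (dotp (wgrad b) (velX μ u) • wgrad b)

/-- `𝔗[h,βb]u = h u + μ h 𝒯[h,βb]u`. -/
def opFrakT (μ β : ℝ) (b h : Plane → ℝ) (u : X0 μ) : Y0 μ :=
  toY μ (h • ⇑(velX μ u)) + μ • mulY μ h (opT μ β b h u)

/-- The inverse `𝔗[h,βb]⁻¹ : (X⁰)' → X⁰`. -/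
def opFrakTinv (μ β : ℝ) (b h : Plane → ℝ) : Y0 μ → X0 μ := Function.invFun (opFrakT μ β b h)

/-- The scalar `(u⬝∇)(∇⬝u) - (∇⬝u)²`. -/
def quadDiv (μ : ℝ) (u : X0 μ) : Plane → ℝ := adv (velX μ u) (divX μ u) - ⇑(divX μ u) ^ 2

/-- The scalar `(u⬝∇)² b`. -/
def adv2 (μ : ℝ) (b : Plane → ℝ) (u : X0 μ) : Plane → ℝ := adv (velX μ u) (adv (velX μ u) b)

/-- `𝒬[h,u] = -1/(3h) ∇(h³ ((u⬝∇)(∇⬝u) - (∇⬝u)²))`. -/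
def opQ (μ : ℝ) (h : Plane → ℝ) (u : X0 μ) : Y0 μ :=
  -(1 / 3 : ℝ) • mulY μ h⁻¹ (gradY μ (h ^ 3 * quadDiv μ u))

/-- `𝒬_b[h,βb,u] = β/(2h) (∇(h² (u⬝∇)²b) - h² ((u⬝∇)(∇⬝u) - (∇⬝u)²) ∇b) + β² ((u⬝∇)²b) ∇b`. -/
def opQb (μ β : ℝ) (b h : Plane → ℝ) (u : X0 μ) : Y0 μ :=
  (β / 2) • mulY μ h⁻¹ (gradY μ (h ^ 2 * adv2 μ b u) - toY μ ((h ^ 2 * quadDiv μ u) • wgrad b))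
    + β ^ 2 • toY μ (adv2 μ b u • wgrad b)

/-- `ℛ[h,u] = u/(3h) ⬝ ∇(h³ ∇⬝u) + (1/2) h² (∇⬝u)²`. -/
def opR (μ : ℝ) (h : Plane → ℝ) (u : X0 μ) : Plane → ℝ :=
  fun x => 1 / (3 * h x) * adv (velX μ u) (h ^ 3 * divX μ u) x
    + 1 / 2 * h x ^ 2 * divX μ u x ^ 2

/-- `ℛ_b[h,βb,u] = -(1/2) (u/h ⬝ ∇(h² (β∇b⬝u)) + h (β∇b⬝u) ∇⬝u + (β∇b⬝u)²)`. -/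
def opRb (μ β : ℝ) (b h : Plane → ℝ) (u : X0 μ) : Plane → ℝ :=
  fun x => -(1 / 2) * (1 / h x * adv (velX μ u) (h ^ 2 * dotp (bslope β b) (velX μ u)) x
    + h x * dotp (bslope β b) (velX μ u) x * divX μ u x
    + dotp (bslope β b) (velX μ u) x ^ 2)

/-! ## The two systems -/

/-- `(ζ,u)` satisfies, on the time interval `[0,T]`,
`∂ₜζ + ∇⬝(h u) = 0` and
`(Id + μ 𝒯[h,βb]) ∂ₜu + ∇ζ + ε (u⬝∇)u + μ ε (𝒬[h,u] + 𝒬_b[h,βb,u]) = 0`.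
Time derivatives are taken in `L²` and in `X⁰`; the second equation holds in `(X⁰)'`. -/
def SolvesGNu (ε β μ T : ℝ) (b : Plane → ℝ) (ζ : ℝ → L2) (u : ℝ → X0 μ) : Prop :=
  ∀ t ∈ Icc 0 T, ∃ (ζt : L2) (ut : X0 μ),
    HasDerivWithinAt ζ ζt (Icc 0 T) t ∧ HasDerivWithinAt u ut (Icc 0 T) t ∧
    HasWeakDiv (depth ε β b (ζ t) • ⇑(velX μ (u t))) (-⇑ζt) ∧
    (toY μ (velX μ ut) + μ • opT μ β b (depth ε β b (ζ t)) ut) + gradY μ (ζ t)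
      + ε • toY μ (advV (velX μ (u t)) (velX μ (u t)))
      + (μ * ε) • (opQ μ (depth ε β b (ζ t)) (u t) + opQb μ β b (depth ε β b (ζ t)) (u t)) = 0

/-- The velocity `u = 𝔗[h,βb]⁻¹ (h v)` associated with `(ζ,v)`. -/
def velOf (ε β μ : ℝ) (b : Plane → ℝ) (z : L2) (v : Y0 μ) : X0 μ :=
  opFrakTinv μ β b (depth ε β b z) (mulY μ (depth ε β b z) v)

/-- The variable `v = h⁻¹ 𝔗[h,βb]u` associated with `(ζ,u)`. -/
def vOf (ε β μ : ℝ) (b : Plane → ℝ) (z : L2) (u : X0 μ) : Y0 μ :=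
  mulY μ (depth ε β b z)⁻¹ (opFrakT μ β b (depth ε β b z) u)

/-- `(ζ,v)` satisfies, on the time interval `[0,T]` and with `u = 𝔗[h,βb]⁻¹ (h v)`,
`∂ₜζ + ∇⬝(h u) = 0` and
`(∂ₜ + ε u^⊥ curl) v + ∇ζ + (ε/2) ∇|u|² = μ ε ∇(ℛ[h,u] + ℛ_b[h,βb,u])`.
Time derivatives are taken in `L²` and in `(X⁰)'`; the second equation holds in `(X⁰)'`. -/
def SolvesGNv (ε β μ T : ℝ) (b : Plane → ℝ) (ζ : ℝ → L2) (v : ℝ → Y0 μ) : Prop :=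
  ∀ t ∈ Icc 0 T, ∃ (ζt : L2) (vt : Y0 μ),
    HasDerivWithinAt ζ ζt (Icc 0 T) t ∧ HasDerivWithinAt v vt (Icc 0 T) t ∧
    HasWeakDiv (depth ε β b (ζ t) • ⇑(velX μ (velOf ε β μ b (ζ t) (v t)))) (-⇑ζt) ∧
    (vt + ε • toY μ (curlY μ (v t) • perp (velX μ (velOf ε β μ b (ζ t) (v t)))))
      + gradY μ (ζ t)
      + (ε / 2) • gradY μ (fun x => ‖velX μ (velOf ε β μ b (ζ t) (v t)) x‖ ^ 2)
      = (μ * ε) • gradY μ (opR μ (depth ε β b (ζ t)) (velOf ε β μ b (ζ t) (v t))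
          + opRb μ β b (depth ε β b (ζ t)) (velOf ε β μ b (ζ t) (v t)))

end

/-!
The two systems are the same evolution law in two sets of unknowns, related by
`h v = 𝔗[h,βb] u`. The proof has three ingredients.

*Elliptic regularity.* `𝔗` is the operator of a coercive form on `X⁰`, hence bijective from `X⁰`
to `(X⁰)'` (`bijective_frak0`). That its inverse preserves four derivatives is seen by translating:
`X⁰`, `(X⁰)'` and `L²` carry isometric actions of the plane (`TransAct`), a derivative is the
generator of the action along an axis (`IsGen`), and an operator whose conjugates by translations
depend differentiably, in operator norm, on the translation (`DiffOp`) has a solution operator that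
maps differentiable vectors to differentiable vectors (`DiffOp.regularity`). Iterating the space
`DV E` of differentiable vectors gives `Hⁿ`, `Xⁿ`, `Yⁿ`, and the passage between families of weak
derivatives and elements of these spaces is `IsTower.exists_lift`. Since inversion of operators is
continuous, `v ∈ C⁰([0,T]; Y⁴)` if and only if `u ∈ C⁰([0,T]; X⁴)`. The coefficients are only
bounded, with derivatives in `H³`: the depth lives in the space `DV CK`, where `CK` consists of the
bounded continuous functions with gradient in `H²`. The Sobolev embedding `H² → C_b` (`sobolev`)
makes it act on `H⁴`.

*Time derivatives.* Conservation of mass says `∂ₜζ = -∇⬝(h u)`, and the right-hand side is a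
continuous curve in `H³`; so the depth is differentiable in time with values in `CK`
(`FlowData.hasDerivWithinAt_h`), the operators `𝔗` and `h` are differentiable in operator norm, and
`u` and `v` are differentiable at the same times. Differentiating `h v = 𝔗 u` gives
`(∂ₜh) v + h ∂ₜv = (∂ₜ𝔗) u + 𝔗 ∂ₜu` (`hasDerivWithinAt_relation`).

*An algebraic identity.* At a fixed time, inserting `∂ₜh = -ε ∇⬝(h u)`, the difference
`(∂ₜ𝔗) u - (∂ₜh) v` is exactly the discrepancy between `h` times the nonlinear terms of the two
momentum equations (`Jets.flux_identity`). All the terms are square integrable fields given by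
polynomials in the derivatives of `h`, `u`, `∇⬝u` and `∇b`, so after identification of each of
them the identity is one of polynomials; it uses `∇⬝u = ∂₁u₁ + ∂₂u₂`, the symmetry of second
derivatives and the expression of `v` as a field, whose curl involves no third derivative.
As multiplication by `h` is injective on `(X⁰)'`, the momentum equations are equivalent
(`FlowData.momentum_eq`).
-/

noncomputable section

set_option linter.unusedSectionVars false

open Filter Topology

/-! ### Isometric actions of the plane and their generators -/

/-- A normed space with an isometric action of the translation group `ℝ²`. No continuity in the
group variable is required, so that bounded continuous functions with the sup norm qualify. The
norm is part of the class: this keeps the terms small in which spaces of differentiable vectors are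
iterated. -/
class TransAct (E : Type*) extends NormedAddCommGroup E, NormedSpace ℝ E where
  /-- The action of `x ∈ ℝ²`. -/
  tr : Plane → E →L[ℝ] E
  tr_zero : ∀ e, tr 0 e = e
  tr_add : ∀ x y e, tr (x + y) e = tr x (tr y e)
  norm_tr : ∀ x e, ‖tr x e‖ = ‖e‖

attribute [instance 100] TransAct.toNormedAddCommGroup TransAct.toNormedSpace

open TransAct

/-- The `i`-th unit vector of the plane. -/
def bv (i : Fin 2) : Plane := EuclideanSpace.single i 1

section Gen

variable {E F G : Type*} [TransAct E]
  [TransAct F]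
  [TransAct G]

theorem tr_comm (x y : Plane) (e : E) : tr x (tr y e) = tr y (tr x e) := by
  rw [← tr_add, ← tr_add, add_comm]

theorem tr_neg_tr (x : Plane) (e : E) : tr (-x) (tr x e) = e := by
  rw [← tr_add, neg_add_cancel, tr_zero]

theorem tr_tr_neg (x : Plane) (e : E) : tr x (tr (-x) e) = e := by
  rw [← tr_add, add_neg_cancel, tr_zero]

/-- `IsGen i e e'`: the orbit of `e` under translation along the `i`-th axis is differentiable,
with derivative `e'` at the origin. This is the strong form of `∂ᵢ e = e'` in `E`. -/
def IsGen (i : Fin 2) (e e' : E) : Prop :=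
  HasDerivAt (fun s : ℝ => tr (s • bv i) e) e' 0

/-- A bounded linear map commuting with translations. -/
class IsEq (A : E →L[ℝ] F) : Prop where
  map_tr : ∀ x e, A (tr x e) = tr x (A e)

/-- A bounded bilinear map commuting with translations. -/
class IsEq₂ (B : E →L[ℝ] F →L[ℝ] G) : Prop where
  map_tr : ∀ x e f, B (tr x e) (tr x f) = tr x (B e f)

/-- Strong continuity of the translation action. -/
class StrongAct (E : Type*) [TransAct E] : Prop where
  cont : ∀ e : E, Continuous fun x => tr x e

instance IsEq.id : IsEq (ContinuousLinearMap.id ℝ E) := ⟨fun _ _ => rfl⟩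

instance IsEq.comp (A : F →L[ℝ] G) (B : E →L[ℝ] F) [hA : IsEq A] [hB : IsEq B] :
    IsEq (A.comp B) :=
  ⟨fun x e => by simp [hA.map_tr, hB.map_tr]⟩

instance IsEq.tr (x : Plane) : IsEq (tr x : E →L[ℝ] E) := ⟨fun y e => tr_comm x y e⟩

theorem IsGen.hasDerivAt {i : Fin 2} {e e' : E} (h : IsGen i e e') (s : ℝ) :
    HasDerivAt (fun s : ℝ => tr (s • bv i) e) (tr (s • bv i) e') s := by
  have h0 : HasDerivAt (fun r : ℝ => tr (r • bv i) e) e' (s - s) := by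
    rw [sub_self]; exact h
  have h1 := (tr (s • bv i) : E →L[ℝ] E).hasFDerivAt.comp_hasDerivAt _
    (h0.comp_sub_const s s)
  refine h1.congr_of_eventuallyEq (Eventually.of_forall fun r => ?_)
  simp only [Function.comp]
  rw [← tr_add, ← add_smul]
  congr 2; ring_nf

theorem IsGen.unique {i : Fin 2} {e a b : E} (h : IsGen i e a) (h' : IsGen i e b) : a = b :=
  HasDerivAt.unique h h'

theorem IsGen.zero (i : Fin 2) : IsGen i (0 : E) 0 := by
  simpa [IsGen] using hasDerivAt_const (0 : ℝ) (0 : E)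

theorem IsGen.add {i : Fin 2} {e e' f f' : E} (h : IsGen i e e') (h' : IsGen i f f') :
    IsGen i (e + f) (e' + f') := by
  have := HasDerivAt.add h h'
  refine this.congr_of_eventuallyEq (Eventually.of_forall fun r => ?_)
  simp

theorem IsGen.const_smul {i : Fin 2} {e e' : E} (c : ℝ) (h : IsGen i e e') :
    IsGen i (c • e) (c • e') := by
  have := HasDerivAt.const_smul c h
  refine this.congr_of_eventuallyEq (Eventually.of_forall fun r => ?_)
  simp

theorem IsGen.neg {i : Fin 2} {e e' : E} (h : IsGen i e e') : IsGen i (-e) (-e') := by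
  simpa using h.const_smul (-1)

theorem IsGen.sub {i : Fin 2} {e e' f f' : E} (h : IsGen i e e') (h' : IsGen i f f') :
    IsGen i (e - f) (e' - f') := by
  simpa [sub_eq_add_neg] using h.add h'.neg

theorem IsGen.map {i : Fin 2} {e e' : E} (A : E →L[ℝ] F) [hA : IsEq A] (h : IsGen i e e') :
    IsGen i (A e) (A e') := by
  have := A.hasFDerivAt.comp_hasDerivAt (0 : ℝ) h
  refine this.congr_of_eventuallyEq (Eventually.of_forall fun r => ?_)
  simp [hA.map_tr]

theorem IsGen.tendsto_slope {i : Fin 2} {e e' : E} (h : IsGen i e e') :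
    Tendsto (fun s : ℝ => s⁻¹ • (tr (s • bv i) e - e)) (𝓝[≠] 0) (𝓝 e') := by
  have := hasDerivAt_iff_tendsto_slope.1 h
  refine this.congr fun s => ?_
  simp [slope_def_module, tr_zero]

theorem isGen_of_tendsto_slope {i : Fin 2} {e e' : E}
    (h : Tendsto (fun s : ℝ => s⁻¹ • (tr (s • bv i) e - e)) (𝓝[≠] 0) (𝓝 e')) :
    IsGen i e e' := by
  refine hasDerivAt_iff_tendsto_slope.2 (h.congr fun s => ?_)
  simp [slope_def_module, tr_zero]

theorem dist_tr (x : Plane) (e f : E) : dist (tr x e) (tr x f) = dist e f := by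
  rw [dist_eq_norm, dist_eq_norm, ← map_sub, norm_tr]

/-- The generator is a closed operator. -/
theorem IsGen.of_tendsto {ι : Type*} {l : Filter ι} [l.NeBot] {i : Fin 2} {e e' : ι → E}
    {a a' : E} (h : ∀ᶠ n in l, IsGen i (e n) (e' n)) (ha : Tendsto e l (𝓝 a))
    (ha' : Tendsto e' l (𝓝 a')) : IsGen i a a' := by
  have key := hasDerivAt_of_tendstoUniformly (l := l)
    (f := fun n (s : ℝ) => tr (s • bv i) (e n)) (f' := fun n (s : ℝ) => tr (s • bv i) (e' n))
    (g := fun s : ℝ => tr (s • bv i) a) (g' := fun s : ℝ => tr (s • bv i) a')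
    (by
      rw [Metric.tendstoUniformly_iff]
      intro ε hε
      filter_upwards [Metric.tendsto_nhds.1 ha' ε hε] with n hn s
      rw [dist_tr, dist_comm]; exact hn)
    (by filter_upwards [h] with n hn s using hn.hasDerivAt s)
    (fun s => ((tr (s • bv i) : E →L[ℝ] E).continuous.tendsto a).comp ha)
  simpa [tr_zero, IsGen] using key 0

/-- Generators along the two axes commute. -/
theorem IsGen.swap {i j : Fin 2} {e a b c : E} (ha : IsGen i e a) (hb : IsGen j e b)
    (hc : IsGen j a c) : IsGen i b c := by
  refine IsGen.of_tendsto (l := 𝓝[≠] (0 : ℝ)) (Eventually.of_forall fun s => ?_)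
    hb.tendsto_slope hc.tendsto_slope
  exact ((ha.map (tr (s • bv j))).sub ha).const_smul _

theorem plane_eq (x : Plane) : x = x 0 • bv 0 + x 1 • bv 1 := by
  ext i; fin_cases i <;> simp [bv]

/-- Leibniz rule: `∂ᵢ (m e) = (∂ᵢ m) e + m (∂ᵢ e)` for a product which makes sense in two ways,
with either factor in a rougher space (`jM m` and `jE e` are the rough copies of `m` and `e`). -/
theorem IsGen.leibniz {M M₁ E₁ : Type*} [TransAct M]
    [TransAct M₁]
    [TransAct E₁] [StrongAct E]
    (B₁ : M₁ →L[ℝ] E →L[ℝ] F) (B₂ : M →L[ℝ] E₁ →L[ℝ] F) [h₁ : IsEq₂ B₁]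
    (jM : M →L[ℝ] M₁) (jE : E →L[ℝ] E₁) [IsEq jM] [hjE : IsEq jE]
    (hc : ∀ m e, B₁ (jM m) e = B₂ m (jE e)) {i : Fin 2} {m : M} {e : E} {m' : M₁} {e' : E₁}
    (hm : IsGen i (jM m) m') (he : IsGen i (jE e) e') :
    IsGen i (B₁ (jM m) e) (B₁ m' e + B₂ m e') := by
  apply isGen_of_tendsto_slope
  have hcont : Tendsto (fun s : ℝ => tr (s • bv i) e) (𝓝[≠] 0) (𝓝 e) := by
    have h1 : Continuous fun s : ℝ => tr (s • bv i) e :=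
      (StrongAct.cont e).comp (by fun_prop)
    have := h1.tendsto 0
    simp only [zero_smul, tr_zero] at this
    exact this.mono_left nhdsWithin_le_nhds
  have t1 : Tendsto (fun s : ℝ => B₁ (s⁻¹ • (tr (s • bv i) (jM m) - jM m)) (tr (s • bv i) e))
      (𝓝[≠] 0) (𝓝 (B₁ m' e)) :=
    ((isBoundedBilinearMap_apply (𝕜 := ℝ) (E := E) (F := F)).continuous.tendsto (B₁ m', e)).comp
      (((B₁.continuous.tendsto m').comp hm.tendsto_slope).prodMk_nhds hcont)
  have t2 : Tendsto (fun s : ℝ => B₂ m (s⁻¹ • (tr (s • bv i) (jE e) - jE e)))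
      (𝓝[≠] 0) (𝓝 (B₂ m e')) :=
    ((B₂ m).continuous.tendsto e').comp he.tendsto_slope
  refine (t1.add t2).congr fun s => ?_
  rw [map_smul, map_smul, map_sub, map_sub, ← h₁.map_tr, ← hjE.map_tr, ← hc, ← hc,
    smul_apply, sub_apply, ← smul_add]
  congr 1; abel

end Gen

/-! ### Spaces of differentiable vectors -/

section DSub

variable {E F G M : Type*} [TransAct E]
  [TransAct F]
  [TransAct G]
  [TransAct M]

/-- The triples `(e, (f₀, f₁))` with `∂ᵢ e = J fᵢ`. -/
def derivPairs (J : F →L[ℝ] E) : Submodule ℝ (E × (Fin 2 → F)) where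
  carrier := {p | ∀ i, IsGen i p.1 (J (p.2 i))}
  add_mem' := fun hp hq i => by simpa using (hp i).add (hq i)
  zero_mem' := fun i => by simpa using IsGen.zero i
  smul_mem' := fun c p hp i => by simpa using (hp i).const_smul c

/-- The vectors `e ∈ E` whose generators `∂₀ e, ∂₁ e` exist in `E` and lie in the range of the
map `J : F → E`, realised as the triples `(e, (f₀, f₁))` with `∂ᵢ e = J fᵢ`. This is a type of its
own, not a coerced submodule, so that iterating the construction keeps instances small. -/
def dsub (J : F →L[ℝ] E) : Type _ := derivPairs J

instance (J : F →L[ℝ] E) : NormedAddCommGroup (dsub J) := Submodule.normedAddCommGroup _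

instance (J : F →L[ℝ] E) : NormedSpace ℝ (dsub J) := Submodule.normedSpace (derivPairs J)

/-- The inclusion of `dsub J` in the product space. -/
def dsub.toProd (J : F →L[ℝ] E) : dsub J →L[ℝ] E × (Fin 2 → F) := (derivPairs J).subtypeL

namespace dsub

variable (J : F →L[ℝ] E)

/-- The underlying vector `e`. -/
def base : dsub J →L[ℝ] E := (ContinuousLinearMap.fst ℝ E (Fin 2 → F)).comp (toProd J)

/-- The component `fᵢ`, which stands for `∂ᵢ e`. -/
def der (i : Fin 2) : dsub J →L[ℝ] F :=
  ((ContinuousLinearMap.proj i).comp (ContinuousLinearMap.snd ℝ E (Fin 2 → F))).comp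
    (toProd J)

variable {J}

theorem isGen (p : dsub J) (i : Fin 2) : IsGen i (base J p) (J (der J i p)) := p.2 i

theorem ext {p q : dsub J} (h : base J p = base J q) (h' : ∀ i, der J i p = der J i q) :
    p = q :=
  Subtype.ext (Prod.ext h (funext h'))

theorem ext_of_injective (hJ : Function.Injective J) {p q : dsub J} (h : base J p = base J q) :
    p = q :=
  ext h fun i => hJ ((isGen p i).unique (h ▸ isGen q i))

/-- Corestriction of a map whose values are derivative pairs. -/
def codRestrict {G : Type*} [NormedAddCommGroup G] [NormedSpace ℝ G]
    (L : G →L[ℝ] E × (Fin 2 → F)) (h : ∀ g, L g ∈ derivPairs J) : G →L[ℝ] dsub J :=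
  L.codRestrict (derivPairs J) h

/-- Constructor for elements of `dsub J`. -/
def mk (e : E) (f : Fin 2 → F) (h : ∀ i, IsGen i e (J (f i))) : dsub J := ⟨(e, f), h⟩

@[simp] theorem base_mk (e : E) (f : Fin 2 → F) (h : ∀ i, IsGen i e (J (f i))) :
    base J (mk e f h) = e := rfl

@[simp] theorem der_mk (e : E) (f : Fin 2 → F) (h : ∀ i, IsGen i e (J (f i))) (i : Fin 2) :
    der J i (mk e f h) = f i := rfl

/-- The action of translations, componentwise. -/
def trans [IsEq J] (x : Plane) : dsub J →L[ℝ] dsub J :=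
  codRestrict (((TransAct.tr x : E →L[ℝ] E).comp (base J)).prod
    (ContinuousLinearMap.pi fun i => (TransAct.tr x : F →L[ℝ] F).comp (der J i)))
      fun p i => by
        have := (isGen p i).map (TransAct.tr x)
        rw [← IsEq.map_tr (A := J)] at this
        exact this

theorem norm_trans [IsEq J] (x : Plane) (p : dsub J) : ‖trans x p‖ = ‖p‖ := by
  refine congrArg₂ max (TransAct.norm_tr x (base J p)) ?_
  simp only [Pi.norm_def, nnnorm]
  congr 2
  funext i
  exact Subtype.ext (TransAct.norm_tr x (der J i p))

instance [IsEq J] : TransAct (dsub J) where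
  toNormedAddCommGroup := inferInstance
  toNormedSpace := inferInstance
  tr := trans
  tr_zero p := ext (TransAct.tr_zero (base J p)) fun i => TransAct.tr_zero (der J i p)
  tr_add x y p := ext (TransAct.tr_add x y (base J p)) fun i => TransAct.tr_add x y (der J i p)
  norm_tr := norm_trans

instance [IsEq J] : IsEq (base J) := ⟨fun _ _ => rfl⟩
instance [IsEq J] (i : Fin 2) : IsEq (der J i) := ⟨fun _ _ => rfl⟩

instance [CompleteSpace E] [CompleteSpace F] : CompleteSpace (dsub J) := by
  have : IsClosed (derivPairs J : Set (E × (Fin 2 → F))) := by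
    refine isClosed_of_closure_subset fun p hp i => ?_
    obtain ⟨u, hu, hup⟩ := mem_closure_iff_seq_limit.1 hp
    refine IsGen.of_tendsto (Eventually.of_forall fun n => hu n i)
      ((continuous_fst.tendsto p).comp hup) ?_
    exact (J.continuous.tendsto _).comp ((continuous_apply i).tendsto _ |>.comp
      ((continuous_snd.tendsto p).comp hup))
  exact this.completeSpace_coe

theorem isEmbedding_aux : IsInducing (fun p : dsub J => (base J p, fun i => der J i p)) :=
  IsInducing.subtypeVal

theorem tendsto_iff {ι : Type*} {l : Filter ι} {p : ι → dsub J} {q : dsub J} :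
    Tendsto p l (𝓝 q) ↔ Tendsto (fun n => base J (p n)) l (𝓝 (base J q)) ∧
      ∀ i, Tendsto (fun n => der J i (p n)) l (𝓝 (der J i q)) := by
  rw [isEmbedding_aux.tendsto_nhds_iff, nhds_prod_eq, tendsto_prod_iff', tendsto_pi_nhds]
  rfl

theorem continuousOn_iff {T : Type*} [TopologicalSpace T] {s : Set T} {p : T → dsub J} :
    ContinuousOn p s ↔ ContinuousOn (fun t => base J (p t)) s ∧
      ∀ i, ContinuousOn (fun t => der J i (p t)) s := by
  simp only [ContinuousOn, ContinuousWithinAt, tendsto_iff]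
  exact ⟨fun h => ⟨fun t ht => (h t ht).1, fun i t ht => (h t ht).2 i⟩,
    fun h t ht => ⟨h.1 t ht, fun i => h.2 i t ht⟩⟩

instance [IsEq J] [StrongAct E] [StrongAct F] : StrongAct (dsub J) :=
  ⟨fun p => isEmbedding_aux.continuous_iff.2 <|
    (StrongAct.cont (base J p)).prodMk (continuous_pi fun i => StrongAct.cont (der J i p))⟩

/-- Generators in `dsub J` are computed componentwise. -/
theorem isGen_iff [IsEq J] {i : Fin 2} {p q : dsub J} :
    IsGen i p q ↔ IsGen i (base J p) (base J q) ∧ ∀ j, IsGen i (der J j p) (der J j q) := by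
  refine ⟨fun h => ⟨h.map _, fun j => h.map _⟩, fun h => isGen_of_tendsto_slope ?_⟩
  rw [tendsto_iff]
  refine ⟨?_, fun j => ?_⟩
  · simpa [IsEq.map_tr] using h.1.tendsto_slope
  · simpa [IsEq.map_tr] using (h.2 j).tendsto_slope

/-- A linear map into `dsub J` from its components. -/
def lift (L₀ : G →L[ℝ] E) (L : Fin 2 → G →L[ℝ] F) (h : ∀ g i, IsGen i (L₀ g) (J (L i g))) :
    G →L[ℝ] dsub J :=
  codRestrict (L₀.prod (ContinuousLinearMap.pi L)) h

@[simp] theorem base_lift (L₀ : G →L[ℝ] E) (L : Fin 2 → G →L[ℝ] F)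
    (h : ∀ g i, IsGen i (L₀ g) (J (L i g))) (g : G) : base J (lift L₀ L h g) = L₀ g := rfl

@[simp] theorem der_lift (L₀ : G →L[ℝ] E) (L : Fin 2 → G →L[ℝ] F)
    (h : ∀ g i, IsGen i (L₀ g) (J (L i g))) (g : G) (i : Fin 2) :
    der J i (lift L₀ L h g) = L i g := rfl

theorem lift_isEq [IsEq J] (L₀ : G →L[ℝ] E) (L : Fin 2 → G →L[ℝ] F)
    (h : ∀ g i, IsGen i (L₀ g) (J (L i g))) [h₀ : IsEq L₀] (h₁ : ∀ i, IsEq (L i)) :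
    IsEq (lift L₀ L h) :=
  ⟨fun x g => ext (h₀.map_tr x g) fun i => (h₁ i).map_tr x g⟩

/-- A bilinear map into `dsub J` from its components. -/
def lift₂ (P₀ : M →L[ℝ] G →L[ℝ] E) (P : Fin 2 → M →L[ℝ] G →L[ℝ] F)
    (h : ∀ m g i, IsGen i (P₀ m g) (J (P i m g))) : M →L[ℝ] G →L[ℝ] dsub J :=
  LinearMap.mkContinuous
    { toFun := fun m => lift (P₀ m) (fun i => P i m) (h m)
      map_add' := fun m m' => by
        refine ContinuousLinearMap.ext fun g => dsub.ext ?_ fun i => ?_ <;> simp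
      map_smul' := fun c m => by
        refine ContinuousLinearMap.ext fun g => dsub.ext ?_ fun i => ?_ <;> simp }
    (max ‖P₀‖ ‖P‖) fun m => by
      refine ContinuousLinearMap.opNorm_le_bound _ (by positivity) fun g => ?_
      refine max_le ?_ ?_
      · refine (P₀.le_opNorm₂ m g).trans ?_
        gcongr; exact le_max_left _ _
      · refine (pi_norm_le_iff_of_nonneg (by positivity)).2 fun i => ?_
        refine ((P i).le_opNorm₂ m g).trans ?_
        gcongr
        exact (norm_le_pi_norm P i).trans (le_max_right _ _)

theorem lift₂_isEq [IsEq J] (P₀ : M →L[ℝ] G →L[ℝ] E) (P : Fin 2 → M →L[ℝ] G →L[ℝ] F)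
    (h : ∀ m g i, IsGen i (P₀ m g) (J (P i m g))) [h₀ : IsEq₂ P₀] (h₁ : ∀ i, IsEq₂ (P i)) :
    IsEq₂ (lift₂ P₀ P h) :=
  ⟨fun x m g => ext (h₀.map_tr x m g) fun i => (h₁ i).map_tr x m g⟩

end dsub

/-- The space of differentiable vectors: `e ∈ E` with `∂₀ e, ∂₁ e ∈ E`. -/
def DV (E : Type*) [TransAct E] : Type _ := dsub (ContinuousLinearMap.id ℝ E)

namespace DV

instance : TransAct (DV E) := inferInstanceAs (TransAct (dsub (ContinuousLinearMap.id ℝ E)))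

instance [CompleteSpace E] : CompleteSpace (DV E) :=
  inferInstanceAs (CompleteSpace (dsub (ContinuousLinearMap.id ℝ E)))

instance [StrongAct E] : StrongAct (DV E) :=
  inferInstanceAs (StrongAct (dsub (ContinuousLinearMap.id ℝ E)))

/-- The underlying vector of a differentiable vector. -/
def base : DV E →L[ℝ] E := dsub.base (ContinuousLinearMap.id ℝ E)

/-- `∂ᵢ` as a map from differentiable vectors. -/
def der (i : Fin 2) : DV E →L[ℝ] E := dsub.der (ContinuousLinearMap.id ℝ E) i

instance : IsEq (base : DV E →L[ℝ] E) := ⟨fun _ _ => rfl⟩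
instance (i : Fin 2) : IsEq (der i : DV E →L[ℝ] E) := ⟨fun _ _ => rfl⟩

theorem isGen (p : DV E) (i : Fin 2) : IsGen i (base p) (der i p) := p.2 i

theorem base_injective : Function.Injective (base : DV E →L[ℝ] E) := fun _ _ h =>
  dsub.ext_of_injective (J := ContinuousLinearMap.id ℝ E) (fun _ _ h => h) h

/-- Constructor for differentiable vectors. -/
def mk (e : E) (f : Fin 2 → E) (h : ∀ i, IsGen i e (f i)) : DV E := dsub.mk e f h

@[simp] theorem base_mk (e : E) (f : Fin 2 → E) (h : ∀ i, IsGen i e (f i)) :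
    base (mk e f h) = e := rfl

@[simp] theorem der_mk (e : E) (f : Fin 2 → E) (h : ∀ i, IsGen i e (f i)) (i : Fin 2) :
    der i (mk e f h) = f i := rfl

theorem continuousOn_iff {T : Type*} [TopologicalSpace T] {s : Set T} {p : T → DV E} :
    ContinuousOn p s ↔ ContinuousOn (fun t => base (p t)) s ∧
      ∀ i, ContinuousOn (fun t => der i (p t)) s :=
  dsub.continuousOn_iff

/-- A linear map into `DV E` from its components. -/
def lift (L₀ : G →L[ℝ] E) (L : Fin 2 → G →L[ℝ] E) (h : ∀ g i, IsGen i (L₀ g) (L i g)) :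
    G →L[ℝ] DV E :=
  dsub.lift L₀ L h

@[simp] theorem base_lift (L₀ : G →L[ℝ] E) (L : Fin 2 → G →L[ℝ] E)
    (h : ∀ g i, IsGen i (L₀ g) (L i g)) (g : G) : base (lift L₀ L h g) = L₀ g := rfl

theorem lift_isEq (L₀ : G →L[ℝ] E) (L : Fin 2 → G →L[ℝ] E) (h : ∀ g i, IsGen i (L₀ g) (L i g))
    [IsEq L₀] (h₁ : ∀ i, IsEq (L i)) : IsEq (lift L₀ L h) :=
  dsub.lift_isEq (J := ContinuousLinearMap.id ℝ E) L₀ L h h₁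

/-- A bilinear map into `DV E` from its components. -/
def lift₂ (P₀ : M →L[ℝ] G →L[ℝ] E) (P : Fin 2 → M →L[ℝ] G →L[ℝ] E)
    (h : ∀ m g i, IsGen i (P₀ m g) (P i m g)) : M →L[ℝ] G →L[ℝ] DV E :=
  dsub.lift₂ P₀ P h

@[simp] theorem base_lift₂ (P₀ : M →L[ℝ] G →L[ℝ] E) (P : Fin 2 → M →L[ℝ] G →L[ℝ] E)
    (h : ∀ m g i, IsGen i (P₀ m g) (P i m g)) (m : M) (g : G) :
    base (lift₂ P₀ P h m g) = P₀ m g := rfl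

@[simp] theorem der_lift₂ (P₀ : M →L[ℝ] G →L[ℝ] E) (P : Fin 2 → M →L[ℝ] G →L[ℝ] E)
    (h : ∀ m g i, IsGen i (P₀ m g) (P i m g)) (m : M) (g : G) (i : Fin 2) :
    der i (lift₂ P₀ P h m g) = P i m g := rfl

theorem lift₂_isEq (P₀ : M →L[ℝ] G →L[ℝ] E) (P : Fin 2 → M →L[ℝ] G →L[ℝ] E)
    (h : ∀ m g i, IsGen i (P₀ m g) (P i m g)) [IsEq₂ P₀] (h₁ : ∀ i, IsEq₂ (P i)) :
    IsEq₂ (lift₂ P₀ P h) :=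
  dsub.lift₂_isEq (J := ContinuousLinearMap.id ℝ E) P₀ P h h₁

/-- An equivariant map acts on differentiable vectors. -/
def map (A : E →L[ℝ] F) [IsEq A] : DV E →L[ℝ] DV F :=
  lift (A.comp base) (fun i => A.comp (der i)) fun g i => (isGen g i).map A

@[simp] theorem base_map (A : E →L[ℝ] F) [IsEq A] (p : DV E) : base (map A p) = A (base p) := rfl
@[simp] theorem der_map (A : E →L[ℝ] F) [IsEq A] (p : DV E) (i : Fin 2) :
    der i (map A p) = A (der i p) := rfl

instance (A : E →L[ℝ] F) [IsEq A] : IsEq (map A) :=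
  lift_isEq _ _ _ fun _ => inferInstance

theorem isGen_iff {i : Fin 2} {p q : DV E} :
    IsGen i p q ↔ IsGen i (base p) (base q) ∧ ∀ j, IsGen i (der j p) (der j q) :=
  dsub.isGen_iff

theorem base_der (p : DV (DV E)) (i : Fin 2) : base (der i p) = der i (base p) :=
  ((isGen_iff.1 (isGen p i)).1).unique (isGen (base p) i)

end DV

end DSub

attribute [irreducible] DV.map DV DV.base DV.der DV.mk DV.lift DV.lift₂

/-! ### Inverting families of operators -/

theorem isInvertible_of_bijective {E F : Type*} [NormedAddCommGroup E] [NormedSpace ℝ E]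
    [NormedAddCommGroup F] [NormedSpace ℝ F] [CompleteSpace E] [CompleteSpace F] {A : E →L[ℝ] F}
    (hA : Function.Bijective A) : A.IsInvertible :=
  ⟨ContinuousLinearEquiv.ofBijective A (LinearMap.ker_eq_bot.2 hA.1)
    (LinearMap.range_eq_top.2 hA.2), by ext; rfl⟩

theorem continuousOn_inverse_apply {T E F : Type*} [TopologicalSpace T]
    [NormedAddCommGroup E] [NormedSpace ℝ E] [NormedAddCommGroup F] [NormedSpace ℝ F]
    [CompleteSpace E] [CompleteSpace F] {s : Set T} {A : T → E →L[ℝ] F} {f : T → F} {u : T → E}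
    (hA : ContinuousOn A s) (hbij : ∀ t ∈ s, Function.Bijective (A t)) (hf : ContinuousOn f s)
    (hu : ∀ t ∈ s, A t (u t) = f t) : ContinuousOn u s := by
  have h1 : ContinuousOn (fun t => (A t).inverse (f t)) s := by
    refine ContinuousOn.clm_apply (fun t ht => ?_) hf
    exact ((isInvertible_of_bijective (hbij t ht)).contDiffAt_map_inverse
      (n := 0)).continuousAt.comp_continuousWithinAt (hA t ht)
  refine h1.congr fun t ht => ?_
  simp only []
  rw [← hu t ht, (isInvertible_of_bijective (hbij t ht)).inverse_apply_self]

theorem hasDerivWithinAt_inverse_apply {E F : Type*}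
    [NormedAddCommGroup E] [NormedSpace ℝ E] [NormedAddCommGroup F] [NormedSpace ℝ F]
    [CompleteSpace E] [CompleteSpace F] {s : Set ℝ} {A : ℝ → E →L[ℝ] F} {f : ℝ → F} {u : ℝ → E}
    {t : ℝ} {A' : E →L[ℝ] F} {f' : F} (ht : t ∈ s)
    (hA : HasDerivWithinAt A A' s t) (hbij : ∀ t ∈ s, Function.Bijective (A t))
    (hf : HasDerivWithinAt f f' s t) (hu : ∀ t ∈ s, A t (u t) = f t) :
    ∃ u', HasDerivWithinAt u u' s t := by
  have hd : DifferentiableAt ℝ (ContinuousLinearMap.inverse : (E →L[ℝ] F) → F →L[ℝ] E) (A t) :=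
    ((isInvertible_of_bijective (hbij t ht)).contDiffAt_map_inverse
      (n := 1)).differentiableAt (by norm_num)
  have h2 := (hd.hasFDerivAt.comp_hasDerivWithinAt t hA).clm_apply hf
  refine ⟨_, h2.congr (fun r hr => ?_) ?_⟩
  · simp only [Function.comp]
    rw [← hu r hr, (isInvertible_of_bijective (hbij r hr)).inverse_apply_self]
  · simp only [Function.comp]
    rw [← hu t ht, (isInvertible_of_bijective (hbij t ht)).inverse_apply_self]

/-! ### Regularity for operators that depend smoothly on translations -/

section DiffOp

variable {E F G M : Type*} [TransAct E]
  [TransAct F]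
  [TransAct G]
  [TransAct M]

/-- Conjugation of an operator by a translation. -/
def conjOp (x : Plane) (A : E →L[ℝ] F) : E →L[ℝ] F :=
  (tr x : F →L[ℝ] F).comp (A.comp (tr (-x)))

/-- Operators whose translation conjugates are differentiable in operator norm at the origin,
such as multiplications by `C¹` coefficients. -/
def DiffOp (A : E →L[ℝ] F) : Prop :=
  ∀ i, ∃ A' : E →L[ℝ] F, HasDerivAt (fun s : ℝ => conjOp (s • bv i) A) A' 0

theorem conjOp_apply_tr (x : Plane) (A : E →L[ℝ] F) (e : E) :
    conjOp x A (tr x e) = tr x (A e) := by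
  simp [conjOp, tr_neg_tr]

theorem conjOp_zero (A : E →L[ℝ] F) : conjOp 0 A = A := by
  ext e; simp [conjOp, tr_zero]

theorem DiffOp.of_isEq (A : E →L[ℝ] F) [hA : IsEq A] : DiffOp A := fun i => by
  refine ⟨0, (hasDerivAt_const (0 : ℝ) A).congr_of_eventuallyEq (Eventually.of_forall fun s => ?_)⟩
  ext e
  simp [conjOp, hA.map_tr, tr_tr_neg]

theorem DiffOp.add {A B : E →L[ℝ] F} (hA : DiffOp A) (hB : DiffOp B) : DiffOp (A + B) :=
  fun i => by
  obtain ⟨B', hB⟩ := hB i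
  obtain ⟨A', hA⟩ := hA i
  refine ⟨_, (hA.add hB).congr_of_eventuallyEq (Eventually.of_forall fun s => ?_)⟩
  ext e; simp [conjOp]

theorem DiffOp.sum {ι : Type*} (s : Finset ι) {A : ι → E →L[ℝ] F} (h : ∀ j, DiffOp (A j)) :
    DiffOp (∑ j ∈ s, A j) := by
  classical
  induction s using Finset.induction_on with
  | empty =>
    have : IsEq (0 : E →L[ℝ] F) := ⟨fun x e => by simp⟩
    simpa using DiffOp.of_isEq (0 : E →L[ℝ] F)
  | insert a s ha ih => rw [Finset.sum_insert ha]; exact (h a).add ih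

theorem DiffOp.bilin (B : M →L[ℝ] E →L[ℝ] F) [hB : IsEq₂ B] (m : DV M) :
    DiffOp (B (DV.base m)) := fun i => by
  refine ⟨B (DV.der i m), (B.hasFDerivAt.comp_hasDerivAt (0 : ℝ)
    (DV.isGen m i)).congr_of_eventuallyEq (Eventually.of_forall fun s => ?_)⟩
  ext e
  simp [conjOp, ← hB.map_tr, tr_tr_neg]

theorem conjOp_bijective {A : E →L[ℝ] F} (hA : Function.Bijective A) (x : Plane) :
    Function.Bijective (conjOp x A) := by
  refine ⟨fun e f h => ?_, fun g => ?_⟩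
  · have h1 : A (tr (-x) e) = A (tr (-x) f) := by
      have := congrArg (tr (-x)) h
      simpa [conjOp, tr_neg_tr] using this
    have := congrArg (tr x) (hA.1 h1)
    simpa [tr_tr_neg] using this
  · obtain ⟨e, he⟩ := hA.2 (tr (-x) g)
    exact ⟨tr x e, by rw [conjOp_apply_tr, he, tr_tr_neg]⟩

/-- Abstract elliptic regularity: the solution of `A u = f` is differentiable along
translations if `f` and `A` are, because `τ u = (τ A τ⁻¹)⁻¹ (τ f)`. -/
theorem DiffOp.regularity [CompleteSpace E] [CompleteSpace F] {A : E →L[ℝ] F} (hA : DiffOp A)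
    (hbij : Function.Bijective A) {i : Fin 2} {u : E} {f' : F} (hf : IsGen i (A u) f') :
    ∃ u', IsGen i u u' := by
  obtain ⟨A', hA'⟩ := hA i
  have hinv := isInvertible_of_bijective hbij
  have h0 : conjOp ((0 : ℝ) • bv i) A = A := by rw [zero_smul, conjOp_zero]
  have hd : DifferentiableAt ℝ (ContinuousLinearMap.inverse : (E →L[ℝ] F) → F →L[ℝ] E)
      (conjOp ((0 : ℝ) • bv i) A) := by
    rw [h0]
    exact (hinv.contDiffAt_map_inverse (n := 1)).differentiableAt (by norm_num)
  have h1 := hd.hasFDerivAt.comp_hasDerivAt (0 : ℝ) hA'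
  have h2 := h1.clm_apply hf
  refine ⟨_, h2.congr_of_eventuallyEq (Eventually.of_forall fun s => ?_)⟩
  simp only [Function.comp]
  rw [← conjOp_apply_tr,
    (isInvertible_of_bijective (conjOp_bijective hbij (s • bv i))).inverse_apply_self]

/-- A bijective differentiable operator is bijective between the differentiable vectors. -/
theorem DiffOp.bijective_lift [CompleteSpace E] [CompleteSpace F] {A : E →L[ℝ] F}
    (hA : DiffOp A) (hbij : Function.Bijective A) (A₁ : DV E →L[ℝ] DV F)
    (hc : ∀ p, DV.base (A₁ p) = A (DV.base p)) : Function.Bijective A₁ := by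
  refine ⟨fun p q h => DV.base_injective (hbij.1 ?_), fun q => ?_⟩
  · rw [← hc, ← hc, h]
  · obtain ⟨u, hu⟩ := hbij.2 (DV.base q)
    have : ∀ i, ∃ u', IsGen i u u' := fun i =>
      hA.regularity hbij (f' := DV.der i q) (hu ▸ DV.isGen q i)
    choose u' hu' using this
    refine ⟨DV.mk u u' hu', DV.base_injective ?_⟩
    rw [hc, DV.base_mk]
    exact hu

end DiffOp

/-! ### From weak to strong differentiability -/

section Separating

variable {E : Type*} [TransAct E]

/-- If the orbit of `e'` is continuous, it suffices to test `∂ᵢ e = e'` against a separating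
family of functionals: both sides of `τₛ e - e = ∫₀ˢ τᵣ e' dr` then agree. -/
theorem isGen_of_separating [CompleteSpace E] {ι : Type*} (Λ : ι → E →L[ℝ] ℝ)
    (hΛ : ∀ e, (∀ j, Λ j e = 0) → e = 0) {i : Fin 2} {e e' : E}
    (hcont : Continuous fun s : ℝ => tr (s • bv i) e')
    (h : ∀ j (s : ℝ), HasDerivAt (fun s : ℝ => Λ j (tr (s • bv i) e))
      (Λ j (tr (s • bv i) e')) s) : IsGen i e e' := by
  have key : ∀ s : ℝ, tr (s • bv i) e = e + ∫ r in (0 : ℝ)..s, tr (r • bv i) e' := by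
    intro s
    rw [← sub_eq_zero]
    refine hΛ _ fun j => ?_
    rw [map_sub, map_add, ← ContinuousLinearMap.intervalIntegral_comp_comm _
      (hcont.intervalIntegrable 0 s),
      intervalIntegral.integral_eq_sub_of_hasDerivAt (fun r _ => h j r)
      (((Λ j).continuous.comp hcont).intervalIntegrable 0 s)]
    simp [tr_zero]
  have h1 : HasDerivAt (fun s : ℝ => e + ∫ r in (0 : ℝ)..s, tr (r • bv i) e')
      (tr ((0 : ℝ) • bv i) e') 0 :=
    (intervalIntegral.integral_hasDerivAt_right (hcont.intervalIntegrable 0 0)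
      (hcont.stronglyMeasurableAtFilter _ _)
      hcont.continuousAt).const_add e
  rw [zero_smul, tr_zero] at h1
  exact h1.congr_of_eventuallyEq (Eventually.of_forall key)

theorem StrongAct.continuous_axis [StrongAct E] (i : Fin 2) (e : E) :
    Continuous fun s : ℝ => tr (s • bv i) e :=
  (StrongAct.cont e).comp (by fun_prop)

end Separating

/-! ### Multi-index families -/

section Towers

variable {T E F : Type*} [TopologicalSpace T]
  [TransAct E]
  [TransAct F]

/-- A family `e α`, `|α| ≤ n`, of continuous curves in `E` such that `∂ᵢ e α = e (α + eᵢ)`. -/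
def IsTower (n : ℕ) (s : Set T) (e : (Fin 2 → ℕ) → T → E) : Prop :=
  (∀ α, ∑ i, α i ≤ n → ContinuousOn (e α) s) ∧
    ∀ α, ∑ i, α i < n → ∀ t ∈ s, ∀ i, IsGen i (e α t) (e (α + Pi.single i 1) t)

theorem sum_add_single (α : Fin 2 → ℕ) (i : Fin 2) :
    ∑ j, (α + Pi.single i 1 : Fin 2 → ℕ) j = ∑ j, α j + 1 := by
  fin_cases i <;> simp <;> omega

open Classical in
theorem IsTower.exists_lift {n : ℕ} {s : Set T} {e : (Fin 2 → ℕ) → T → E}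
    (h : IsTower (n + 1) s e) :
    ∃ e₁ : (Fin 2 → ℕ) → T → DV E, IsTower n s e₁ ∧ ∀ t ∈ s, DV.base (e₁ 0 t) = e 0 t := by
  set e₁ : (Fin 2 → ℕ) → T → DV E := fun α t =>
    if h : ∀ i, IsGen i (e α t) (e (α + Pi.single i 1) t) then
      DV.mk (e α t) (fun i => e (α + Pi.single i 1) t) h else 0 with he₁
  have hb : ∀ α, ∑ i, α i ≤ n → ∀ t ∈ s, DV.base (e₁ α t) = e α t := fun α hα t ht => by
    simp only [he₁, dif_pos (h.2 α (by omega) t ht), DV.base_mk]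
  have hd : ∀ α, ∑ i, α i ≤ n → ∀ t ∈ s, ∀ i, DV.der i (e₁ α t) = e (α + Pi.single i 1) t :=
    fun α hα t ht i => by
    simp only [he₁, dif_pos (h.2 α (by omega) t ht), DV.der_mk]
  refine ⟨e₁, ⟨fun α hα => ?_, fun α hα t ht i => ?_⟩, hb 0 (by simp)⟩
  · rw [DV.continuousOn_iff]
    refine ⟨(h.1 α (by omega)).congr (hb α hα), fun i => ?_⟩
    exact (h.1 _ (by rw [sum_add_single]; omega)).congr fun t ht => hd α hα t ht i
  · have h1 : ∑ j, (α + Pi.single i 1 : Fin 2 → ℕ) j ≤ n := by rw [sum_add_single]; omega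
    rw [DV.isGen_iff, hb α hα.le t ht, hb _ h1 t ht]
    refine ⟨h.2 α (by omega) t ht i, fun j => ?_⟩
    rw [hd α hα.le t ht, hd _ h1 t ht, add_right_comm]
    exact h.2 _ (by rw [sum_add_single]; omega) t ht i

/-- `GenChain α e g`: iterated generators along some path from `0` to `α` lead from `e` to `g`. -/
inductive GenChain : (Fin 2 → ℕ) → E → E → Prop
  | refl (e : E) : GenChain 0 e e
  | step {α : Fin 2 → ℕ} {e g k : E} (i : Fin 2) : GenChain α e g → IsGen i g k →
      GenChain (α + Pi.single i 1) e k

theorem GenChain.map {α : Fin 2 → ℕ} {e g : E} (A : E →L[ℝ] F) [IsEq A] (h : GenChain α e g) :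
    GenChain α (A e) (A g) := by
  induction h with
  | refl => exact .refl _
  | step i _ hi ih => exact .step i ih (hi.map A)

/-- The curve `u` has continuous derivatives `∂^α u` for `|α| ≤ n`. -/
def HasDerivs (n : ℕ) (s : Set T) (u : T → E) : Prop :=
  ∀ α : Fin 2 → ℕ, ∑ i, α i ≤ n → ∃ D : T → E, ContinuousOn D s ∧ ∀ t ∈ s, GenChain α (u t) (D t)

theorem HasDerivs.zero {s : Set T} {u : T → E} (h : ContinuousOn u s) : HasDerivs 0 s u := by
  intro α hα
  have : α = 0 := by
    funext i
    have := Finset.single_le_sum (f := α) (fun j _ => Nat.zero_le _) (Finset.mem_univ i)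
    simp only [Pi.zero_apply]; omega
  subst this
  exact ⟨u, h, fun t _ => .refl _⟩

theorem HasDerivs.base {n : ℕ} {s : Set T} {U : T → DV E} (h : HasDerivs n s U) :
    HasDerivs (n + 1) s fun t => DV.base (U t) := by
  intro α hα
  by_cases h0 : ∑ i, α i ≤ n
  · obtain ⟨D, hD, hD'⟩ := h α h0
    exact ⟨fun t => DV.base (D t), DV.base.continuous.comp_continuousOn hD,
      fun t ht => (hD' t ht).map DV.base⟩
  · obtain ⟨i, hi⟩ : ∃ i, α i ≠ 0 := by
      by_contra! hcon
      exact h0 (by simp [hcon])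
    have hα' : α = (α - Pi.single i 1) + Pi.single i 1 := by
      funext j
      by_cases hj : j = i
      · subst hj; simp; omega
      · simp [hj]
    have hs : ∑ j, (α - Pi.single i 1 : Fin 2 → ℕ) j ≤ n := by
      have := sum_add_single (α - Pi.single i 1) i
      rw [← hα'] at this; omega
    obtain ⟨D, hD, hD'⟩ := h _ hs
    refine ⟨fun t => DV.der i (D t), (DV.der i).continuous.comp_continuousOn hD,
      fun t ht => ?_⟩
    rw [hα']
    exact .step i ((hD' t ht).map DV.base) (DV.isGen _ i)

end Towers

/-! ### Test functions and weak derivatives -/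

theorem pd_comp_sub {F : Type*} [NormedAddCommGroup F] [NormedSpace ℝ F] (i : Fin 2)
    (φ : Plane → F) (y : Plane) : pd i (fun x => φ (x - y)) = fun x => pd i φ (x - y) := by
  funext x
  simp only [pd, fderiv_comp_sub]

theorem IsTest.comp_sub {F : Type*} [NormedAddCommGroup F] [NormedSpace ℝ F] {φ : Plane → F}
    (h : IsTest φ) (y : Plane) : IsTest fun x => φ (x - y) :=
  ⟨h.1.comp (contDiff_id.sub contDiff_const),
    h.2.comp_homeomorph (Homeomorph.subRight y)⟩

theorem mderiv_single {F : Type*} [NormedAddCommGroup F] [NormedSpace ℝ F] (i : Fin 2)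
    (φ : Plane → F) : mderiv (Pi.single i 1) φ = pd i φ := by
  fin_cases i <;> simp [mderiv]

theorem IsTest.pd_comm {F : Type*} [NormedAddCommGroup F] [NormedSpace ℝ F] {φ : Plane → F}
    (h : IsTest φ) (i j : Fin 2) : pd i (pd j φ) = pd j (pd i φ) := by
  funext x
  have h2 : ContDiffAt ℝ 2 φ x := (contDiff_infty.1 h.1 2).contDiffAt
  have hd : ∀ k, fderiv ℝ (pd k φ) x = (fderiv ℝ (fderiv ℝ φ) x).flip
      (EuclideanSpace.single k 1) := by
    intro k
    have h3 : DifferentiableAt ℝ (fderiv ℝ φ) x :=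
      (h2.fderiv_right (m := 1) (by norm_num)).differentiableAt (by norm_num)
    ext v
    have := (h3.hasFDerivAt.clm_apply (hasFDerivAt_const (EuclideanSpace.single k 1 : Plane) x))
    rw [show pd k φ = fun y => fderiv ℝ φ y (EuclideanSpace.single k 1) from rfl, this.fderiv]
    simp
  have hs := (h2.isSymmSndFDerivAt (by simp))
  change fderiv ℝ (pd j φ) x _ = fderiv ℝ (pd i φ) x _
  rw [hd, hd]
  exact hs _ _

theorem IsTest.mderiv_add_single {F : Type*} [NormedAddCommGroup F] [NormedSpace ℝ F]
    {φ : Plane → F} (h : IsTest φ) (α : Fin 2 → ℕ) (i : Fin 2) :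
    mderiv (α + Pi.single i 1) φ = mderiv α (pd i φ) := by
  have hcomm : ∀ n (ψ : Plane → F), IsTest ψ → (pd 0) ((pd 1)^[n] ψ) = (pd 1)^[n] (pd 0 ψ) := by
    intro n
    induction n with
    | zero => intro ψ _; rfl
    | succ n ih =>
      intro ψ hψ
      rw [Function.iterate_succ_apply, Function.iterate_succ_apply, ih _ (hψ.pderiv 1),
        hψ.pd_comm 0 1]
  fin_cases i
  · simp [mderiv, Function.iterate_succ_apply, hcomm _ _ h]
  · simp [mderiv, Function.iterate_succ_apply]

theorem integrable_mul_test {f : Plane → ℝ} (hf : LocallyIntegrable f volume) {φ : Plane → ℝ}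
    (hφ : IsTest φ) : Integrable (fun x => f x * φ x) volume := by
  simpa [smul_eq_mul] using hf.integrable_smul_right_of_hasCompactSupport hφ.1.continuous hφ.2

theorem ae_eq_of_forall_test {f g : Plane → ℝ} (hf : LocallyIntegrable f volume)
    (hg : LocallyIntegrable g volume)
    (h : ∀ φ : Plane → ℝ, IsTest φ → ∫ x, f x * φ x = ∫ x, g x * φ x) : f =ᵐ[volume] g :=
  ae_eq_of_integral_contDiff_smul_eq hf hg fun φ h1 h2 => by
    simpa [smul_eq_mul, mul_comm] using h φ ⟨h1, h2⟩

theorem HasWeakDeriv.congr {α : Fin 2 → ℕ} {f g f' g' : Plane → ℝ} (h : HasWeakDeriv α f g)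
    (hf : f =ᵐ[volume] f') (hg : g =ᵐ[volume] g') : HasWeakDeriv α f' g' := by
  refine ⟨h.1.congr hf, h.2.1.congr hg, fun φ hφ => ?_⟩
  rw [← integral_congr_ae (hf.mono fun x hx => show f x * _ = f' x * mderiv α φ x by rw [hx]),
    ← integral_congr_ae (hg.mono fun x hx => show g x * φ x = g' x * φ x by rw [hx]), h.2.2 φ hφ]

theorem HasWeakDeriv.unique {α : Fin 2 → ℕ} {f g g' : Plane → ℝ} (h : HasWeakDeriv α f g)
    (h' : HasWeakDeriv α f g') : g =ᵐ[volume] g' := by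
  refine ae_eq_of_forall_test h.2.1 h'.2.1 fun φ hφ => ?_
  have := (h.2.2 φ hφ).symm.trans (h'.2.2 φ hφ)
  exact mul_left_cancel₀ (pow_ne_zero _ (by norm_num)) this

theorem HasWeakDeriv.zero {f : Plane → ℝ} (hf : LocallyIntegrable f volume) :
    HasWeakDeriv 0 f f :=
  ⟨hf, hf, fun φ _ => by simp [mderiv]⟩

theorem HasWeakDeriv.eq_of_zero {f g : Plane → ℝ} (h : HasWeakDeriv 0 f g) : f =ᵐ[volume] g :=
  (HasWeakDeriv.zero h.1).unique h

theorem hasWeakDeriv_single_iff {i : Fin 2} {f g : Plane → ℝ} :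
    HasWeakDeriv (Pi.single i 1) f g ↔ LocallyIntegrable f volume ∧ LocallyIntegrable g volume ∧
      ∀ φ : Plane → ℝ, IsTest φ → ∫ x, f x * pd i φ x = -∫ x, g x * φ x := by
  simp [HasWeakDeriv, mderiv_single]

theorem HasWeakDeriv.step {α : Fin 2 → ℕ} {i : Fin 2} {f g k : Plane → ℝ}
    (h : HasWeakDeriv α f g) (h' : HasWeakDeriv (Pi.single i 1) g k) :
    HasWeakDeriv (α + Pi.single i 1) f k := by
  refine ⟨h.1, h'.2.1, fun φ hφ => ?_⟩
  rw [hφ.mderiv_add_single, h.2.2 _ (hφ.pderiv i), (hasWeakDeriv_single_iff.1 h').2.2 φ hφ,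
    sum_add_single, pow_succ]
  ring

theorem HasWeakDeriv.of_step {α : Fin 2 → ℕ} {i : Fin 2} {f g k : Plane → ℝ}
    (h : HasWeakDeriv α f g) (h' : HasWeakDeriv (α + Pi.single i 1) f k) :
    HasWeakDeriv (Pi.single i 1) g k := by
  refine hasWeakDeriv_single_iff.2 ⟨h.2.1, h'.2.1, fun φ hφ => ?_⟩
  have h1 := h'.2.2 φ hφ
  rw [hφ.mderiv_add_single, h.2.2 _ (hφ.pderiv i), sum_add_single, pow_succ, mul_assoc] at h1
  simpa using mul_left_cancel₀ (pow_ne_zero _ (by norm_num)) h1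

/-- Moving the test function along the `i`-th axis. -/
theorem hasDerivAt_integral_mul_shift {f : Plane → ℝ} (hf : LocallyIntegrable f volume)
    {φ : Plane → ℝ} (hφ : IsTest φ) (i : Fin 2) (s : ℝ) :
    HasDerivAt (fun s : ℝ => ∫ x, f x * φ (x - s • bv i))
      (-∫ x, f x * pd i φ (x - s • bv i)) s := by
  set K : Set Plane := (fun p : Plane × ℝ => p.1 + p.2 • bv i) ''
    (tsupport (pd i φ) ×ˢ Icc (s - 1) (s + 1)) with hK
  have hKc : IsCompact K :=
    (((hφ.pderiv i).2 : IsCompact _).prod isCompact_Icc).image (by fun_prop)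
  obtain ⟨C, hC⟩ := (hφ.pderiv i).2.exists_bound_of_continuous (hφ.pderiv i).1.continuous
  have hmain := hasDerivAt_integral_of_dominated_loc_of_deriv_le (μ := (volume : Measure Plane))
    (F := fun (s : ℝ) x => f x * φ (x - s • bv i))
    (F' := fun (s : ℝ) x => -(f x * pd i φ (x - s • bv i)))
    (bound := K.indicator fun x => ‖f x‖ * C) (x₀ := s) (s := Icc (s - 1) (s + 1))
    (Icc_mem_nhds (by linarith) (by linarith))
    (Eventually.of_forall fun r =>
      (integrable_mul_test hf (hφ.comp_sub (r • bv i))).aestronglyMeasurable)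
    (integrable_mul_test hf (hφ.comp_sub _))
    (integrable_mul_test hf ((hφ.pderiv i).comp_sub _)).neg.aestronglyMeasurable
    (Eventually.of_forall fun x r hr => ?_) ?_ (Eventually.of_forall fun x r _ => ?_)
  · have := hmain.2
    rwa [integral_neg] at this
  · by_cases hx : x - r • bv i ∈ tsupport (pd i φ)
    · have hxK : x ∈ K := ⟨(x - r • bv i, r), ⟨hx, hr⟩, by simp⟩
      rw [indicator_of_mem hxK, norm_neg, norm_mul]
      gcongr
      exact hC _
    · rw [image_eq_zero_of_notMem_tsupport hx, mul_zero, neg_zero, norm_zero]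
      exact indicator_nonneg (fun x _ => mul_nonneg (norm_nonneg _)
        ((norm_nonneg _).trans (hC 0))) _
  · rw [integrable_indicator_iff hKc.measurableSet]
    exact (hf.integrableOn_isCompact hKc).norm.mul_const C
  · have h1 : HasDerivAt (fun r : ℝ => x - r • bv i) (-bv i) r := by
      simpa using ((hasDerivAt_id r).smul_const (bv i)).const_sub x
    have h2 := ((hφ.1.differentiable (by simp)).differentiableAt
      (x := x - r • bv i)).hasFDerivAt.comp_hasDerivAt r h1
    have h3 := h2.const_mul (f x)
    refine h3.congr_deriv ?_
    simp [pd, bv]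

theorem HasWeakDeriv.hasDerivAt_shift {i : Fin 2} {f g : Plane → ℝ}
    (h : HasWeakDeriv (Pi.single i 1) f g) {φ : Plane → ℝ} (hφ : IsTest φ) (s : ℝ) :
    HasDerivAt (fun s : ℝ => ∫ x, f x * φ (x - s • bv i)) (∫ x, g x * φ (x - s • bv i)) s := by
  have := (hasWeakDeriv_single_iff.1 h).2.2 _ (hφ.comp_sub (s • bv i))
  rw [pd_comp_sub] at this
  have h2 := hasDerivAt_integral_mul_shift h.1 hφ i s
  rwa [this, neg_neg] at h2

/-! ### Translations of `L²` functions -/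

section Lp

variable {F : Type*} [NormedAddCommGroup F] [NormedSpace ℝ F]

theorem Lp.compMeasurePreserving_congr {g k : Plane → Plane} (hg : MeasurePreserving g volume volume)
    (hk : MeasurePreserving k volume volume) (h : g = k) (f : Lp F 2 (volume : Measure Plane)) :
    Lp.compMeasurePreserving g hg f = Lp.compMeasurePreserving k hk f := by
  subst h; rfl

instance : TransAct (Lp F 2 (volume : Measure Plane)) where
  tr x := (Lp.compMeasurePreservingₗᵢ ℝ (fun y : Plane => y + x)
    (measurePreserving_add_right volume x)).toContinuousLinearMap
  tr_zero f := by
    refine (Lp.compMeasurePreserving_congr _ (MeasurePreserving.id _) ?_ f).trans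
      (Lp.compMeasurePreserving_id_apply f)
    funext y; simp
  tr_add x y f := by
    refine (Lp.compMeasurePreserving_congr _ ((measurePreserving_add_right volume y).comp
      (measurePreserving_add_right volume x)) ?_ f).trans
      (Lp.compMeasurePreserving_comp_apply _ _ _)
    funext z; simp [add_assoc]
  norm_tr x f := Lp.norm_compMeasurePreserving f _

theorem coeFn_tr (x : Plane) (f : Lp F 2 (volume : Measure Plane)) :
    ⇑(tr x f : Lp F 2 (volume : Measure Plane)) =ᵐ[volume] fun y => f (y + x) :=
  Lp.coeFn_compMeasurePreserving f (measurePreserving_add_right volume x)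

instance : StrongAct (Lp F 2 (volume : Measure Plane)) := ⟨fun f => by
  have hc : Continuous fun x : Plane => (⟨fun y => y + x, by fun_prop⟩ : C(Plane, Plane)) :=
    ContinuousMap.continuous_of_continuous_uncurry _ (by
      change Continuous fun p : Plane × Plane => p.2 + p.1
      fun_prop)
  exact (continuous_const (y := f)).compMeasurePreservingLp hc
    (fun x => measurePreserving_add_right volume x) (by norm_num)⟩

theorem Lp.locallyIntegrable (f : Lp F 2 (volume : Measure Plane)) :
    LocallyIntegrable f volume :=
  (Lp.memLp f).locallyIntegrable (by norm_num)

end Lp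

/-- Integration against a test function, as a functional on `L²`. -/
def testL {φ : Plane → ℝ} (hφ : IsTest φ) : L2 →L[ℝ] ℝ := innerSL ℝ (hφ.memLp.toLp φ)

theorem testL_apply {φ : Plane → ℝ} (hφ : IsTest φ) (f : L2) :
    testL hφ f = ∫ x, f x * φ x := by
  rw [testL, innerSL_apply_apply, L2.inner_def]
  refine integral_congr_ae ?_
  filter_upwards [hφ.memLp.coeFn_toLp] with x hx
  simp [hx]

theorem testL_tr {φ : Plane → ℝ} (hφ : IsTest φ) (x : Plane) (f : L2) :
    testL hφ (tr x f) = ∫ y, f y * φ (y - x) := by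
  rw [testL_apply, ← integral_add_right_eq_self (fun y => f y * φ (y - x)) x]
  refine integral_congr_ae ?_
  filter_upwards [coeFn_tr x f] with y hy
  simp [hy]

theorem testL_separating {f : L2} (h : ∀ (φ : Plane → ℝ) (hφ : IsTest φ), testL hφ f = 0) :
    f = 0 := by
  have : (f : Plane → ℝ) =ᵐ[volume] fun _ => (0 : ℝ) :=
    ae_eq_of_forall_test (Lp.locallyIntegrable f) (locallyIntegrable_const 0) fun φ hφ => by
      rw [← testL_apply hφ, h φ hφ]; simp
  exact Lp.ext (this.trans (Lp.coeFn_zero ..).symm)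

/-- In `L²`, the weak derivative is the generator of translations. -/
theorem isGen_L2_iff {i : Fin 2} {f g : L2} :
    IsGen i f g ↔ HasWeakDeriv (Pi.single i 1) f g := by
  constructor
  · intro h
    refine hasWeakDeriv_single_iff.2
      ⟨Lp.locallyIntegrable f, Lp.locallyIntegrable g, fun φ hφ => ?_⟩
    have h1 := (testL hφ).hasFDerivAt.comp_hasDerivAt (0 : ℝ) h
    have h2 := hasDerivAt_integral_mul_shift (Lp.locallyIntegrable f) hφ i 0
    have h3 : (testL hφ ∘ fun s : ℝ => tr (s • bv i) f)
        = fun s : ℝ => ∫ x, f x * φ (x - s • bv i) := by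
      funext s; simp [testL_tr]
    rw [h3] at h1
    have := h1.unique h2
    simp only [zero_smul, sub_zero] at this
    rw [← testL_apply hφ g, this, neg_neg]
  · intro h
    refine isGen_of_separating (ι := {φ : Plane → ℝ // IsTest φ}) (fun φ => testL φ.2)
      (fun f hf => testL_separating fun φ hφ => hf ⟨φ, hφ⟩) (StrongAct.continuous_axis i g)
      fun φ s => ?_
    simp only [testL_tr]
    exact h.hasDerivAt_shift φ.2 s

theorem GenChain.hasWeakDeriv {α : Fin 2 → ℕ} {f g : L2} (h : GenChain α f g) :
    HasWeakDeriv α f g := by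
  induction h with
  | refl f => exact .zero (Lp.locallyIntegrable f)
  | step i _ hi ih => exact ih.step (isGen_L2_iff.1 hi)

/-! ### Classical partial derivatives -/

/-- `g` is the classical partial derivative `∂ᵢ f`, both functions being continuous. -/
structure PD (i : Fin 2) (f g : Plane → ℝ) : Prop where
  cont : Continuous f
  cont' : Continuous g
  hasLineDerivAt : ∀ x, HasLineDerivAt ℝ f (g x) x (bv i)

theorem PD.integral_test {i : Fin 2} {f g : Plane → ℝ} (h : PD i f g) {φ : Plane → ℝ}
    (hφ : IsTest φ) : ∫ x, f x * pd i φ x = -∫ x, g x * φ x := by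
  refine integral_bilinear_hasLineDerivAt_right_eq_neg_left_of_integrable (v := bv i)
    (B := ContinuousLinearMap.mul ℝ ℝ) ?_ ?_ ?_ (fun x _ => h.hasLineDerivAt x) fun x _ => ?_
  · exact integrable_mul_test h.cont'.locallyIntegrable hφ
  · exact integrable_mul_test h.cont.locallyIntegrable (hφ.pderiv i)
  · exact integrable_mul_test h.cont.locallyIntegrable hφ
  · exact ((hφ.1.differentiable (by simp)).differentiableAt.hasFDerivAt).hasLineDerivAt (bv i)

theorem PD.hasWeakDeriv {i : Fin 2} {f g : Plane → ℝ} (h : PD i f g) :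
    HasWeakDeriv (Pi.single i 1) f g :=
  hasWeakDeriv_single_iff.2
    ⟨h.cont.locallyIntegrable, h.cont'.locallyIntegrable, fun _ hφ => h.integral_test hφ⟩

/-! ### Components and translations of elements of `X⁰` -/

/-- The `j`-th component of an `L²` vector field. -/
def compV (j : Fin 2) : L2V →L[ℝ] L2 :=
  ContinuousLinearMap.compLpL 2 volume (EuclideanSpace.proj (𝕜 := ℝ) j)

theorem coeFn_compV (j : Fin 2) (w : L2V) : compV j w =ᵐ[volume] fun x => w x j :=
  ContinuousLinearMap.coeFn_compLpL _ w

instance (j : Fin 2) : IsEq (compV j) := ⟨fun x w => by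
  refine Lp.ext ?_
  have h1 := (measurePreserving_add_right (volume : Measure Plane) x).quasiMeasurePreserving.ae_eq_comp
    (coeFn_compV j w)
  filter_upwards [coeFn_compV j (tr x w), coeFn_tr x w, coeFn_tr x (compV j w), h1]
    with y e1 e2 e3 e4
  simp only [Function.comp] at e4
  rw [e1, e2, e3, e4]⟩

theorem compV_ext {w w' : L2V} (h : ∀ j, compV j w = compV j w') : w = w' := by
  refine Lp.ext ?_
  filter_upwards [coeFn_compV 0 w, coeFn_compV 0 w', coeFn_compV 1 w, coeFn_compV 1 w']
    with x e0 e0' e1 e1'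
  ext j
  fin_cases j
  · change w x 0 = w' x 0
    rw [← e0, ← e0', h]
  · change w x 1 = w' x 1
    rw [← e1, ← e1', h]

theorem hasWeakDiv_iff (w : L2V) (d : L2) :
    HasWeakDiv w d ↔ ∀ (φ : Plane → ℝ) (hφ : IsTest φ),
      ∑ i, testL (hφ.pderiv i) (compV i w) = -testL hφ d := by
  have key : ∀ (φ : Plane → ℝ) (hφ : IsTest φ), ∫ x, ∑ i, w x i * pd i φ x
      = ∑ i, testL (hφ.pderiv i) (compV i w) := by
    intro φ hφ
    have h1 : ∀ i, (fun x => compV i w x * pd i φ x) =ᵐ[volume] fun x => w x i * pd i φ x :=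
      fun i => (coeFn_compV i w).mono fun x hx => by simp only [hx]
    rw [integral_finsetSum]
    · exact Finset.sum_congr rfl fun i _ => by rw [testL_apply, integral_congr_ae (h1 i)]
    · exact fun i _ => (integrable_mul_test (Lp.locallyIntegrable _) (hφ.pderiv i)).congr (h1 i)
  constructor
  · intro h φ hφ
    rw [← key φ hφ, h.2.2 φ hφ, testL_apply]
  · intro h
    exact ⟨Lp.locallyIntegrable w, Lp.locallyIntegrable d, fun φ hφ => by
      rw [key φ hφ, h φ hφ, testL_apply]⟩

theorem testL_congr {φ ψ : Plane → ℝ} (h : φ = ψ) (hφ : IsTest φ) (hψ : IsTest ψ) :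
    testL hφ = testL hψ := by subst h; rfl

theorem testL_tr' {φ : Plane → ℝ} (hφ : IsTest φ) (x : Plane) (f : L2) :
    testL hφ (tr x f) = testL (hφ.comp_sub x) f := by
  rw [testL_tr, testL_apply]

theorem HasWeakDiv.tr {w : L2V} {d : L2} (h : HasWeakDiv w d) (x : Plane) :
    HasWeakDiv (TransAct.tr x w : L2V) (TransAct.tr x d : L2) := by
  rw [hasWeakDiv_iff] at h ⊢
  intro φ hφ
  have := h _ (hφ.comp_sub x)
  rw [testL_tr', ← this]
  refine Finset.sum_congr rfl fun i _ => ?_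
  rw [IsEq.map_tr (A := compV i), testL_tr']
  rw [testL_congr (pd_comp_sub i φ x).symm]

section X0

variable {μ : ℝ}

theorem mem_X0sub {p : WithLp 2 (L2V × L2)} :
    p ∈ X0sub μ ↔ HasWeakDiv (√μ • p.fst : L2V) p.snd := by
  have : (fun x => √μ • p.fst x) =ᵐ[volume] (√μ • p.fst : L2V) :=
    (Lp.coeFn_smul (√μ) p.fst).symm
  exact ⟨fun h => HasWeakDiv.congr h this Filter.EventuallyEq.rfl,
    fun h => HasWeakDiv.congr h this.symm Filter.EventuallyEq.rfl⟩

/-- The diagonal translation of pairs. -/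
def trPair (x : Plane) : WithLp 2 (L2V × L2) →L[ℝ] WithLp 2 (L2V × L2) :=
  ((WithLp.prodContinuousLinearEquiv 2 ℝ L2V L2).symm : L2V × L2 →L[ℝ] WithLp 2 (L2V × L2)).comp
    (((tr x : L2V →L[ℝ] L2V).prodMap (tr x : L2 →L[ℝ] L2)).comp
      (WithLp.prodContinuousLinearEquiv 2 ℝ L2V L2 : WithLp 2 (L2V × L2) →L[ℝ] L2V × L2))

instance : TransAct (X0 μ) where
  tr x := ((trPair x).comp (X0sub μ).subtypeL).codRestrict (X0sub μ) fun p => by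
    have := HasWeakDiv.tr (mem_X0sub.1 p.2) x
    rw [map_smul] at this
    exact mem_X0sub.2 this
  tr_zero p := Subtype.ext <| WithLp.ofLp_injective 2 <|
    Prod.ext (tr_zero p.1.fst) (tr_zero p.1.snd)
  tr_add x y p := Subtype.ext <| WithLp.ofLp_injective 2 <|
    Prod.ext (tr_add x y p.1.fst) (tr_add x y p.1.snd)
  norm_tr x p := by
    have h : ∀ q : X0 μ, ‖q‖ = √(‖q.1.fst‖ ^ 2 + ‖q.1.snd‖ ^ 2) := fun q => by
      exact WithLp.prod_norm_eq_of_L2 q.1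
    rw [h, h]
    congr 3
    · exact norm_tr x p.1.fst
    · exact norm_tr x p.1.snd

instance : IsEq (velX μ) := ⟨fun _ _ => rfl⟩

instance : IsEq (divX μ) := ⟨fun x p => by
  change (√μ)⁻¹ • tr x p.1.snd = tr x ((√μ)⁻¹ • p.1.snd)
  rw [map_smul]⟩

/-- The `j`-th component of the velocity. -/
def vc (μ : ℝ) (j : Fin 2) : X0 μ →L[ℝ] L2 := (compV j).comp (velX μ)

instance (j : Fin 2) : IsEq (vc μ j) := IsEq.comp _ _

theorem coeFn_vc (j : Fin 2) (u : X0 μ) : vc μ j u =ᵐ[volume] fun x => velX μ u x j :=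
  coeFn_compV j _

theorem velX_injective : Function.Injective (velX μ) := by
  intro p q h
  have h1 : p.1.fst = q.1.fst := h
  have h2 : p.1.snd = q.1.snd := by
    have hp := (hasWeakDiv_iff _ _).1 (mem_X0sub.1 p.2)
    have hq := (hasWeakDiv_iff _ _).1 (mem_X0sub.1 q.2)
    rw [h1] at hp
    rw [← sub_eq_zero]
    refine testL_separating fun φ hφ => ?_
    have := (hp φ hφ).symm.trans (hq φ hφ)
    rw [map_sub, neg_injective this, sub_self]
  exact Subtype.ext (WithLp.ofLp_injective 2 (Prod.ext h1 h2))

theorem vc_ext {u w : X0 μ} (h : ∀ j, vc μ j u = vc μ j w) : u = w :=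
  velX_injective (compV_ext h)

instance : CompleteSpace (X0 μ) := by
  have : IsClosed (X0sub μ : Set (WithLp 2 (L2V × L2))) := by
    have : (X0sub μ : Set (WithLp 2 (L2V × L2))) =
        ⋂ φ : {φ : Plane → ℝ // IsTest φ}, {p | ∑ i, testL (φ.2.pderiv i) (compV i (√μ • p.fst))
          = -testL φ.2 p.snd} := by
      ext p
      simp only [SetLike.mem_coe, mem_X0sub, hasWeakDiv_iff, mem_iInter, mem_ofPred_eq,
        Subtype.forall]
    rw [this]
    refine isClosed_iInter fun φ => isClosed_eq ?_ ?_
    · refine continuous_finsetSum _ fun i _ => ?_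
      exact (testL (φ.2.pderiv i)).continuous.comp ((compV i).continuous.comp
        (((√μ) • WithLp.fstL 2 ℝ L2V L2).continuous))
    · exact ((testL φ.2).continuous.comp (WithLp.sndL 2 ℝ L2V L2).continuous).neg
  exact this.completeSpace_coe

instance : StrongAct (X0 μ) := ⟨fun p => by
  refine Topology.IsInducing.subtypeVal.continuous_iff.2 ?_
  exact (WithLp.prod_continuous_toLp 2 L2V L2).comp
    ((StrongAct.cont p.1.fst).prodMk (StrongAct.cont p.1.snd))⟩

theorem isGen_X0_iff {i : Fin 2} {u u' : X0 μ} :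
    IsGen i u u' ↔ ∀ j, IsGen i (vc μ j u) (vc μ j u') := by
  refine ⟨fun h j => h.map _, fun h => ?_⟩
  refine isGen_of_separating
    (ι := Fin 2 × {φ : Plane → ℝ // IsTest φ}) (fun p => (testL p.2.2).comp (vc μ p.1))
    (fun w hw => vc_ext fun j => ?_) (StrongAct.continuous_axis i u') fun p s => ?_
  · rw [map_zero]
    exact testL_separating fun φ hφ => hw (j, ⟨φ, hφ⟩)
  · have := (testL p.2.2).hasFDerivAt.comp_hasDerivAt s ((h p.1).hasDerivAt s)
    simp only [ContinuousLinearMap.comp_apply, IsEq.map_tr (A := vc μ p.1)]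
    exact this

theorem hasWeakDiv_vel (hμ : 0 < μ) (u : X0 μ) : HasWeakDiv (velX μ u) (divX μ u) := by
  have h0 : √μ ≠ 0 := (Real.sqrt_pos.2 hμ).ne'
  refine (HasWeakDiv.const_smul (√μ)⁻¹ u.2).congr (Eventually.of_forall fun x => ?_) ?_
  · simp only [smul_smul, inv_mul_cancel₀ h0, one_smul]; rfl
  · filter_upwards [Lp.coeFn_smul (√μ)⁻¹ u.1.snd] with x hx
    exact hx.symm

theorem sum_testL_vc (hμ : 0 < μ) (u : X0 μ) {φ : Plane → ℝ} (hφ : IsTest φ) :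
    ∑ i, testL (hφ.pderiv i) (vc μ i u) = -testL hφ (divX μ u) :=
  (hasWeakDiv_iff _ _).1 (hasWeakDiv_vel hμ u) φ hφ

/-- The element of `X⁰` with given velocity and divergence. -/
def mkX (_hμ : 0 < μ) (w : L2V) (d : L2) (h : HasWeakDiv w d) : X0 μ :=
  ⟨WithLp.toLp 2 (w, √μ • d), by
    refine (HasWeakDiv.const_smul (√μ) h).congr Filter.EventuallyEq.rfl ?_
    filter_upwards [Lp.coeFn_smul (√μ) d] with x hx
    exact hx.symm⟩

theorem velX_mkX (hμ : 0 < μ) (w : L2V) (d : L2) (h : HasWeakDiv w d) :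
    velX μ (mkX hμ w d h) = w := rfl

theorem divX_mkX (hμ : 0 < μ) (w : L2V) (d : L2) (h : HasWeakDiv w d) :
    divX μ (mkX hμ w d h) = d := by
  change (√μ)⁻¹ • (√μ • d) = d
  rw [smul_smul, inv_mul_cancel₀ (Real.sqrt_pos.2 hμ).ne', one_smul]

theorem inner_L2V (w w' : L2V) : inner ℝ w w' = ∑ i, inner ℝ (compV i w) (compV i w') := by
  simp only [L2.inner_def]
  rw [← integral_finsetSum _ fun i _ => L2.integrable_inner _ _]
  refine integral_congr_ae ?_
  filter_upwards [coeFn_compV 0 w, coeFn_compV 0 w', coeFn_compV 1 w, coeFn_compV 1 w']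
    with x e0 e0' e1 e1'
  simp [PiLp.inner_apply, e0, e0', e1, e1']

theorem inner_X0 (hμ : 0 < μ) (u w : X0 μ) :
    inner ℝ u w = ∑ i, inner ℝ (vc μ i u) (vc μ i w) + μ * inner ℝ (divX μ u) (divX μ w) := by
  have h1 : inner ℝ u w = inner ℝ (velX μ u) (velX μ w) + inner ℝ u.1.snd w.1.snd :=
    WithLp.prod_inner_apply _ _
  have h2 : ∀ u : X0 μ, u.1.snd = √μ • divX μ u := fun u => by
    change _ = √μ • ((√μ)⁻¹ • u.1.snd)
    rw [smul_smul, mul_inv_cancel₀ (Real.sqrt_pos.2 hμ).ne', one_smul]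
  rw [h1, h2, h2, inner_L2V, real_inner_smul_left, real_inner_smul_right, ← mul_assoc,
    Real.mul_self_sqrt hμ.le]
  rfl

theorem norm_sq_X0 (hμ : 0 < μ) (u : X0 μ) :
    ‖u‖ ^ 2 = ∑ i, ‖vc μ i u‖ ^ 2 + μ * ‖divX μ u‖ ^ 2 := by
  simp only [← real_inner_self_eq_norm_sq, inner_X0 hμ]

theorem vc_testX {φ : Plane → Plane} (h : IsTest φ) (j : Fin 2) :
    vc μ j (testX μ φ h) = (h.comp_apply j).memLp.toLp _ := by
  refine Lp.ext ?_
  filter_upwards [coeFn_vc j (testX μ φ h), h.memLp.coeFn_toLp,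
    (h.comp_apply j).memLp.coeFn_toLp] with x e1 e2 e3
  rw [e1, e3]
  exact congrArg (fun v : Plane => v j) e2

theorem divX_testX (hμ : 0 < μ) {φ : Plane → Plane} (h : IsTest φ) :
    divX μ (testX μ φ h) = h.memLp_div.toLp _ := by
  change (√μ)⁻¹ • (√μ • (h.memLp_div.toLp _ : L2)) = _
  rw [smul_smul, inv_mul_cancel₀ (Real.sqrt_pos.2 hμ).ne', one_smul]

theorem testX_congr {φ ψ : Plane → Plane} (h : φ = ψ) (hφ : IsTest φ) (hψ : IsTest ψ) :
    testX μ φ hφ = testX μ ψ hψ := by subst h; rfl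

theorem pd_comp_apply {φ : Plane → Plane} (h : IsTest φ) (i j : Fin 2) :
    pd i (fun x => φ x j) = fun x => pd i φ x j := by
  funext x
  have h1 := ((h.1.differentiable (by simp)).differentiableAt (x := x)).hasFDerivAt
  have h2 := (EuclideanSpace.proj (𝕜 := ℝ) j : Plane →L[ℝ] ℝ).hasFDerivAt.comp x h1
  have h3 : (fun x => φ x j) = (EuclideanSpace.proj (𝕜 := ℝ) j : Plane →L[ℝ] ℝ) ∘ φ := rfl
  simp only [pd]
  rw [h3, h2.fderiv]
  rfl

theorem isTest_pd {φ : Plane → ℝ} (h : IsTest φ) (i : Fin 2) : PD i φ (pd i φ) :=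
  ⟨h.1.continuous, (h.pderiv i).1.continuous, fun _ =>
    ((h.1.differentiable (by simp)).differentiableAt.hasFDerivAt).hasLineDerivAt (bv i)⟩

/-- Test fields are differentiable vectors of `X⁰`. -/
theorem isGen_testX {φ : Plane → Plane} (h : IsTest φ) (i : Fin 2) :
    IsGen i (testX μ φ h) (testX μ (pd i φ) (h.pderiv i)) := by
  refine isGen_X0_iff.2 fun j => ?_
  rw [isGen_L2_iff, vc_testX, vc_testX]
  refine (isTest_pd (h.comp_apply j) i).hasWeakDeriv.congr
    (h.comp_apply j).memLp.coeFn_toLp.symm ?_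
  rw [pd_comp_apply h]
  exact ((h.pderiv i).comp_apply j).memLp.coeFn_toLp.symm

theorem tr_testX {φ : Plane → Plane} (h : IsTest φ) (x : Plane) :
    tr (-x) (testX μ φ h) = testX μ _ (h.comp_sub x) := by
  refine vc_ext fun j => Lp.ext ?_
  rw [IsEq.map_tr (A := vc μ j), vc_testX, vc_testX]
  have h1 := (measurePreserving_add_right (volume : Measure Plane)
    (-x)).quasiMeasurePreserving.ae_eq_comp (h.comp_apply j).memLp.coeFn_toLp
  filter_upwards [coeFn_tr (-x) ((h.comp_apply j).memLp.toLp _),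
    ((h.comp_sub x).comp_apply j).memLp.coeFn_toLp, h1] with y e1 e2 e3
  rw [e1, e2]
  simpa [sub_eq_add_neg] using e3

end X0

/-! ### Density of test fields in `X⁰` -/

theorem inner_map_map_of_norm_map {E : Type*} [NormedAddCommGroup E] [InnerProductSpace ℝ E]
    (A : E →L[ℝ] E) (h : ∀ e, ‖A e‖ = ‖e‖) (a b : E) : inner ℝ (A a) (A b) = inner ℝ a b :=
  LinearIsometry.inner_map_map (⟨A.toLinearMap, h⟩ : E →ₗᵢ[ℝ] E) a b

theorem inner_tr_L2 (x : Plane) (a b : L2) :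
    inner ℝ (tr x a : L2) b = inner ℝ a (tr (-x) b : L2) := by
  rw [← inner_map_map_of_norm_map (tr (-x)) (norm_tr (-x)) (tr x a), tr_neg_tr]

theorem inner_tr_X0 {μ : ℝ} (x : Plane) (a b : X0 μ) :
    inner ℝ (tr x a : X0 μ) b = inner ℝ a (tr (-x) b : X0 μ) := by
  rw [← inner_map_map_of_norm_map (tr (-x)) (norm_tr (-x)) (tr x a), tr_neg_tr]

theorem pd_inner_tr {i : Fin 2} {g g' : L2} (h : IsGen i g g') (a : L2) :
    PD i (fun y => inner ℝ g (tr y a : L2)) (fun y => -inner ℝ g' (tr y a : L2)) := by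
  refine ⟨continuous_const.inner (StrongAct.cont a),
    (continuous_const.inner (StrongAct.cont a)).neg, fun y => ?_⟩
  have h1 : HasDerivAt (fun s : ℝ => tr ((-s) • bv i) g) (-g') 0 := by
    have h0 : HasDerivAt (fun s : ℝ => tr (s • bv i) g) g' (-0) := by rw [neg_zero]; exact h
    simpa [Function.comp_def] using h0.scomp (0 : ℝ) (hasDerivAt_neg (0 : ℝ))
  have h2 := h1.inner ℝ (hasDerivAt_const (0 : ℝ) (tr y a))
  simp only [neg_smul, inner_zero_right, zero_add, inner_neg_left] at h2
  refine h2.congr_of_eventuallyEq (Eventually.of_forall fun s => ?_)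
  simp only
  rw [inner_tr_L2, neg_neg, ← tr_add, add_comm]

theorem pd_testL_tr {φ : Plane → ℝ} (hφ : IsTest φ) (i : Fin 2) (a : L2) :
    PD i (fun y => testL hφ (tr y a)) (fun y => -testL (hφ.pderiv i) (tr y a)) := by
  refine ⟨(testL hφ).continuous.comp (StrongAct.cont a),
    ((testL _).continuous.comp (StrongAct.cont a)).neg, fun y => ?_⟩
  have h := hasDerivAt_integral_mul_shift (Lp.locallyIntegrable (tr y a)) hφ i 0
  simp only [zero_smul, sub_zero] at h
  rw [← testL_apply] at h
  refine h.congr_of_eventuallyEq (Eventually.of_forall fun s => ?_)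
  simp only
  rw [add_comm, tr_add, testL_tr]

/-- The smoothing `∫ φ(y) τ_y a dy`. -/
def smoothing (φ : Plane → ℝ) (a : L2) : L2 := ∫ y, φ y • tr y a

theorem apply_smoothing {φ : Plane → ℝ} (hφ : IsTest φ) (a : L2) (Λ : L2 →L[ℝ] ℝ) :
    Λ (smoothing φ a) = ∫ y, Λ (tr y a) * φ y := by
  have hint : Integrable (fun y => φ y • tr y a) (volume : Measure Plane) :=
    (hφ.1.continuous.smul (StrongAct.cont a)).integrable_of_hasCompactSupport
      hφ.2.smul_right
  rw [smoothing, ← Λ.integral_comp_comm hint]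
  simp [mul_comm]

section Density

variable {μ : ℝ}

/-- A field orthogonal to all test fields is `w = μ ∇g` with `g = ∇⬝w`, so formally
`‖g‖² = -∑ ⟨∂ᵢg, wᵢ⟩ = -μ‖∇g‖²`. To justify this without test functions close to `g`, the
continuous function `y ↦ ∑ ⟨∂ᵢg, τ_y wᵢ⟩ + ⟨g, τ_y g⟩` is shown to vanish as a distribution. -/
theorem eq_zero_of_inner_testX (hμ : 0 < μ) {w : X0 μ}
    (h : ∀ (φ : Plane → Plane) (hφ : IsTest φ), inner ℝ (testX μ φ hφ) w = 0) : w = 0 := by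
  set g : L2 := divX μ w with hg
  have hsingle : ∀ (i : Fin 2) (ψ : Plane → ℝ), IsTest ψ →
      IsTest (fun x => ψ x • (bv i : Plane)) := fun i ψ hψ =>
    ⟨hψ.1.smul contDiff_const, hψ.2.smul_right⟩
  -- `∇g = μ⁻¹ w`
  have hgen : ∀ i, IsGen i g (μ⁻¹ • vc μ i w) := by
    intro i
    rw [isGen_L2_iff, hasWeakDeriv_single_iff]
    refine ⟨Lp.locallyIntegrable _, Lp.locallyIntegrable _, fun ψ hψ => ?_⟩
    have h1 := h _ (hsingle i ψ hψ)
    have hc : ∀ j, (fun x => (ψ x • bv i : Plane) j) = fun x => if j = i then ψ x else 0 := by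
      intro j; funext x; simp [bv, eq_comm]
    have hd : (fun x => ∑ j, pd j (fun y => (ψ y • bv i : Plane) j) x) = pd i ψ := by
      funext x
      rw [Finset.sum_eq_single i]
      · rw [hc]; simp
      · intro j _ hj
        rw [hc]; simp [hj, pd]
      · simp
    have e1 : ∀ j, inner ℝ (vc μ j (testX μ _ (hsingle i ψ hψ))) (vc μ j w)
        = if j = i then testL hψ (vc μ j w) else 0 := by
      intro j
      rw [vc_testX]
      change testL ((hsingle i ψ hψ).comp_apply j) _ = _
      rw [testL_apply]
      by_cases hj : j = i
      · simp only [hj, if_true, testL_apply]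
        exact integral_congr_ae (Eventually.of_forall fun x => by simp [bv])
      · simp only [hj, if_false]
        refine (integral_congr_ae (Eventually.of_forall fun x => ?_)).trans (integral_zero _ _)
        simp [bv, hj]
    have e2 : inner ℝ (divX μ (testX μ _ (hsingle i ψ hψ))) (divX μ w)
        = testL (hψ.pderiv i) g := by
      rw [divX_testX hμ, testL, innerSL_apply_apply]
      congr 1
      exact MemLp.toLp_congr _ _ (Eventually.of_forall fun x => congrFun hd x)
    rw [inner_X0 hμ, e2] at h1
    simp only [e1, Finset.sum_ite_eq', Finset.mem_univ, if_true] at h1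
    have e3 : ∫ x, (μ⁻¹ • vc μ i w : L2) x * ψ x = μ⁻¹ * testL hψ (vc μ i w) := by
      rw [← testL_apply hψ, map_smul, smul_eq_mul]
    rw [e3, ← testL_apply (hψ.pderiv i)]
    field_simp
    linarith
  have hsm : ∀ φ : Plane → ℝ, IsTest φ →
      ∑ i, smoothing (pd i φ) (vc μ i w) + smoothing φ g = 0 := by
    intro φ hφ
    refine testL_separating fun ψ hψ => ?_
    rw [map_add, map_sum, apply_smoothing hφ]
    have e1 : ∀ i, testL hψ (smoothing (pd i φ) (vc μ i w))
        = ∫ y, testL (hψ.pderiv i) (tr y (vc μ i w)) * φ y := fun i => by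
      rw [apply_smoothing (hφ.pderiv i), (pd_testL_tr hψ i (vc μ i w)).integral_test hφ,
        ← integral_neg]
      simp
    simp only [e1]
    have hint : ∀ i, Integrable (fun y => testL (hψ.pderiv i) (tr y (vc μ i w)) * φ y) volume :=
      fun i => integrable_mul_test
        ((testL (hψ.pderiv i)).continuous.comp (StrongAct.cont _)).locallyIntegrable hφ
    rw [← integral_finsetSum _ fun i _ => hint i, ← integral_add]
    · have e2 : ∀ y, ∑ i, testL (hψ.pderiv i) (tr y (vc μ i w)) * φ y
          + testL hψ (tr y g) * φ y = 0 := fun y => by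
        have := sum_testL_vc hμ (tr y w) hψ
        simp only [IsEq.map_tr (A := vc μ _), IsEq.map_tr (A := divX μ)] at this
        rw [← Finset.sum_mul, this]; ring
      simp only [e2, integral_zero]
    · exact integrable_finsetSum _ fun i _ => hint i
    · exact integrable_mul_test ((testL hψ).continuous.comp (StrongAct.cont _)).locallyIntegrable hφ
  set k : Plane → ℝ := fun y =>
    ∑ i, inner ℝ (μ⁻¹ • vc μ i w) (tr y (vc μ i w)) + inner ℝ g (tr y g) with hk
  have hcont : ∀ a b : L2, Continuous fun y => inner ℝ a (tr y b) := fun a b =>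
    continuous_const.inner (StrongAct.cont b)
  have hkc : Continuous k :=
    (continuous_finsetSum _ fun i _ => hcont _ _).add (hcont _ _)
  have hk0 : k =ᵐ[volume] fun _ => 0 := by
    refine ae_eq_of_forall_test hkc.locallyIntegrable (locallyIntegrable_const 0) fun φ hφ => ?_
    have h1 := congrArg (innerSL ℝ g) (hsm φ hφ)
    rw [map_add, map_sum, map_zero, apply_smoothing hφ] at h1
    have e1 : ∀ i, innerSL ℝ g (smoothing (pd i φ) (vc μ i w))
        = ∫ y, inner ℝ (μ⁻¹ • vc μ i w) (tr y (vc μ i w)) * φ y := fun i => by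
      rw [apply_smoothing (hφ.pderiv i)]
      have := (pd_inner_tr (hgen i) (vc μ i w)).integral_test hφ
      simp only [innerSL_apply_apply]
      rw [this, ← integral_neg]
      simp
    simp only [e1] at h1
    rw [← integral_finsetSum _ fun i _ => integrable_mul_test
      (hcont _ _).locallyIntegrable hφ, ← integral_add] at h1
    · simp only [hk, zero_mul, integral_zero, add_mul, Finset.sum_mul]
      exact h1
    · exact integrable_finsetSum _ fun i _ => integrable_mul_test
        (hcont _ _).locallyIntegrable hφ
    · exact integrable_mul_test (hcont _ _).locallyIntegrable hφ
  have hk1 : k 0 = 0 := congrFun ((hkc.ae_eq_iff_eq _ continuous_const).1 hk0) 0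
  simp only [hk, tr_zero, real_inner_smul_left, real_inner_self_eq_norm_sq,
    Fin.sum_univ_two] at hk1
  have hμ' : 0 < μ⁻¹ := inv_pos.2 hμ
  refine vc_ext fun j => ?_
  rw [map_zero, ← norm_eq_zero, ← sq_eq_zero_iff]
  have a0 : 0 ≤ μ⁻¹ * ‖vc μ 0 w‖ ^ 2 := by positivity
  have a1 : 0 ≤ μ⁻¹ * ‖vc μ 1 w‖ ^ 2 := by positivity
  have a2 : 0 ≤ ‖g‖ ^ 2 := by positivity
  have : μ⁻¹ * ‖vc μ j w‖ ^ 2 = 0 := by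
    fin_cases j
    · change μ⁻¹ * ‖vc μ 0 w‖ ^ 2 = 0
      linarith
    · change μ⁻¹ * ‖vc μ 1 w‖ ^ 2 = 0
      linarith
  exact (mul_eq_zero.1 this).resolve_left hμ'.ne'

/-! ### The dual space -/

instance : NormedAddCommGroup (Y0 μ) := ContinuousLinearMap.toNormedAddCommGroup

instance : NormedSpace ℝ (Y0 μ) := ContinuousLinearMap.toNormedSpace

instance : TransAct (Y0 μ) where
  tr x := ContinuousLinearMap.precomp ℝ (tr (-x) : X0 μ →L[ℝ] X0 μ)
  tr_zero v := by ext w; simp [tr_zero]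
  tr_add x y v := by
    ext w
    change v (tr (-(x + y)) w) = v (tr (-y) (tr (-x) w))
    rw [← tr_add]
    congr 2; abel_nf
  norm_tr x v := by
    have hle : ∀ (x : Plane) (v : Y0 μ), ‖v.comp (tr x : X0 μ →L[ℝ] X0 μ)‖ ≤ ‖v‖ := fun x v => by
      refine ContinuousLinearMap.opNorm_le_bound _ (norm_nonneg _) fun w => ?_
      rw [← norm_tr x w]
      exact v.le_opNorm _
    refine le_antisymm (hle (-x) v) ?_
    have : v = (v.comp (tr (-x) : X0 μ →L[ℝ] X0 μ)).comp (tr x) := by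
      ext w; simp [tr_neg_tr]
    conv_lhs => rw [this]
    exact hle x _

theorem tr_Y0_apply (x : Plane) (v : Y0 μ) (w : X0 μ) : tr x v w = v (tr (-x) w) := rfl

/-- The Riesz isomorphism `(X⁰)' → X⁰`. -/
def rieszX (μ : ℝ) : Y0 μ →L[ℝ] X0 μ :=
  LinearMap.mkContinuous
    { toFun := fun v => (InnerProductSpace.toDual ℝ (X0 μ)).symm v
      map_add' := fun v w => map_add _ v w
      map_smul' := fun c v => by simp } 1 fun v => by
    rw [one_mul]
    exact ((InnerProductSpace.toDual ℝ (X0 μ)).symm.norm_map v).le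

theorem inner_rieszX (v : Y0 μ) (w : X0 μ) : inner ℝ (rieszX μ v) w = v w :=
  InnerProductSpace.toDual_symm_apply

instance : IsEq (rieszX μ) := ⟨fun x v => by
  refine ext_inner_right ℝ fun w => ?_
  rw [inner_rieszX, tr_Y0_apply, inner_tr_X0, inner_rieszX]⟩

theorem norm_rieszX (v : Y0 μ) : ‖rieszX μ v‖ = ‖v‖ :=
  (InnerProductSpace.toDual ℝ (X0 μ)).symm.norm_map v

instance : StrongAct (Y0 μ) := ⟨fun v => by
  have h := StrongAct.cont (rieszX μ v)
  simp only [← IsEq.map_tr (A := rieszX μ)] at h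
  have hi : Isometry (rieszX μ) := AddMonoidHomClass.isometry_of_norm _ norm_rieszX
  exact hi.isEmbedding.continuous_iff.2 h⟩

theorem Y0_ext (hμ : 0 < μ) {v v' : Y0 μ}
    (h : ∀ (φ : Plane → Plane) (hφ : IsTest φ), v (testX μ φ hφ) = v' (testX μ φ hφ)) :
    v = v' := by
  rw [← sub_eq_zero, ← norm_eq_zero, ← norm_rieszX, norm_eq_zero]
  refine eq_zero_of_inner_testX hμ fun φ hφ => ?_
  rw [real_inner_comm, inner_rieszX, sub_apply, h φ hφ, sub_self]

/-- In `(X⁰)'`, the distributional derivative is the generator of translations. -/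
theorem isGen_Y0_iff (hμ : 0 < μ) {i : Fin 2} {v w : Y0 μ} :
    IsGen i v w ↔ ∀ (φ : Plane → Plane) (h : IsTest φ),
      w (testX μ φ h) = -v (testX μ (pd i φ) (h.pderiv i)) := by
  have key : ∀ (φ : Plane → Plane) (h : IsTest φ) (s : ℝ), HasDerivAt
      (fun s : ℝ => tr (s • bv i) v (testX μ φ h))
      (-v (tr (-(s • bv i)) (testX μ (pd i φ) (h.pderiv i)))) s := by
    intro φ h s
    have h1 : HasDerivAt (fun s : ℝ => tr ((-s) • bv i) (testX μ φ h))
        (-tr (-(s • bv i)) (testX μ (pd i φ) (h.pderiv i))) s := by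
      simpa [Function.comp_def] using
        ((isGen_testX h i).hasDerivAt (-s)).scomp s (hasDerivAt_neg s)
    have h2 := v.hasFDerivAt.comp_hasDerivAt s h1
    rw [map_neg] at h2
    refine h2.congr_of_eventuallyEq (Eventually.of_forall fun r => ?_)
    simp [tr_Y0_apply]
  constructor
  · intro h φ hφ
    have h1 := (ContinuousLinearMap.apply ℝ ℝ (testX μ φ hφ)).hasFDerivAt.comp_hasDerivAt (0 : ℝ) h
    have h2 := key φ hφ 0
    simp only [zero_smul, neg_zero, tr_zero] at h2
    exact h1.unique h2
  · intro h
    refine isGen_of_separating (ι := {φ : Plane → Plane // IsTest φ})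
      (fun φ => ContinuousLinearMap.apply ℝ ℝ (testX μ φ.1 φ.2))
      (fun v hv => Y0_ext hμ fun φ hφ => by simpa using hv ⟨φ, hφ⟩)
      (StrongAct.continuous_axis i w) fun φ s => ?_
    have := key φ.1 φ.2 s
    refine this.congr_deriv ?_
    change _ = w (tr (-(s • bv i)) (testX μ φ.1 φ.2))
    rw [tr_testX, tr_testX, h]
    congr 2
    exact testX_congr (pd_comp_sub i φ.1 _).symm _ _

theorem GenChain.hasDerivY (hμ : 0 < μ) {α : Fin 2 → ℕ} {v w : Y0 μ} (h : GenChain α v w) :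
    HasDerivY μ α v w := by
  induction h with
  | refl v => intro φ h; simp [mderiv]
  | @step α v g k i _ hi ih =>
    intro φ h
    rw [(isGen_Y0_iff hμ).1 hi φ h, ih, sum_add_single, pow_succ,
      testX_congr (h.mderiv_add_single α i).symm ((h.pderiv i).multideriv α) (h.multideriv _)]
    ring

/-! ### Curves in the Sobolev spaces as families of derivatives -/

theorem ContH.isTower {n : ℕ} {T : ℝ} {ζ : ℝ → L2} (h : ContH n T ζ) :
    ∃ e : (Fin 2 → ℕ) → ℝ → L2, IsTower n (Icc 0 T) e ∧ ∀ t ∈ Icc 0 T, e 0 t = ζ t := by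
  classical
  choose! D hD hD' using h
  refine ⟨D, ⟨hD, fun α hα t ht i => isGen_L2_iff.2 ?_⟩, fun t ht => ?_⟩
  · exact (hD' α hα.le t ht).of_step (hD' _ (by rw [sum_add_single]; omega) t ht)
  · exact (Lp.ext (hD' 0 (by simp) t ht).eq_of_zero).symm

theorem MemH.isTower {n : ℕ} {f : Plane → ℝ} (h : MemH n f) :
    ∃ e : (Fin 2 → ℕ) → Unit → L2, IsTower n univ e ∧ e 0 () =ᵐ[volume] f := by
  choose! D hD hD' using h
  classical
  refine ⟨fun α _ => if h : MemLp (D α) 2 (volume : Measure Plane) then h.toLp _ else 0,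
    ⟨fun α _ => continuousOn_const, fun α hα t ht i => isGen_L2_iff.2 ?_⟩, ?_⟩
  · have h1 : ∑ j, (α + Pi.single i 1 : Fin 2 → ℕ) j ≤ n := by rw [sum_add_single]; omega
    simp only [dif_pos (hD α hα.le), dif_pos (hD _ h1)]
    exact ((hD' α hα.le).of_step (hD' _ h1)).congr (hD α hα.le).coeFn_toLp.symm
      (hD _ h1).coeFn_toLp.symm
  · have h0 : ∑ j, (0 : Fin 2 → ℕ) j ≤ n := by simp
    simp only [dif_pos (hD 0 h0)]
    exact (hD 0 h0).coeFn_toLp.trans (hD' 0 h0).eq_of_zero.symm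

theorem ContX.isTower {n : ℕ} {T : ℝ} {u : ℝ → X0 μ} (h : ContX μ n T u) :
    ∃ e : (Fin 2 → ℕ) → ℝ → X0 μ, IsTower n (Icc 0 T) e ∧ ∀ t ∈ Icc 0 T, e 0 t = u t := by
  choose! D hD hD' using h
  have hw : ∀ α, ∑ i, α i ≤ n → ∀ t ∈ Icc 0 T, ∀ j,
      HasWeakDeriv α (vc μ j (u t)) (vc μ j (D α t)) := fun α hα t ht j =>
    (hD' α hα t ht j).congr (coeFn_vc j _).symm (coeFn_vc j _).symm
  refine ⟨D, ⟨hD, fun α hα t ht i => isGen_X0_iff.2 fun j => isGen_L2_iff.2 ?_⟩, fun t ht => ?_⟩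
  · exact (hw α hα.le t ht j).of_step (hw _ (by rw [sum_add_single]; omega) t ht j)
  · exact vc_ext fun j => (Lp.ext (hw 0 (by simp) t ht j).eq_of_zero).symm

theorem ContY.isTower (hμ : 0 < μ) {n : ℕ} {T : ℝ} {v : ℝ → Y0 μ} (h : ContY μ n T v) :
    ∃ e : (Fin 2 → ℕ) → ℝ → Y0 μ, IsTower n (Icc 0 T) e ∧ ∀ t ∈ Icc 0 T, e 0 t = v t := by
  choose! D hD hD' using h
  refine ⟨D, ⟨hD, fun α hα t ht i => (isGen_Y0_iff hμ).2 fun φ hφ => ?_⟩, fun t ht => ?_⟩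
  · have h1 : ∑ j, (α + Pi.single i 1 : Fin 2 → ℕ) j ≤ n := by rw [sum_add_single]; omega
    rw [hD' _ h1 t ht φ hφ, hD' α hα.le t ht _ (hφ.pderiv i), sum_add_single, pow_succ,
      testX_congr (hφ.mderiv_add_single α i) (hφ.multideriv _) ((hφ.pderiv i).multideriv α)]
    ring
  · refine Y0_ext hμ fun φ hφ => ?_
    have := hD' 0 (by simp) t ht φ hφ
    simpa [mderiv] using this

theorem HasDerivs.contX {n : ℕ} {T : ℝ} {u : ℝ → X0 μ} (h : HasDerivs n (Icc 0 T) u) :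
    ContX μ n T u := fun α hα => by
  obtain ⟨D, hD, hD'⟩ := h α hα
  refine ⟨D, hD, fun t ht i => ?_⟩
  exact ((hD' t ht).map (vc μ i)).hasWeakDeriv.congr (coeFn_vc i _) (coeFn_vc i _)

theorem HasDerivs.contY (hμ : 0 < μ) {n : ℕ} {T : ℝ} {v : ℝ → Y0 μ}
    (h : HasDerivs n (Icc 0 T) v) : ContY μ n T v := fun α hα => by
  obtain ⟨D, hD, hD'⟩ := h α hα
  exact ⟨D, hD, fun t ht => (hD' t ht).hasDerivY hμ⟩

end Density

/-! ### The Sobolev embedding `H² → C_b` -/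

/-- Two bounded functionals on `L²` agree if they agree on test functions. -/
theorem clm_ext_test {Λ Λ' : L2 →L[ℝ] ℝ}
    (h : ∀ (φ : Plane → ℝ) (hφ : IsTest φ), Λ (hφ.memLp.toLp φ) = Λ' (hφ.memLp.toLp φ)) :
    Λ = Λ' := by
  rw [← sub_eq_zero, ← (InnerProductSpace.toDual ℝ L2).symm.map_eq_zero_iff]
  refine testL_separating fun φ hφ => ?_
  rw [testL, innerSL_apply_apply, real_inner_comm, InnerProductSpace.toDual_symm_apply,
    sub_apply, h φ hφ, sub_self]

/-- Both sides are `∬ k(y) g(x + y) χ(x) dx dy`. -/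
theorem integral_mul_testL_tr {k : Plane → ℝ} (hk : Integrable k volume)
    (hk2 : MemLp k 2 (volume : Measure Plane)) {χ : Plane → ℝ} (hχ : IsTest χ) (g : L2) :
    ∫ y, k y * testL hχ (tr y g) = ∫ x, χ x * inner ℝ (hk2.toLp k) (tr x g) := by
  have hnegc : ∀ a : L2, Continuous fun y : Plane => tr (-y) a := fun a =>
    (StrongAct.cont a).comp continuous_neg
  have i1 : Integrable (fun y => k y • tr (-y) (hχ.memLp.toLp χ : L2)) volume :=
    hk.smul_of_top_left (memLp_top_of_bound (hnegc _).aestronglyMeasurable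
      ‖(hχ.memLp.toLp χ : L2)‖ (Eventually.of_forall fun y => (norm_tr _ _).le))
  have i2 : Integrable (fun x => χ x • tr (-x) (hk2.toLp k : L2)) volume :=
    (hχ.1.continuous.smul (hnegc _)).integrable_of_hasCompactSupport hχ.2.smul_right
  have e1 : ∀ g : L2, ∫ y, k y * testL hχ (tr y g)
      = innerSL ℝ (∫ y, k y • tr (-y) (hχ.memLp.toLp χ : L2)) g := fun g => by
    rw [innerSL_apply_apply, real_inner_comm, ← integral_inner i1]
    refine integral_congr_ae (Eventually.of_forall fun y => ?_)
    simp only []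
    rw [real_inner_smul_right, ← inner_tr_L2, testL, innerSL_apply_apply, real_inner_comm]
  have e2 : ∀ g : L2, ∫ x, χ x * inner ℝ (hk2.toLp k) (tr x g)
      = innerSL ℝ (∫ x, χ x • tr (-x) (hk2.toLp k : L2)) g := fun g => by
    rw [innerSL_apply_apply, real_inner_comm, ← integral_inner i2]
    refine integral_congr_ae (Eventually.of_forall fun y => ?_)
    simp only []
    rw [real_inner_smul_right, ← inner_tr_L2, real_inner_comm]
  rw [e1, e2]
  congr 1
  refine clm_ext_test fun φ hφ => ?_
  rw [← e1, ← e2]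
  have hφtr : ∀ y : Plane, ⇑(tr y (hφ.memLp.toLp φ : L2)) =ᵐ[volume] fun x => φ (x + y) :=
    fun y => (coeFn_tr y _).trans ((measurePreserving_add_right (volume : Measure Plane)
      y).quasiMeasurePreserving.ae_eq_comp hφ.memLp.coeFn_toLp)
  have a1 : ∀ y, k y * testL hχ (tr y (hφ.memLp.toLp φ : L2)) = ∫ x, k y * χ x * φ (x + y) := by
    intro y
    rw [testL_apply, ← integral_const_mul]
    refine integral_congr_ae ((hφtr y).mono fun x hx => ?_)
    simp only [hx]; ring
  have a2 : ∀ x, χ x * inner ℝ (hk2.toLp k) (tr x (hφ.memLp.toLp φ : L2))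
      = ∫ y, k y * χ x * φ (x + y) := by
    intro x
    rw [L2.inner_def, ← integral_const_mul]
    refine integral_congr_ae ?_
    filter_upwards [hφtr x, hk2.coeFn_toLp] with y h1 h2
    rw [h1, h2, add_comm]
    simp only [RCLike.inner_apply, conj_trivial]; ring
  simp only [a1, a2]
  refine integral_integral_swap ?_
  obtain ⟨C, hC⟩ := hφ.2.exists_bound_of_continuous hφ.1.continuous
  have hχi : Integrable χ volume := hχ.1.continuous.integrable_of_hasCompactSupport hχ.2
  have hc : Continuous fun p : Plane × Plane => φ (p.2 + p.1) :=
    hφ.1.continuous.comp (by fun_prop)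
  exact (hk.mul_prod hχi).mul_bdd (c := C) hc.aestronglyMeasurable
    (Eventually.of_forall fun p => hC _)

/-- One-dimensional Taylor formula `e = ∫₀¹ τₛ e ds - ∫₀¹ (1 - s) τₛ e' ds`. -/
theorem IsGen.eq_average {E : Type*} [TransAct E]
    [StrongAct E] [CompleteSpace E] {i : Fin 2} {e e' : E} (h : IsGen i e e') :
    e = (∫ s in (0 : ℝ)..1, tr (s • bv i) e) - ∫ s in (0 : ℝ)..1, (1 - s) • tr (s • bv i) e' := by
  have c1 := StrongAct.continuous_axis i e
  have c2 : Continuous fun s : ℝ => (1 - s) • tr (s • bv i) e' :=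
    (continuous_const.sub continuous_id).smul (StrongAct.continuous_axis i e')
  have hd : ∀ s : ℝ, HasDerivAt (fun s : ℝ => (1 - s) • tr (s • bv i) e)
      ((1 - s) • tr (s • bv i) e' - tr (s • bv i) e) s := fun s => by
    have := ((hasDerivAt_id s).const_sub 1).smul (h.hasDerivAt s)
    refine this.congr_deriv ?_
    simp [sub_eq_add_neg]
  have := intervalIntegral.integral_eq_sub_of_hasDerivAt (a := 0) (b := 1) (fun s _ => hd s)
    ((c2.sub c1).intervalIntegrable 0 1)
  rw [intervalIntegral.integral_sub (c2.intervalIntegrable 0 1) (c1.intervalIntegrable 0 1)]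
    at this
  simp only [sub_self, zero_smul, sub_zero, one_smul, tr_zero, zero_sub] at this
  exact (neg_sub _ _).symm.trans (neg_eq_iff_eq_neg.2 this) |>.symm

/-- Product weights on the unit square. -/
def squareKernel (p q : ℝ → ℝ) : Plane → ℝ :=
  {y : Plane | y 0 ∈ Ioc (0 : ℝ) 1 ∧ y 1 ∈ Ioc (0 : ℝ) 1}.indicator fun y => p (y 0) * q (y 1)

theorem integral_plane (f : Plane → ℝ) :
    ∫ y, f y = ∫ z : ℝ × ℝ, f (!₂[z.1, z.2]) := by
  have h1 := (PiLp.volume_preserving_toLp (Fin 2)).integral_comp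
    (MeasurableEquiv.toLp 2 (Fin 2 → ℝ)).measurableEmbedding f
  have h2 := (volume_preserving_finTwoArrow ℝ).symm.integral_comp
    (MeasurableEquiv.finTwoArrow (α := ℝ)).symm.measurableEmbedding
    fun y : Fin 2 → ℝ => f (WithLp.toLp 2 y)
  rw [← h1]
  exact h2.symm

theorem measurableSet_square :
    MeasurableSet {y : Plane | y 0 ∈ Ioc (0 : ℝ) 1 ∧ y 1 ∈ Ioc (0 : ℝ) 1} := by
  have h : ∀ i : Fin 2, Measurable fun y : Plane => y i := fun i =>
    (by fun_prop : Continuous fun y : Plane => y i).measurable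
  exact (h 0 measurableSet_Ioc).inter (h 1 measurableSet_Ioc)

theorem integral_squareKernel {p q : ℝ → ℝ} (hp : Continuous p) (hq : Continuous q)
    {G : Plane → ℝ} (hG : Continuous G) :
    ∫ y, squareKernel p q y * G y
      = ∫ s in (0 : ℝ)..1, q s * ∫ r in (0 : ℝ)..1, p r * G (r • bv 0 + s • bv 1) := by
  have hpt : ∀ z : ℝ × ℝ, (!₂[z.1, z.2] : Plane) = z.1 • bv 0 + z.2 • bv 1 := fun z => by
    rw [plane_eq !₂[z.1, z.2]]; simp
  rw [integral_plane]
  have e1 : (fun z : ℝ × ℝ => squareKernel p q !₂[z.1, z.2] * G !₂[z.1, z.2])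
      = (Ioc (0 : ℝ) 1 ×ˢ Ioc (0 : ℝ) 1).indicator
        fun z : ℝ × ℝ => q z.2 * (p z.1 * G (z.1 • bv 0 + z.2 • bv 1)) := by
    funext z
    rw [hpt]
    by_cases hz : z ∈ Ioc (0 : ℝ) 1 ×ˢ Ioc (0 : ℝ) 1
    · rw [indicator_of_mem hz, squareKernel, indicator_of_mem]
      · simp [bv]; ring
      · simpa [bv] using hz
    · rw [indicator_of_notMem hz, squareKernel, indicator_of_notMem, zero_mul]
      simpa [bv] using hz
  have hc : Continuous fun z : ℝ × ℝ => q z.2 * (p z.1 * G (z.1 • bv 0 + z.2 • bv 1)) :=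
    (hq.comp continuous_snd).mul ((hp.comp continuous_fst).mul (hG.comp (by fun_prop)))
  have hi : IntegrableOn (fun z : ℝ × ℝ => q z.2 * (p z.1 * G (z.1 • bv 0 + z.2 • bv 1)))
      (Ioc (0 : ℝ) 1 ×ˢ Ioc (0 : ℝ) 1) (volume.prod volume) :=
    (hc.continuousOn.integrableOn_compact (isCompact_Icc.prod isCompact_Icc)).mono_set
      (prod_mono Ioc_subset_Icc_self Ioc_subset_Icc_self)
  rw [e1, integral_indicator (measurableSet_Ioc.prod measurableSet_Ioc), Measure.volume_eq_prod,
    ← setIntegral_prod_swap]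
  refine (setIntegral_prod _ hi.swap).trans ?_
  rw [intervalIntegral.integral_of_le zero_le_one]
  refine setIntegral_congr_fun measurableSet_Ioc fun s _ => ?_
  simp only [intervalIntegral.integral_of_le zero_le_one]
  exact integral_const_mul (μ := volume.restrict (Ioc (0 : ℝ) 1)) (q s)
    fun r => p r * G (r • bv 0 + s • bv 1)

theorem integrable_squareKernel {p q : ℝ → ℝ} (hp : Continuous p) (hq : Continuous q) :
    Integrable (squareKernel p q) volume := by
  have hs : {y : Plane | y 0 ∈ Ioc (0 : ℝ) 1 ∧ y 1 ∈ Ioc (0 : ℝ) 1} ⊆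
      {y : Plane | ∀ i, y i ∈ Icc (0 : ℝ) 1} := fun y hy i => by
    fin_cases i
    exacts [Ioc_subset_Icc_self hy.1, Ioc_subset_Icc_self hy.2]
  have hK : IsCompact {y : Plane | ∀ i, y i ∈ Icc (0 : ℝ) 1} := by
    have := (isCompact_univ_pi fun _ : Fin 2 => isCompact_Icc (a := (0 : ℝ)) (b := 1)).image
      (PiLp.continuous_toLp 2 fun _ : Fin 2 => ℝ)
    convert this using 1
    ext y
    simp only [mem_ofPred_eq, mem_image, mem_univ_pi]
    exact ⟨fun h => ⟨y.ofLp, h, rfl⟩, by rintro ⟨z, hz, rfl⟩; exact hz⟩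
  have hc : Continuous fun y : Plane => p (y 0) * q (y 1) :=
    (hp.comp (by fun_prop)).mul (hq.comp (by fun_prop))
  rw [squareKernel, integrable_indicator_iff measurableSet_square]
  exact (hc.continuousOn.integrableOn_compact hK).mono_set hs

theorem memLp_squareKernel {p q : ℝ → ℝ} (hp : Continuous p) (hq : Continuous q) :
    MemLp (squareKernel p q) 2 (volume : Measure Plane) := by
  refine (memLp_two_iff_integrable_sq (integrable_squareKernel hp hq).aestronglyMeasurable).2 ?_
  refine (integrable_squareKernel (hp.pow 2) (hq.pow 2)).congr (Eventually.of_forall fun y => ?_)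
  simp only [squareKernel, indicator]
  split_ifs <;> simp [mul_pow]

/-- Weighted average over the unit square, as a functional on `L²`. -/
def squareFun {p q : ℝ → ℝ} (hp : Continuous p) (hq : Continuous q) : L2 →L[ℝ] ℝ :=
  innerSL ℝ ((memLp_squareKernel hp hq).toLp _)

theorem integral_mul_squareFun {p q : ℝ → ℝ} (hp : Continuous p) (hq : Continuous q)
    {χ : Plane → ℝ} (hχ : IsTest χ) (g : L2) :
    ∫ s in (0 : ℝ)..1, q s * ∫ r in (0 : ℝ)..1, p r * testL hχ (tr (r • bv 0) (tr (s • bv 1) g))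
      = ∫ x, χ x * squareFun hp hq (tr x g) := by
  have := integral_mul_testL_tr (integrable_squareKernel hp hq) (memLp_squareKernel hp hq) hχ g
  have hG : Continuous fun y => testL hχ (tr y g) :=
    (testL hχ).continuous.comp (StrongAct.cont g)
  rw [integral_squareKernel hp hq hG] at this
  simp only [tr_add] at this
  exact this

theorem IsGen.apply_eq_average {E : Type*} [TransAct E]
    [StrongAct E] [CompleteSpace E] {i : Fin 2} {e e' : E} (h : IsGen i e e') (Λ : E →L[ℝ] ℝ) :
    Λ e = (∫ s in (0 : ℝ)..1, 1 * Λ (tr (s • bv i) e))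
      - ∫ s in (0 : ℝ)..1, (1 - s) * Λ (tr (s • bv i) e') := by
  have c1 := StrongAct.continuous_axis i e
  have c2 : Continuous fun s : ℝ => (1 - s) • tr (s • bv i) e' :=
    (continuous_const.sub continuous_id).smul (StrongAct.continuous_axis i e')
  conv_lhs => rw [h.eq_average]
  rw [map_sub, ← ContinuousLinearMap.intervalIntegral_comp_comm _ (c1.intervalIntegrable 0 1),
    ← ContinuousLinearMap.intervalIntegral_comp_comm _ (c2.intervalIntegrable 0 1)]
  simp

/-- Bounded continuous functions on the plane, with the sup norm. This is a type of its own, so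
that its norm and its algebra are found along a single path. -/
def BCF : Type := BoundedContinuousFunction Plane ℝ

namespace BCF

instance : NormedCommRing BCF := inferInstanceAs (NormedCommRing (BoundedContinuousFunction Plane ℝ))

instance : NormedAlgebra ℝ BCF :=
  inferInstanceAs (NormedAlgebra ℝ (BoundedContinuousFunction Plane ℝ))

instance : NormedAddCommGroup BCF := NonUnitalNormedRing.toNormedAddCommGroup

instance : NormedSpace ℝ BCF :=
  inferInstanceAs (NormedSpace ℝ (BoundedContinuousFunction Plane ℝ))

instance : CompleteSpace BCF :=
  inferInstanceAs (CompleteSpace (BoundedContinuousFunction Plane ℝ))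

instance : FunLike BCF Plane ℝ := inferInstanceAs (FunLike (BoundedContinuousFunction Plane ℝ) _ _)

/-- Constructor from a bound. -/
def of (f : Plane → ℝ) (hf : Continuous f) (C : ℝ) (h : ∀ x, ‖f x‖ ≤ C) : BCF :=
  BoundedContinuousFunction.ofNormedAddCommGroup f hf C h

@[simp] theorem of_apply {f : Plane → ℝ} (hf : Continuous f) {C : ℝ} (h : ∀ x, ‖f x‖ ≤ C)
    (x : Plane) : of f hf C h x = f x := rfl

theorem norm_of_le {f : Plane → ℝ} (hf : Continuous f) {C : ℝ} (hC : 0 ≤ C) (h : ∀ x, ‖f x‖ ≤ C) :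
    ‖of f hf C h‖ ≤ C :=
  BoundedContinuousFunction.norm_ofNormedAddCommGroup_le hf hC h

theorem ext {f g : BCF} (h : ∀ x, f x = g x) : f = g := DFunLike.ext _ _ h

theorem continuous (f : BCF) : Continuous f := BoundedContinuousFunction.continuous f

theorem norm_apply_le (f : BCF) (x : Plane) : ‖f x‖ ≤ ‖f‖ :=
  BoundedContinuousFunction.norm_coe_le_norm f x

theorem norm_le {f : BCF} {C : ℝ} (hC : 0 ≤ C) : ‖f‖ ≤ C ↔ ∀ x, ‖f x‖ ≤ C :=
  BoundedContinuousFunction.norm_le hC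

@[simp] theorem add_apply (f g : BCF) (x : Plane) : (f + g) x = f x + g x := rfl
@[simp] theorem sub_apply (f g : BCF) (x : Plane) : (f - g) x = f x - g x := rfl
@[simp] theorem mul_apply (f g : BCF) (x : Plane) : (f * g) x = f x * g x := rfl
@[simp] theorem smul_apply (c : ℝ) (f : BCF) (x : Plane) : (c • f) x = c * f x := rfl
@[simp] theorem one_apply (x : Plane) : (1 : BCF) x = 1 := rfl
@[simp] theorem neg_apply (f : BCF) (x : Plane) : (-f) x = -f x := rfl

theorem continuous_eval : Continuous fun z : BCF × Plane => z.1 z.2 :=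
  ContinuousEval.continuous_eval (F := BoundedContinuousFunction Plane ℝ)

/-- Two bounded continuous functions which agree almost everywhere are equal. -/
theorem ext_ae {f g : BCF} (h : f =ᵐ[volume] g) : f = g :=
  DFunLike.coe_injective ((Continuous.ae_eq_iff_eq volume f.continuous g.continuous).1 h)

end BCF

instance : TransAct BCF where
  tr x := LinearMap.mkContinuous
    { toFun := fun f => BCF.of (fun y => f (y + x)) (f.continuous.comp (by fun_prop)) ‖f‖
        fun y => f.norm_apply_le _
      map_add' := fun _ _ => rfl
      map_smul' := fun _ _ => rfl } 1 fun f => by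
    rw [one_mul]
    exact BCF.norm_of_le _ (norm_nonneg f) fun y => f.norm_apply_le (y + x)
  tr_zero f := BCF.ext fun y => by
    change f (y + 0) = f y
    rw [add_zero]
  tr_add x y f := BCF.ext fun z => by
    change f (z + (x + y)) = f (z + x + y)
    rw [add_assoc]
  norm_tr x f := by
    refine le_antisymm (BCF.norm_of_le _ (norm_nonneg f) fun y => f.norm_apply_le (y + x)) ?_
    refine (BCF.norm_le (norm_nonneg _)).2 fun y => ?_
    have := BCF.norm_apply_le (BCF.of (fun y => f (y + x)) (f.continuous.comp (by fun_prop)) ‖f‖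
      fun y => f.norm_apply_le _) (y - x)
    rwa [BCF.of_apply, sub_add_cancel] at this

theorem tr_BCF_apply (x : Plane) (f : BCF) (y : Plane) : tr x f y = f (y + x) := rfl

/-- `H¹(ℝ²)`. -/
abbrev H1 : Type := DV L2
/-- `H²(ℝ²)`. -/
abbrev H2 : Type := DV H1
/-- `H³(ℝ²)`. -/
abbrev H3 : Type := DV H2
/-- `H⁴(ℝ²)`. -/
abbrev H4 : Type := DV H3

/-- Value at the origin of (the continuous representative of) an `H²` function `f`, from the
Taylor formula `f(0) = ∬ (f - (1 - r) ∂₀f - (1 - s) ∂₁f + (1 - r)(1 - s) ∂₀∂₁f)(r, s) dr ds`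
on the unit square. -/
def evalZero : H2 →L[ℝ] ℝ :=
  have h1 : Continuous fun _ : ℝ => (1 : ℝ) := continuous_const
  have hw : Continuous fun s : ℝ => 1 - s := by fun_prop
  (squareFun h1 h1).comp (DV.base.comp DV.base) - (squareFun hw h1).comp (DV.base.comp (DV.der 0))
    - ((squareFun h1 hw).comp (DV.base.comp (DV.der 1))
      - (squareFun hw hw).comp ((DV.der 0).comp (DV.der 1)))

theorem norm_evalZero_tr_le (f : H2) (x : Plane) : ‖evalZero (tr x f)‖ ≤ ‖evalZero‖ * ‖f‖ := by
  refine (evalZero.le_opNorm _).trans_eq ?_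
  rw [norm_tr]

/-- The Sobolev embedding `H² → C_b`. -/
def sobolev : H2 →L[ℝ] BCF :=
  LinearMap.mkContinuous
    { toFun := fun f => BCF.of
        (fun x => evalZero (tr x f)) (evalZero.continuous.comp (StrongAct.cont f))
        (‖evalZero‖ * ‖f‖) (norm_evalZero_tr_le f)
      map_add' := fun f g => BCF.ext fun x => by simp
      map_smul' := fun c f => BCF.ext fun x => by simp } ‖evalZero‖ fun f =>
    BCF.norm_of_le _
      (mul_nonneg (norm_nonneg _) (norm_nonneg _)) (norm_evalZero_tr_le f)

theorem sobolev_apply (f : H2) (x : Plane) : sobolev f x = evalZero (tr x f) := rfl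

instance : IsEq sobolev := ⟨fun x f => BCF.ext fun y => by
  rw [tr_BCF_apply, sobolev_apply, sobolev_apply, tr_add]⟩

theorem coeFn_sobolev (f : H2) :
    (DV.base (DV.base f) : L2) =ᵐ[volume] sobolev f := by
  refine ae_eq_of_forall_test (Lp.locallyIntegrable _)
    (sobolev f).continuous.locallyIntegrable fun χ hχ => ?_
  set g : L2 := DV.base (DV.base f)
  set g0 : L2 := DV.base (DV.der 0 f)
  set g1 : L2 := DV.base (DV.der 1 f)
  set g01 : L2 := DV.der 0 (DV.der 1 f)
  have i0 : IsGen 0 g g0 := (DV.isGen f 0).map DV.base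
  have i1 : IsGen 1 g g1 := (DV.isGen f 1).map DV.base
  have i01 : IsGen 0 g1 g01 := DV.isGen (DV.der 1 f) 0
  have h1 : Continuous fun _ : ℝ => (1 : ℝ) := continuous_const
  have hw : Continuous fun s : ℝ => 1 - s := by fun_prop
  have key : ∀ {q : ℝ → ℝ} (hq : Continuous q) {a a' : L2}, IsGen 0 a a' →
      ∫ s in (0 : ℝ)..1, q s * testL hχ (tr (s • bv 1) a)
        = (∫ x, χ x * squareFun h1 hq (tr x a)) - ∫ x, χ x * squareFun hw hq (tr x a') := by
    intro q hq a a' h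
    rw [← integral_mul_squareFun h1 hq hχ, ← integral_mul_squareFun hw hq hχ,
      ← intervalIntegral.integral_sub]
    · refine intervalIntegral.integral_congr fun s _ => ?_
      rw [← mul_sub, (h.map (tr (s • bv 1))).apply_eq_average]
    all_goals
      refine Continuous.intervalIntegrable ?_ _ _
      refine hq.mul (intervalIntegral.continuous_parametric_intervalIntegral_of_continuous' ?_ _ _)
      refine Continuous.mul (by fun_prop) ((testL hχ).continuous.comp ?_)
      simp only [← tr_add]
      exact (StrongAct.cont _).comp (by fun_prop)
  rw [← testL_apply hχ, i1.apply_eq_average, key h1 i0, key hw i01]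
  have hint : ∀ {p q : ℝ → ℝ} (hp : Continuous p) (hq : Continuous q) (a : L2),
      Integrable (fun x => χ x * squareFun hp hq (tr x a)) volume := fun hp hq a =>
    (hχ.1.continuous.mul ((squareFun hp hq).continuous.comp
      (StrongAct.cont a))).integrable_of_hasCompactSupport hχ.2.mul_right
  rw [← integral_sub (hint _ _ _) (hint _ _ _), ← integral_sub (hint _ _ _) (hint _ _ _)]
  refine (integral_sub ((hint h1 h1 g).sub (hint hw h1 g0))
    ((hint h1 hw g1).sub (hint hw hw g01))).symm.trans ?_
  refine integral_congr_ae (Eventually.of_forall fun x => ?_)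
  have e : sobolev f x = (squareFun h1 h1 (tr x g) - squareFun hw h1 (tr x g0))
      - (squareFun h1 hw (tr x g1) - squareFun hw hw (tr x g01)) := by
    simp only [sobolev_apply, evalZero, sub_apply, ContinuousLinearMap.comp_apply, IsEq.map_tr, g,
      g0, g1, g01]
  simp only [Pi.sub_apply, e]
  ring

attribute [irreducible] sobolev

/-! ### Equivariant bilinear maps -/

section Bilinear

variable {E F G M E' M' : Type*} [TransAct E]
  [TransAct F]
  [TransAct M]
  [TransAct E']
  [TransAct M']

instance (B : M →L[ℝ] E →L[ℝ] F) (a : M' →L[ℝ] M) (b : E' →L[ℝ] E) [hB : IsEq₂ B] [ha : IsEq a]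
    [hb : IsEq b] : IsEq₂ (B.bilinearComp a b) :=
  ⟨fun x m e => by simp [ha.map_tr, hb.map_tr, hB.map_tr]⟩

instance (B C : M →L[ℝ] E →L[ℝ] F) [hB : IsEq₂ B] [hC : IsEq₂ C] : IsEq₂ (B + C) :=
  ⟨fun x m e => by simp [hC.map_tr, hB.map_tr]⟩

instance (B : M →L[ℝ] E →L[ℝ] F) [hB : IsEq₂ B] : IsEq₂ B.flip :=
  ⟨fun x m e => by simp [hB.map_tr]⟩

theorem IsGen.bilin (B : M →L[ℝ] E →L[ℝ] F) [hB : IsEq₂ B] {i : Fin 2} {m m' : M} {e e' : E}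
    (hm : IsGen i m m') (he : IsGen i e e') : IsGen i (B m e) (B m' e + B m e') := by
  have h1 := (B.hasFDerivAt.comp_hasDerivAt (0 : ℝ) hm).clm_apply he
  simp only [Function.comp, zero_smul, tr_zero] at h1
  refine h1.congr_of_eventuallyEq (Eventually.of_forall fun s => ?_)
  exact (hB.map_tr _ _ _).symm

/-- An equivariant bilinear map between differentiable vectors, with the Leibniz rule. -/
def DV.map₂ (B : M →L[ℝ] E →L[ℝ] F) [IsEq₂ B] : DV M →L[ℝ] DV E →L[ℝ] DV F :=
  DV.lift₂ (B.bilinearComp DV.base DV.base)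
    (fun i => B.bilinearComp (DV.der i) DV.base + B.bilinearComp DV.base (DV.der i))
    fun m e i => (DV.isGen m i).bilin B (DV.isGen e i)

@[simp] theorem DV.base_map₂ (B : M →L[ℝ] E →L[ℝ] F) [IsEq₂ B] (m : DV M) (e : DV E) :
    DV.base (DV.map₂ B m e) = B (DV.base m) (DV.base e) :=
  DV.base_lift₂ _ _ _ m e

@[simp] theorem DV.der_map₂ (B : M →L[ℝ] E →L[ℝ] F) [IsEq₂ B] (m : DV M) (e : DV E) (i : Fin 2) :
    DV.der i (DV.map₂ B m e) = B (DV.der i m) (DV.base e) + B (DV.base m) (DV.der i e) :=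
  DV.der_lift₂ _ _ _ m e i

/-- If both `e` and its candidate derivative `a` are differentiable vectors, it suffices to
check `∂ᵢ e = a` in the rougher space, because derivatives commute. -/
theorem DV.isGen_of_base {i : Fin 2} {e a : DV E} (h : IsGen i (DV.base e) (DV.base a)) :
    IsGen i e a :=
  DV.isGen_iff.2 ⟨h, fun j => h.swap (DV.isGen e j) (DV.isGen a j)⟩

end Bilinear

/-! ### Multiplication by bounded continuous functions -/

theorem memLp_bcf_mul (f : BCF) (g : L2) : MemLp (fun x => f x * g x) 2 (volume : Measure Plane) :=
  (Lp.memLp g).of_le_mul (c := ‖f‖)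
    (f.continuous.aestronglyMeasurable.mul (Lp.aestronglyMeasurable g))
    (Eventually.of_forall fun x => by
      rw [norm_mul]; gcongr; exact f.norm_apply_le x)

/-- The product `C_b × L² → L²`. -/
def bmul : BCF →L[ℝ] L2 →L[ℝ] L2 :=
  LinearMap.mkContinuous₂ (LinearMap.mk₂ ℝ (fun f g => (memLp_bcf_mul f g).toLp _)
    (fun f f' g => by
      rw [← MemLp.toLp_add]
      exact MemLp.toLp_congr _ _ (Eventually.of_forall fun x => by simp [add_mul]))
    (fun c f g => by
      rw [← MemLp.toLp_const_smul]
      exact MemLp.toLp_congr _ _ (Eventually.of_forall fun x => by simp [mul_assoc]))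
    (fun f g g' => by
      rw [← MemLp.toLp_add]
      refine MemLp.toLp_congr _ _ ?_
      filter_upwards [Lp.coeFn_add g g'] with x hx
      change f x * (g + g' : L2) x = f x * g x + f x * g' x
      rw [hx, Pi.add_apply, mul_add])
    (fun c f g => by
      rw [← MemLp.toLp_const_smul]
      refine MemLp.toLp_congr _ _ ?_
      filter_upwards [Lp.coeFn_smul c g] with x hx
      change f x * (c • g : L2) x = c * (f x * g x)
      rw [hx, Pi.smul_apply, smul_eq_mul, mul_left_comm])) 1 fun f g => by
  rw [one_mul]
  refine Lp.norm_le_mul_norm_of_ae_le_mul ?_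
  filter_upwards [(memLp_bcf_mul f g).coeFn_toLp] with x hx
  simp only [LinearMap.mk₂_apply, hx, norm_mul]
  gcongr
  exact f.norm_apply_le x

theorem coeFn_bmul (f : BCF) (g : L2) : bmul f g =ᵐ[volume] fun x => f x * g x :=
  (memLp_bcf_mul f g).coeFn_toLp

instance : IsEq₂ bmul := ⟨fun x f g => by
  refine Lp.ext ?_
  have h1 := (measurePreserving_add_right (volume : Measure Plane)
    x).quasiMeasurePreserving.ae_eq_comp (coeFn_bmul f g)
  filter_upwards [coeFn_bmul (tr x f) (tr x g), coeFn_tr x g, coeFn_tr x (bmul f g), h1]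
    with y e1 e2 e3 e4
  simp only [Function.comp] at e4
  rw [e1, e2, e3, e4, tr_BCF_apply]⟩

instance : IsEq₂ (ContinuousLinearMap.mul ℝ BCF) := ⟨fun _ _ _ => rfl⟩

theorem bmul_mul (f g : BCF) (a : L2) : bmul (f * g) a = bmul f (bmul g a) := by
  refine Lp.ext ?_
  filter_upwards [coeFn_bmul (f * g) a, coeFn_bmul f (bmul g a), coeFn_bmul g a] with x e1 e2 e3
  rw [e1, e2, e3, BCF.mul_apply, mul_assoc]

theorem bmul_one (a : L2) : bmul 1 a = a := by
  refine Lp.ext ?_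
  filter_upwards [coeFn_bmul 1 a] with x e1
  rw [e1, BCF.one_apply, one_mul]

theorem bmul_sobolev_comm (f g : H2) :
    bmul (sobolev f) (DV.base (DV.base g)) = bmul (sobolev g) (DV.base (DV.base f)) := by
  refine Lp.ext ?_
  filter_upwards [coeFn_bmul (sobolev f) (DV.base (DV.base g)),
    coeFn_bmul (sobolev g) (DV.base (DV.base f)), coeFn_sobolev f, coeFn_sobolev g]
    with x e1 e2 e3 e4
  rw [e1, e2, e3, e4, mul_comm]

theorem sobolev_eq_of_ae {f : H2} {g : BCF} (h : (DV.base (DV.base f) : L2) =ᵐ[volume] g) :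
    sobolev f = g :=
  BCF.ext_ae ((coeFn_sobolev f).symm.trans h)

theorem sobolev_injective : Function.Injective sobolev := fun f g h => by
  refine DV.base_injective (DV.base_injective (Lp.ext ?_))
  exact (coeFn_sobolev f).trans (h ▸ (coeFn_sobolev g).symm)

/-! ### Products of Sobolev functions -/

/-- Bounded continuous functions with gradient in `H²`. -/
abbrev CK : Type := dsub sobolev

/-- The underlying bounded continuous function. -/
abbrev CK.val : CK →L[ℝ] BCF := dsub.base sobolev

/-- The partial derivative `∂ᵢ : CK → H²`. -/
abbrev CK.der (i : Fin 2) : CK →L[ℝ] H2 := dsub.der sobolev i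

theorem CK.ext_val {p q : CK} (h : CK.val p = CK.val q) : p = q :=
  dsub.ext_of_injective sobolev_injective h

/-- The inclusion of `H³` in `CK`. -/
def incK : H3 →L[ℝ] CK :=
  dsub.lift (sobolev.comp DV.base) (fun i => DV.der i) fun f i => (DV.isGen f i).map sobolev

@[simp] theorem val_incK (f : H3) : CK.val (incK f) = sobolev (DV.base f) := rfl
@[simp] theorem der_incK (f : H3) (i : Fin 2) : CK.der i (incK f) = DV.der i f := rfl

instance : IsEq incK := dsub.lift_isEq _ _ _ fun _ => inferInstance

/-- The product `CK × H¹ → H¹`. -/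
def mul1 : CK →L[ℝ] H1 →L[ℝ] H1 :=
  DV.lift₂ (bmul.bilinearComp CK.val DV.base)
    (fun i => bmul.bilinearComp (sobolev.comp (CK.der i)) DV.base
      + bmul.bilinearComp CK.val (DV.der i))
    fun k g i => (dsub.isGen k i).bilin bmul (DV.isGen g i)

@[simp] theorem base_mul1 (k : CK) (g : H1) : DV.base (mul1 k g) = bmul (CK.val k) (DV.base g) :=
  DV.base_lift₂ _ _ _ k g

@[simp] theorem der_mul1 (k : CK) (g : H1) (i : Fin 2) : DV.der i (mul1 k g)
    = bmul (sobolev (CK.der i k)) (DV.base g) + bmul (CK.val k) (DV.der i g) :=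
  DV.der_lift₂ _ _ _ k g i

instance : IsEq₂ mul1 := DV.lift₂_isEq _ _ _ fun _ => inferInstance

/-- Leibniz rule for two `H²` functions: neither derivative need be bounded, but each one is
multiplied by a bounded function. -/
theorem isGen_bmul_sobolev (f g : H2) (i : Fin 2) :
    IsGen i (bmul (sobolev f) (DV.base (DV.base g)))
      (bmul (sobolev g) (DV.base (DV.der i f)) + bmul (sobolev f) (DV.base (DV.der i g))) := by
  have key := IsGen.leibniz (M := H2) (E := H2) (M₁ := L2) (E₁ := L2)
    (bmul.flip.bilinearComp (ContinuousLinearMap.id ℝ L2) sobolev)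
    (bmul.bilinearComp sobolev (ContinuousLinearMap.id ℝ L2)) (DV.base.comp DV.base)
    (DV.base.comp DV.base) (fun m e => (bmul_sobolev_comm m e).symm)
    ((DV.isGen f i).map DV.base) ((DV.isGen g i).map DV.base)
  rw [bmul_sobolev_comm]
  exact key

/-- The product `H² × H² → H¹`. -/
def mul22 : H2 →L[ℝ] H2 →L[ℝ] H1 :=
  DV.lift₂ (bmul.bilinearComp sobolev (DV.base.comp DV.base))
    (fun i => bmul.flip.bilinearComp (DV.base.comp (DV.der i)) sobolev
      + bmul.bilinearComp sobolev (DV.base.comp (DV.der i)))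
    fun f g i => isGen_bmul_sobolev f g i

@[simp] theorem base_mul22 (f g : H2) :
    DV.base (mul22 f g) = bmul (sobolev f) (DV.base (DV.base g)) :=
  DV.base_lift₂ _ _ _ f g

instance : IsEq₂ mul22 := DV.lift₂_isEq _ _ _ fun _ => inferInstance

/-- The product `CK × H² → H²`. -/
def mul2 : CK →L[ℝ] H2 →L[ℝ] H2 :=
  DV.lift₂ (mul1.bilinearComp (ContinuousLinearMap.id ℝ CK) DV.base)
    (fun i => mul22.bilinearComp (CK.der i) (ContinuousLinearMap.id ℝ H2)
      + mul1.bilinearComp (ContinuousLinearMap.id ℝ CK) (DV.der i))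
    fun k g i => DV.isGen_of_base <| by
      have := (dsub.isGen k i).bilin bmul ((DV.isGen g i).map DV.base)
      simpa [-map_add, map_add DV.base] using this

@[simp] theorem base_mul2 (k : CK) (g : H2) : DV.base (mul2 k g) = mul1 k (DV.base g) :=
  DV.base_lift₂ _ _ _ k g

instance : IsEq₂ mul2 := DV.lift₂_isEq _ _ _ fun _ => inferInstance

theorem sobolev_mul2 (k : CK) (f : H2) : sobolev (mul2 k f) = CK.val k * sobolev f := by
  refine sobolev_eq_of_ae ?_
  filter_upwards [coeFn_bmul (CK.val k) (DV.base (DV.base f)), coeFn_sobolev f] with x e1 e2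
  rw [base_mul2, base_mul1, e1, e2, BCF.mul_apply]

/-- The product `CK × H³ → H³`. -/
def mul3 : CK →L[ℝ] H3 →L[ℝ] H3 :=
  DV.lift₂ (mul2.bilinearComp (ContinuousLinearMap.id ℝ CK) DV.base)
    (fun i => mul2.flip.bilinearComp (CK.der i) incK
      + mul2.bilinearComp (ContinuousLinearMap.id ℝ CK) (DV.der i))
    fun k g i => DV.isGen_of_base <| DV.isGen_of_base <| by
      have := (dsub.isGen k i).bilin bmul (((DV.isGen g i).map DV.base).map DV.base)
      rw [bmul_sobolev_comm] at this
      simpa using this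

@[simp] theorem base_mul3 (k : CK) (g : H3) : DV.base (mul3 k g) = mul2 k (DV.base g) :=
  DV.base_lift₂ _ _ _ k g

instance : IsEq₂ mul3 := DV.lift₂_isEq _ _ _ fun _ => inferInstance

/-- The product `DV CK × H⁴ → H⁴`. -/
abbrev mul4 : DV CK →L[ℝ] H4 →L[ℝ] H4 := DV.map₂ mul3

theorem isGen_mul_val (k l : CK) (i : Fin 2) : IsGen i (CK.val k * CK.val l)
    (sobolev (mul2 l (CK.der i k) + mul2 k (CK.der i l))) := by
  have := (dsub.isGen k i).bilin (ContinuousLinearMap.mul ℝ BCF) (dsub.isGen l i)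
  rw [map_add, sobolev_mul2, sobolev_mul2, mul_comm (CK.val l)]
  exact this

/-- The product of `CK`. -/
def mulK : CK →L[ℝ] CK →L[ℝ] CK :=
  dsub.lift₂ ((ContinuousLinearMap.mul ℝ BCF).bilinearComp CK.val CK.val)
    (fun i => mul2.flip.bilinearComp (CK.der i) (ContinuousLinearMap.id ℝ CK)
      + mul2.bilinearComp (ContinuousLinearMap.id ℝ CK) (CK.der i))
    fun k l i => by simpa [-map_add] using isGen_mul_val k l i

@[simp] theorem val_mulK (k l : CK) : CK.val (mulK k l) = CK.val k * CK.val l := rfl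

instance : IsEq₂ mulK := dsub.lift₂_isEq _ _ _ fun _ => inferInstance

/-- The product of `DV CK`. -/
abbrev mulDK : DV CK →L[ℝ] DV CK →L[ℝ] DV CK := DV.map₂ mulK

/-- The inclusion of `H⁴` in `DV CK`. -/
abbrev incDK : H4 →L[ℝ] DV CK := DV.map incK

theorem base_incDK (f : H4) : DV.base (incDK f) = incK (DV.base f) := DV.base_map _ _

attribute [irreducible] bmul mul1 mul22 mul2 mul3 mulK incK DV.map₂

/-! ### Continuous representatives -/

/-- Integration against a test function, as a functional on `C_b`. -/
def testB {φ : Plane → ℝ} (hφ : IsTest φ) : BCF →L[ℝ] ℝ :=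
  LinearMap.mkContinuous
    { toFun := fun f => ∫ x, f x * φ x
      map_add' := fun f g => by
        rw [← integral_add (integrable_mul_test f.continuous.locallyIntegrable hφ)
          (integrable_mul_test g.continuous.locallyIntegrable hφ)]
        simp [add_mul]
      map_smul' := fun c f => by
        rw [RingHom.id_apply, smul_eq_mul, ← integral_const_mul]
        simp [mul_assoc] } (∫ x, ‖φ x‖) fun f => by
    have hi : Integrable φ volume := hφ.1.continuous.integrable_of_hasCompactSupport hφ.2
    change ‖∫ x, f x * φ x‖ ≤ _
    rw [mul_comm, ← integral_const_mul]
    refine norm_integral_le_of_norm_le (hi.norm.const_mul _) (Eventually.of_forall fun x => ?_)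
    rw [norm_mul]
    gcongr
    exact f.norm_apply_le x

theorem testB_apply {φ : Plane → ℝ} (hφ : IsTest φ) (f : BCF) : testB hφ f = ∫ x, f x * φ x := rfl

theorem testB_tr {φ : Plane → ℝ} (hφ : IsTest φ) (x : Plane) (f : BCF) :
    testB hφ (tr x f) = ∫ y, f y * φ (y - x) := by
  rw [testB_apply, ← integral_add_right_eq_self (fun y => f y * φ (y - x)) x]
  simp [tr_BCF_apply]

/-- A bounded function whose weak gradient is bounded and uniformly continuous has a continuous
representative, whose derivatives are taken uniformly. The increments `f(x + y) - f(x)` are path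
integrals of the gradient for every `y` and almost every `x`; freezing a good `x` gives the
representative. -/
theorem exists_bcf_representative {f : Plane → ℝ} {C : ℝ} (hC : ∀ᵐ x ∂(volume : Measure Plane), |f x| ≤ C)
    {p : Fin 2 → BCF} (hp : ∀ i, Continuous fun s : ℝ => tr (s • bv i) (p i))
    (h : ∀ i, HasWeakDeriv (Pi.single i 1) f (p i)) :
    ∃ g : BCF, f =ᵐ[volume] g ∧ ∀ i, IsGen i g (p i) := by
  obtain ⟨f', hf'm, hff'⟩ : ∃ f' : Plane → ℝ, Measurable f' ∧ f =ᵐ[volume] f' :=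
    ⟨_, (h 0).1.aestronglyMeasurable.stronglyMeasurable_mk.measurable,
      (h 0).1.aestronglyMeasurable.ae_eq_mk⟩
  have h' : ∀ i, HasWeakDeriv (Pi.single i 1) f' (p i) := fun i =>
    (h i).congr hff' Filter.EventuallyEq.rfl
  set Q : Fin 2 → ℝ → BCF := fun i s => ∫ r in (0 : ℝ)..s, tr (r • bv i) (p i) with hQ
  have hQd : ∀ i s, HasDerivAt (Q i) (tr (s • bv i) (p i)) s := fun i s =>
    intervalIntegral.integral_hasDerivAt_right ((hp i).intervalIntegrable 0 s)
      ((hp i).stronglyMeasurableAtFilter _ _) (hp i).continuousAt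
  have hQc : ∀ i, Continuous (Q i) := fun i =>
    continuous_iff_continuousAt.2 fun s => (hQd i s).continuousAt
  have qmp : ∀ y : Plane, Measure.QuasiMeasurePreserving (fun x : Plane => x + y) volume volume :=
    fun y => (measurePreserving_add_right volume y).quasiMeasurePreserving
  -- increments along the axes
  have hinc : ∀ i s, ∀ᵐ x ∂(volume : Measure Plane), f' (x + s • bv i) = f' x + Q i s x := by
    intro i s
    have hloc : LocallyIntegrable f' volume := (h' i).1
    refine ae_eq_of_forall_test
      (f := fun x => f' (x + s • bv i)) (g := fun x => f' x + Q i s x) ?_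
      (hloc.add (Q i s).continuous.locallyIntegrable) fun φ hφ => ?_
    · intro x
      obtain ⟨U, hU, hU'⟩ := hloc (x + s • bv i)
      refine ⟨(fun x => x + s • bv i) ⁻¹' U,
        (by fun_prop : Continuous fun x : Plane => x + s • bv i).continuousAt hU, ?_⟩
      exact ((measurePreserving_add_right volume (s • bv i)).integrableOn_comp_preimage
        (measurableEmbedding_addRight _)).2 hU'
    · have e1 : ∫ x, f' (x + s • bv i) * φ x = ∫ x, f' x * φ (x - s • bv i) := by
        rw [← integral_add_right_eq_self (fun y => f' y * φ (y - s • bv i)) (s • bv i)]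
        simp
      have e2 : testB hφ (Q i s) = ∫ r in (0 : ℝ)..s, testB hφ (tr (r • bv i) (p i)) :=
        (ContinuousLinearMap.intervalIntegral_comp_comm _ ((hp i).intervalIntegrable 0 s)).symm
      have e3 := intervalIntegral.integral_eq_sub_of_hasDerivAt (a := 0) (b := s)
        (f := fun s : ℝ => ∫ x, f' x * φ (x - s • bv i))
        (f' := fun s : ℝ => testB hφ (tr (s • bv i) (p i)))
        (fun r _ => by rw [testB_tr]; exact (h' i).hasDerivAt_shift hφ r)
        (((testB hφ).continuous.comp (hp i)).intervalIntegrable 0 s)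
      rw [← e2, testB_apply] at e3
      simp only [zero_smul, sub_zero] at e3
      simp only [add_mul]
      rw [integral_add (integrable_mul_test hloc hφ)
        (integrable_mul_test (Q i s).continuous.locallyIntegrable hφ), e1, e3]
      ring
  -- general increments
  set G : Plane → Plane → ℝ := fun x y => Q 0 (y 0) x + Q 1 (y 1) (x + y 0 • bv 0) with hG
  have hGc : Continuous fun z : Plane × Plane => G z.2 z.1 := by
    have hev : Continuous fun z : BCF × Plane => z.1 z.2 := BCF.continuous_eval
    refine Continuous.add ?_ ?_
    · exact hev.comp (((hQc 0).comp (by fun_prop)).prodMk continuous_snd)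
    · exact hev.comp (((hQc 1).comp (by fun_prop)).prodMk (by fun_prop))
  have hinc2 : ∀ y : Plane, ∀ᵐ x ∂(volume : Measure Plane), f' (x + y) = f' x + G x y := by
    intro y
    filter_upwards [hinc 0 (y 0), (qmp (y 0 • bv 0)).ae (hinc 1 (y 1))] with x h0 h1
    rw [h0, add_assoc x, ← plane_eq] at h1
    rw [h1, hG]
    ring
  have hmeas : MeasurableSet {z : Plane × Plane | f' (z.2 + z.1) = f' z.2 + G z.2 z.1} :=
    measurableSet_eq_fun (hf'm.comp (by fun_prop))
      ((hf'm.comp measurable_snd).add hGc.measurable)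
  obtain ⟨x₀, hx₀⟩ := ((Measure.ae_ae_comm (μ := (volume : Measure Plane))
    (ν := (volume : Measure Plane)) (p := fun y x => f' (x + y) = f' x + G x y)
    hmeas).1 (Eventually.of_forall hinc2)).exists
  set g₀ : Plane → ℝ := fun z => f' x₀ + G x₀ (z - x₀) with hg₀
  have hg₀c : Continuous g₀ := continuous_const.add
    (hGc.comp ((by fun_prop : Continuous fun z : Plane => z - x₀).prodMk continuous_const))
  have hfg : f' =ᵐ[volume] g₀ := by
    filter_upwards [(measurePreserving_sub_right volume x₀).quasiMeasurePreserving.ae hx₀]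
      with z hz
    rwa [add_sub_cancel] at hz
  have hbd : ∀ z, ‖g₀ z‖ ≤ C := by
    have hopen : IsOpen {z | C < ‖g₀ z‖} := isOpen_lt continuous_const hg₀c.norm
    have hnull : volume {z | C < ‖g₀ z‖} = 0 := by
      have : ∀ᵐ z ∂(volume : Measure Plane), ¬ C < ‖g₀ z‖ := by
        filter_upwards [hC, hff', hfg] with z a1 a2 a3
        rw [← a3, ← a2, not_lt]; exact a1
      exact measure_eq_zero_iff_ae_notMem.2 this
    have he := hopen.eq_empty_of_measure_zero hnull
    exact fun z => not_lt.1 fun hz => (he ▸ hz : z ∈ (∅ : Set Plane))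
  refine ⟨BCF.of g₀ hg₀c C hbd, hff'.trans hfg,
    fun i => ?_⟩
  set g : BCF := BCF.of g₀ hg₀c C hbd
  have hfg' : f' =ᵐ[volume] g := hfg
  have key : ∀ s : ℝ, tr (s • bv i) g = g + Q i s := by
    intro s
    refine BCF.ext_ae ?_
    filter_upwards [hinc i s, hfg', (qmp (s • bv i)).ae_eq_comp hfg'] with x h1 h2 h3
    simp only [Function.comp] at h3
    rw [tr_BCF_apply, ← h3, h1, h2]
    rfl
  have h1 := (hQd i 0).const_add g
  rw [zero_smul, tr_zero] at h1
  exact h1.congr_of_eventuallyEq (Eventually.of_forall key)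

/-- The element of `DV CK` given by a bounded continuous function with gradient in `H³`. -/
theorem exists_DVCK {f : BCF} {d : Fin 2 → H3} (h : ∀ i, IsGen i f (sobolev (DV.base (d i)))) :
    ∃ k : DV CK, CK.val (DV.base k) = f ∧ ∀ i, DV.der i k = incK (d i) := by
  have hsym : ∀ i j, DV.der i (d j) = DV.der j (d i) := fun i j => by
    have h1 : ∀ i j, IsGen i (sobolev (DV.base (d j))) (sobolev (DV.der i (d j))) := fun i j =>
      (DV.isGen (d j) i).map sobolev
    exact sobolev_injective ((h1 i j).unique ((h i).swap (h j) (h1 j i)))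
  refine ⟨DV.mk (dsub.mk f (fun i => DV.base (d i)) h) (fun i => incK (d i)) fun i => ?_,
    by rw [DV.base_mk]; rfl, fun i => DV.der_mk _ _ _ i⟩
  have hb := h i
  rw [← val_incK] at hb
  refine dsub.isGen_iff.2 ⟨hb, fun j => ?_⟩
  have := DV.isGen (d j) i
  rw [hsym, ← der_incK] at this
  exact this

/-! ### Inverses -/

theorem isGen_one_bcf (i : Fin 2) : IsGen i (1 : BCF) 0 := by
  have : (fun s : ℝ => (tr (s • bv i) (1 : BCF))) = fun _ => 1 := rfl
  rw [IsGen, this]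
  exact hasDerivAt_const _ _

/-- The constant function `1`. -/
def oneK : CK := dsub.mk 1 0 fun i => by
  rw [Pi.zero_apply, map_zero]
  exact isGen_one_bcf i

@[simp] theorem val_oneK : CK.val oneK = 1 := rfl

theorem isGen_oneK (i : Fin 2) : IsGen i oneK 0 := by
  refine dsub.isGen_iff.2 ⟨?_, fun j => ?_⟩
  · rw [map_zero]; exact isGen_one_bcf i
  · rw [map_zero]; exact IsGen.zero i

/-- The constant function `1`. -/
def oneDK : DV CK := DV.mk oneK 0 fun i => isGen_oneK i

@[simp] theorem base_oneDK : DV.base oneDK = oneK := DV.base_mk _ _ _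

/-- Elements of `CK` as differentiable vectors of `C_b`. -/
def CK.toDV : CK →L[ℝ] DV BCF :=
  DV.lift CK.val (fun i => sobolev.comp (CK.der i)) fun k i => dsub.isGen k i

@[simp] theorem CK.base_toDV (k : CK) : DV.base k.toDV = CK.val k := DV.base_lift _ _ _ k

theorem mulK_comm (k l : CK) : mulK k l = mulK l k :=
  CK.ext_val (by rw [val_mulK, val_mulK, mul_comm])

theorem mulK_assoc (k l m : CK) : mulK (mulK k l) m = mulK k (mulK l m) :=
  CK.ext_val (by simp only [val_mulK, mul_assoc])

theorem oneK_mulK (k : CK) : mulK oneK k = k :=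
  CK.ext_val (by rw [val_mulK, val_oneK, one_mul])

theorem bijective_of_mulK_eq_one {k l : CK} (h : mulK k l = oneK) : Function.Bijective (mulK k) :=
  Function.bijective_iff_has_inverse.2 ⟨mulK l,
    fun m => by rw [← mulK_assoc, mulK_comm l, h, oneK_mulK],
    fun m => by rw [← mulK_assoc, h, oneK_mulK]⟩

section Inverse

variable {f g : BCF}

theorem bijective_mul_bcf (hfg : f * g = 1) :
    Function.Bijective (ContinuousLinearMap.mul ℝ BCF f) :=
  Function.bijective_iff_has_inverse.2 ⟨fun a => g * a,
    fun a => by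
      change g * (f * a) = a
      rw [← mul_assoc, mul_comm g, hfg, one_mul],
    fun a => by
      change f * (g * a) = a
      rw [← mul_assoc, hfg, one_mul]⟩

theorem bijective_bmul (hfg : f * g = 1) : Function.Bijective (bmul f) :=
  Function.bijective_iff_has_inverse.2 ⟨bmul g,
    fun a => by rw [← bmul_mul, mul_comm, hfg, bmul_one],
    fun a => by rw [← bmul_mul, hfg, bmul_one]⟩

theorem bijective_mul1 {k : CK} (hfg : CK.val k * g = 1) : Function.Bijective (mul1 k) :=
  have h := DiffOp.bilin bmul (CK.toDV k)
  DiffOp.bijective_lift (CK.base_toDV k ▸ h) (bijective_bmul hfg) _ (base_mul1 k)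

theorem bijective_mul2 {h : DV CK} (hfg : CK.val (DV.base h) * g = 1) :
    Function.Bijective (mul2 (DV.base h)) :=
  DiffOp.bijective_lift (DiffOp.bilin mul1 h) (bijective_mul1 hfg) _ (base_mul2 _)

theorem CK.exists_isGen_inverse {k : CK} (hfg : CK.val k * g = 1) (i : Fin 2) :
    ∃ g', IsGen i g g' ∧ sobolev (CK.der i k) * g + CK.val k * g' = 0 := by
  have h0 := isGen_one_bcf i
  rw [← hfg] at h0
  have hop := DiffOp.bilin (ContinuousLinearMap.mul ℝ BCF) (CK.toDV k)
  rw [CK.base_toDV] at hop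
  obtain ⟨g', hg'⟩ := hop.regularity (bijective_mul_bcf hfg) h0
  exact ⟨g', hg', ((dsub.isGen k i).bilin (ContinuousLinearMap.mul ℝ BCF) hg').unique h0⟩

/-- The inverse lies in `CK`: its derivative `-h⁻² ∂ᵢh` is in `H²` because multiplication by `h`
is bijective there. -/
theorem exists_inverse_CK {h : DV CK} (hfg : CK.val (DV.base h) * g = 1) :
    ∃ l : CK, mulK (DV.base h) l = oneK := by
  have hd : ∀ i, ∃ d : H2, IsGen i g (sobolev d) := fun i => by
    obtain ⟨g', hg', h3⟩ := CK.exists_isGen_inverse hfg i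
    obtain ⟨d₁, hd₁⟩ := (bijective_mul2 hfg).2 (CK.der i (DV.base h))
    obtain ⟨d, hd⟩ := (bijective_mul2 hfg).2 d₁
    refine ⟨-d, ?_⟩
    have h4 : sobolev (CK.der i (DV.base h))
        = CK.val (DV.base h) * (CK.val (DV.base h) * sobolev d) := by
      have e1 := sobolev_mul2 (DV.base h) d₁
      have e2 := sobolev_mul2 (DV.base h) d
      rw [hd₁] at e1
      rw [hd] at e2
      rw [e1, e2]
    have h5 : sobolev (-d) = g' := by
      apply (bijective_mul_bcf hfg).1
      change CK.val (DV.base h) * sobolev (-d) = CK.val (DV.base h) * g'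
      rw [h4] at h3
      rw [map_neg]
      generalize CK.val (DV.base h) = k at *
      generalize sobolev d = e at *
      linear_combination (k * e) * hfg - h3
    rw [h5]
    exact hg'
  choose d hd using hd
  exact ⟨dsub.mk g d hd, CK.ext_val (by rw [val_mulK, val_oneK]; exact hfg)⟩

end Inverse

/-- A function in `DV CK` bounded below has an inverse. -/
theorem exists_inverse_DVCK (h : DV CK) {c : ℝ} (hc : 0 < c)
    (hlow : ∀ x, c ≤ CK.val (DV.base h) x) : ∃ g : DV CK, mulDK h g = oneDK := by
  have hf0 : ∀ x, CK.val (DV.base h) x ≠ 0 := fun x => (hc.trans_le (hlow x)).ne'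
  have hfg : CK.val (DV.base h) * BCF.of
      (fun x => (CK.val (DV.base h) x)⁻¹) ((CK.val (DV.base h)).continuous.inv₀ hf0) c⁻¹
      (fun x => by
        rw [norm_inv, Real.norm_of_nonneg (hc.le.trans (hlow x))]
        exact inv_anti₀ hc (hlow x)) = 1 :=
    BCF.ext fun x => mul_inv_cancel₀ (hf0 x)
  obtain ⟨l, hl⟩ := exists_inverse_CK hfg
  exact (DiffOp.bijective_lift (DiffOp.bilin mulK h) (bijective_of_mulK_eq_one hl) _
    (DV.base_map₂ mulK h)).2 oneDK

theorem bijective_mulDK {h g : DV CK} (hg : mulDK h g = oneDK) : Function.Bijective (mulDK h) :=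
  DiffOp.bijective_lift (DiffOp.bilin mulK h)
    (bijective_of_mulK_eq_one (by rw [← DV.base_map₂, hg, base_oneDK])) _ (DV.base_map₂ mulK h)

/-! ### The quadratic form of the elliptic operator -/

variable {μ : ℝ}

/-- The components of `u ∈ X⁰`: its two velocity components and its divergence. -/
def qX (μ : ℝ) (a : Fin 3) : X0 μ →L[ℝ] L2 := ![vc μ 0, vc μ 1, divX μ] a

@[simp] theorem qX_zero : qX μ 0 = vc μ 0 := rfl
@[simp] theorem qX_one : qX μ 1 = vc μ 1 := rfl
@[simp] theorem qX_two : qX μ 2 = divX μ := rfl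

instance (a : Fin 3) : IsEq (qX μ a) := by
  fin_cases a
  · exact inferInstanceAs (IsEq (vc μ 0))
  · exact inferInstanceAs (IsEq (vc μ 1))
  · exact inferInstanceAs (IsEq (divX μ))

/-- The transpose of `qX μ a`: for `a = 0, 1` the field with the single component `f`, and for
`a = 2` the functional `w ↦ ∫ f ∇⬝w`, which is `-∇f`. -/
def pY (μ : ℝ) (a : Fin 3) : L2 →L[ℝ] Y0 μ :=
  LinearMap.mkContinuous
    { toFun := fun f => (innerSL ℝ f).comp (qX μ a)
      map_add' := fun f g => by ext w; simp
      map_smul' := fun c f => by ext w; simp } ‖qX μ a‖ fun f => by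
    refine (ContinuousLinearMap.opNorm_comp_le _ _).trans ?_
    rw [innerSL_apply_norm, mul_comm]

theorem pY_apply (a : Fin 3) (f : L2) (w : X0 μ) : pY μ a f w = inner ℝ f (qX μ a w) := rfl

instance (a : Fin 3) : IsEq (pY μ a) := ⟨fun x f => by
  ext w
  rw [pY_apply, tr_Y0_apply, pY_apply, inner_tr_L2, IsEq.map_tr (A := qX μ a)]⟩

section Sandwich

variable {C X H Y : Type*} [TransAct C] [TransAct X] [TransAct H] [TransAct Y]

/-- The operator `u ↦ P (m (Q u))` with a coefficient `m`, as a bilinear map. -/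
def sandwich (B : C →L[ℝ] H →L[ℝ] H) (P : H →L[ℝ] Y) (Q : X →L[ℝ] H) : C →L[ℝ] X →L[ℝ] Y :=
  ((ContinuousLinearMap.compL ℝ X H Y P).comp ((ContinuousLinearMap.compL ℝ X H H).flip Q)).comp B

@[simp] theorem sandwich_apply (B : C →L[ℝ] H →L[ℝ] H) (P : H →L[ℝ] Y) (Q : X →L[ℝ] H) (m : C)
    (u : X) : sandwich B P Q m u = P (B m (Q u)) := rfl

instance (B : C →L[ℝ] H →L[ℝ] H) (P : H →L[ℝ] Y) (Q : X →L[ℝ] H) [hB : IsEq₂ B] [hP : IsEq P]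
    [hQ : IsEq Q] : IsEq₂ (sandwich B P Q) :=
  ⟨fun x m u => by simp only [sandwich_apply, hQ.map_tr, hB.map_tr, hP.map_tr]⟩

/-- The operator `∑ P_a m_ab Q_b` with coefficient matrix `m`. -/
def frakOp (B : C →L[ℝ] H →L[ℝ] H) (P : Fin 3 → H →L[ℝ] Y) (Q : Fin 3 → X →L[ℝ] H)
    (m : Fin 3 → Fin 3 → C) : X →L[ℝ] Y :=
  ∑ a, ∑ b, sandwich B (P a) (Q b) (m a b)

theorem frakOp_apply (B : C →L[ℝ] H →L[ℝ] H) (P : Fin 3 → H →L[ℝ] Y) (Q : Fin 3 → X →L[ℝ] H)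
    (m : Fin 3 → Fin 3 → C) (u : X) :
    frakOp B P Q m u = ∑ a, P a (∑ b, B (m a b) (Q b u)) := by
  simp [frakOp]

theorem continuousOn_frakOp (B : C →L[ℝ] H →L[ℝ] H) (P : Fin 3 → H →L[ℝ] Y)
    (Q : Fin 3 → X →L[ℝ] H) {s : Set ℝ} {m : ℝ → Fin 3 → Fin 3 → C}
    (hm : ∀ a b, ContinuousOn (fun t => m t a b) s) :
    ContinuousOn (fun t => frakOp B P Q (m t)) s :=
  continuousOn_finsetSum _ fun a _ => continuousOn_finsetSum _ fun b _ =>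
    (sandwich B (P a) (Q b)).continuous.comp_continuousOn (hm a b)

theorem hasDerivWithinAt_frakOp (B : C →L[ℝ] H →L[ℝ] H) (P : Fin 3 → H →L[ℝ] Y)
    (Q : Fin 3 → X →L[ℝ] H) {s : Set ℝ} {t : ℝ} {m : ℝ → Fin 3 → Fin 3 → C}
    {m' : Fin 3 → Fin 3 → C}
    (hm : ∀ a b, HasDerivWithinAt (fun t => m t a b) (m' a b) s t) :
    HasDerivWithinAt (fun t => frakOp B P Q (m t)) (frakOp B P Q m') s t :=
  HasDerivWithinAt.fun_sum fun a _ => HasDerivWithinAt.fun_sum fun b _ =>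
    (sandwich B (P a) (Q b)).hasFDerivAt.comp_hasDerivWithinAt t (hm a b)

theorem DiffOp.frakOp (B : C →L[ℝ] H →L[ℝ] H) [IsEq₂ B] (P : Fin 3 → H →L[ℝ] Y)
    (Q : Fin 3 → X →L[ℝ] H) [∀ a, IsEq (P a)] [∀ a, IsEq (Q a)] {m : Fin 3 → Fin 3 → C}
    (m' : Fin 3 → Fin 3 → DV C) (hm : ∀ a b, DV.base (m' a b) = m a b) :
    DiffOp (frakOp B P Q m) :=
  .sum _ fun a => .sum _ fun b => hm a b ▸ .bilin (sandwich B (P a) (Q b)) (m' a b)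

/-- Lifting `∑ P_a m_ab Q_b` to differentiable vectors, for a product `B'` which extends `B`. -/
theorem base_frakOp {C' : Type*} [TransAct C'] (B : C →L[ℝ] H →L[ℝ] H)
    (B' : C' →L[ℝ] DV H →L[ℝ] DV H) (P : Fin 3 → H →L[ℝ] Y)
    (Q : Fin 3 → X →L[ℝ] H) [∀ a, IsEq (P a)] [∀ a, IsEq (Q a)] {m : Fin 3 → Fin 3 → C}
    {m' : Fin 3 → Fin 3 → C'}
    (hB : ∀ a b f, DV.base (B' (m' a b) f) = B (m a b) (DV.base f)) (u : DV X) :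
    DV.base (frakOp B' (fun a => DV.map (P a)) (fun a => DV.map (Q a)) m' u)
      = frakOp B P Q m (DV.base u) := by
  simp only [frakOp_apply, map_sum, DV.base_map, hB]

end Sandwich

theorem inner_bmul_eq (m : BCF) (f g : L2) :
    (fun x => inner ℝ (bmul m f x) (g x)) =ᵐ[volume] fun x => m x * f x * g x := by
  filter_upwards [coeFn_bmul m f] with x hx
  rw [hx, mul_comm (m x * f x)]
  rfl

theorem integrable_bcf_mul_mul (m : BCF) (f g : L2) :
    Integrable (fun x => m x * f x * g x) volume :=
  (L2.integrable_inner (𝕜 := ℝ) (bmul m f) g).congr (inner_bmul_eq m f g)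

theorem inner_bmul (m : BCF) (f g : L2) : inner ℝ (bmul m f) g = ∫ x, m x * f x * g x :=
  (L2.inner_def _ _).trans (integral_congr_ae (inner_bmul_eq m f g))

theorem integrable_L2_sq (f : L2) : Integrable (fun x => f x ^ 2) volume := (Lp.memLp f).integrable_sq

theorem norm_L2_sq (f : L2) : ‖f‖ ^ 2 = ∫ x, f x ^ 2 := by
  rw [← real_inner_self_eq_norm_sq, L2.inner_def]
  exact integral_congr_ae (Eventually.of_forall fun x => (sq (f x)).symm)

/-- An operator `∑ P_a m_ab Q_b : X⁰ → (X⁰)'` with a pointwise positive definite coefficient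
matrix is coercive. -/
theorem isCoercive_frakOp_zero (hμ : 0 < μ) {m : Fin 3 → Fin 3 → BCF} {c : ℝ} (hc : 0 < c)
    (hm : ∀ (x : Plane) (q : Fin 3 → ℝ),
      c * (q 0 ^ 2 + q 1 ^ 2 + μ * q 2 ^ 2) ≤ ∑ a, ∑ b, m a b x * q b * q a) :
    IsCoercive (frakOp bmul (pY μ) (qX μ) m : X0 μ →L[ℝ] StrongDual ℝ (X0 μ)) := by
  refine ⟨c, hc, fun u => ?_⟩
  have h1 : (frakOp bmul (pY μ) (qX μ) m : X0 μ →L[ℝ] Y0 μ) u u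
      = ∫ x, ∑ a, ∑ b, m a b x * qX μ b u x * qX μ a u x := by
    have hint : ∀ a b, Integrable (fun x => m a b x * qX μ b u x * qX μ a u x) volume :=
      fun a b => integrable_bcf_mul_mul _ _ _
    rw [frakOp_apply, integral_finsetSum _ fun a _ => integrable_finsetSum _ fun b _ => hint a b,
      sum_apply]
    refine Finset.sum_congr rfl fun a _ => ?_
    rw [integral_finsetSum _ fun b _ => hint a b, pY_apply, sum_inner]
    exact Finset.sum_congr rfl fun b _ => inner_bmul _ _ _
  have hsq := integrable_L2_sq
  have h4 : c * ‖u‖ * ‖u‖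
      = ∫ x, c * (qX μ 0 u x ^ 2 + qX μ 1 u x ^ 2 + μ * qX μ 2 u x ^ 2) := by
    have h2 : Integrable (fun x => qX μ 0 u x ^ 2 + qX μ 1 u x ^ 2) volume :=
      (hsq _).add (hsq _)
    rw [integral_const_mul, integral_add h2 ((hsq _).const_mul _),
      integral_add (hsq _) (hsq _), integral_const_mul, ← norm_L2_sq, ← norm_L2_sq, ← norm_L2_sq,
      mul_assoc, ← sq, norm_sq_X0 hμ, Fin.sum_univ_two, qX_zero, qX_one, qX_two]
  rw [h4]
  refine le_of_le_of_eq (integral_mono ?_ ?_ fun x => hm x fun a => qX μ a u x) h1.symm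
  · exact (((hsq _).add (hsq _)).add ((hsq _).const_mul _)).const_mul _
  · exact integrable_finsetSum _ fun a _ => integrable_finsetSum _ fun b _ =>
      integrable_bcf_mul_mul _ _ _

/-- The Lax-Milgram theorem: a coercive operator `X⁰ → (X⁰)'` is bijective. -/
theorem bijective_of_isCoercive {A : X0 μ →L[ℝ] StrongDual ℝ (X0 μ)} (h : IsCoercive A) :
    Function.Bijective A := by
  have hfac : ⇑A = (InnerProductSpace.toDual ℝ (X0 μ)) ∘ h.continuousLinearEquivOfBilin := by
    funext u
    ext w
    exact (h.continuousLinearEquivOfBilin_apply u w).symm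
  rw [hfac]
  exact (InnerProductSpace.toDual ℝ (X0 μ)).bijective.comp
    h.continuousLinearEquivOfBilin.bijective

/-! ### The elliptic operator and its regularity -/

/-- The coefficient matrix of `𝔗`, for depth `h` and bottom slope `s`, in a commutative ring. -/
def coefMat (μ : ℝ) {R : Type*} [CommRing R] [Algebra ℝ R] (h : R) (s : Fin 2 → R) :
    Fin 3 → Fin 3 → R :=
  ![![h + μ • (h * s 0 * s 0), μ • (h * s 0 * s 1), (-(μ / 2)) • (h * h * s 0)],
    ![μ • (h * s 0 * s 1), h + μ • (h * s 1 * s 1), (-(μ / 2)) • (h * h * s 1)],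
    ![(-(μ / 2)) • (h * h * s 0), (-(μ / 2)) • (h * h * s 1), (μ / 3) • (h * h * h)]]

/-- Pointwise coercivity of the quadratic form
`h |u|² + μ (h³ d² / 3 - h² (s⬝u) d + h (s⬝u)²)`. -/
theorem coefMat_coercive (hμ : 0 < μ) {l h : ℝ} (hl : 0 < l) (hh : l ≤ h) (s : Fin 2 → ℝ)
    (q : Fin 3 → ℝ) : min l (l ^ 3 / 12) * (q 0 ^ 2 + q 1 ^ 2 + μ * q 2 ^ 2)
      ≤ ∑ a, ∑ b, coefMat μ h s a b * q b * q a := by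
  have e : ∑ a, ∑ b, coefMat μ h s a b * q b * q a
      = h * (q 0 ^ 2 + q 1 ^ 2) + μ * (h ^ 3 * (q 2 ^ 2 / 12)
        + h * (h * q 2 / 2 - (s 0 * q 0 + s 1 * q 1)) ^ 2) := by
    simp [Fin.sum_univ_three, coefMat]
    ring
  rw [e]
  have h0 : 0 < h := hl.trans_le hh
  have h3 : l ^ 3 ≤ h ^ 3 := by gcongr
  have b1 : min l (l ^ 3 / 12) * (q 0 ^ 2 + q 1 ^ 2) ≤ h * (q 0 ^ 2 + q 1 ^ 2) := by
    gcongr; exact (min_le_left _ _).trans hh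
  have b2 : min l (l ^ 3 / 12) * (μ * q 2 ^ 2) ≤ h ^ 3 / 12 * (μ * q 2 ^ 2) := by
    gcongr; exact (min_le_right _ _).trans (by gcongr)
  have b3 : 0 ≤ μ * (h * (h * q 2 / 2 - (s 0 * q 0 + s 1 * q 1)) ^ 2) := by positivity
  nlinarith

/-- `coefMat` with values in `DV CK`. -/
def coefDK (μ : ℝ) (h : DV CK) (s : Fin 2 → DV CK) : Fin 3 → Fin 3 → DV CK :=
  ![![h + μ • mulDK (mulDK h (s 0)) (s 0), μ • mulDK (mulDK h (s 0)) (s 1),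
      (-(μ / 2)) • mulDK (mulDK h h) (s 0)],
    ![μ • mulDK (mulDK h (s 0)) (s 1), h + μ • mulDK (mulDK h (s 1)) (s 1),
      (-(μ / 2)) • mulDK (mulDK h h) (s 1)],
    ![(-(μ / 2)) • mulDK (mulDK h h) (s 0), (-(μ / 2)) • mulDK (mulDK h h) (s 1),
      (μ / 3) • mulDK (mulDK h h) h]]

theorem val_coefDK (h : DV CK) (s : Fin 2 → DV CK) (a b : Fin 3) :
    CK.val (DV.base (coefDK μ h s a b))
      = coefMat μ (CK.val (DV.base h)) (fun j => CK.val (DV.base (s j))) a b := by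
  fin_cases a <;> fin_cases b <;> simp [coefDK, coefMat]

theorem coefMat_apply (h : BCF) (s : Fin 2 → BCF) (a b : Fin 3) (x : Plane) :
    coefMat μ h s a b x = coefMat μ (h x) (fun j => s j x) a b := by
  fin_cases a <;> fin_cases b <;> simp [coefMat]

theorem continuousOn_coefDK {s : Fin 2 → DV CK} {h : ℝ → DV CK} {I : Set ℝ}
    (hh : ContinuousOn h I) (a b : Fin 3) : ContinuousOn (fun t => coefDK μ (h t) s a b) I := by
  have h2 : ∀ {f g : ℝ → DV CK}, ContinuousOn f I → ContinuousOn g I →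
      ContinuousOn (fun t => mulDK (f t) (g t)) I := fun hf hg =>
    mulDK.continuous₂.comp_continuousOn (hf.prodMk hg)
  have hc : ∀ k : DV CK, ContinuousOn (fun _ : ℝ => k) I := fun _ => continuousOn_const
  have c1 : ∀ i j, ContinuousOn (fun t => μ • mulDK (mulDK (h t) (s i)) (s j)) I := fun i j =>
    (h2 (h2 hh (hc _)) (hc _)).const_smul μ
  have c2 : ∀ i, ContinuousOn (fun t => (-(μ / 2)) • mulDK (mulDK (h t) (h t)) (s i)) I :=
    fun i => (h2 (h2 hh hh) (hc _)).const_smul (-(μ / 2))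
  have c3 : ContinuousOn (fun t => (μ / 3) • mulDK (mulDK (h t) (h t)) (h t)) I :=
    (h2 (h2 hh hh) hh).const_smul (μ / 3)
  fin_cases a <;> fin_cases b
  exacts [hh.add (c1 0 0), c1 0 1, c2 0, c1 0 1, hh.add (c1 1 1), c2 1, c2 0, c2 1, c3]

/-- The derivative of the coefficient matrix with respect to `h`, in the direction `k`. -/
def coefMatDeriv (μ : ℝ) {R : Type*} [CommRing R] [Algebra ℝ R] (h k : R) (s : Fin 2 → R) :
    Fin 3 → Fin 3 → R :=
  ![![k + μ • (k * s 0 * s 0), μ • (k * s 0 * s 1), (-μ) • (h * k * s 0)],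
    ![μ • (k * s 0 * s 1), k + μ • (k * s 1 * s 1), (-μ) • (h * k * s 1)],
    ![(-μ) • (h * k * s 0), (-μ) • (h * k * s 1), μ • (h * h * k)]]

theorem hasDerivWithinAt_coefMat {h : ℝ → BCF} {k : BCF} {s : Fin 2 → BCF} {I : Set ℝ} {t : ℝ}
    (hh : HasDerivWithinAt h k I t) (a b : Fin 3) :
    HasDerivWithinAt (fun t => coefMat μ (h t) s a b) (coefMatDeriv μ (h t) k s a b) I t := by
  have hm : ∀ {f g : ℝ → BCF} {f' g' : BCF}, HasDerivWithinAt f f' I t →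
      HasDerivWithinAt g g' I t → HasDerivWithinAt (fun t => f t * g t)
        (f' * g t + f t * g') I t := fun hf hg => hf.mul hg
  have hc : ∀ s : BCF, HasDerivWithinAt (fun _ : ℝ => s) 0 I t := fun s =>
    hasDerivWithinAt_const _ _ _
  have d1 : ∀ i j, HasDerivWithinAt (fun t => μ • (h t * s i * s j)) (μ • (k * s i * s j)) I t :=
    fun i j => ((hm (hm hh (hc _)) (hc _)).const_smul μ).congr_deriv (by simp)
  have d2 : ∀ i, HasDerivWithinAt (fun t => (-(μ / 2)) • (h t * h t * s i))
      ((-μ) • (h t * k * s i)) I t := fun i =>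
    ((hm (hm hh hh) (hc _)).const_smul (-(μ / 2))).congr_deriv (by
      refine BCF.ext fun x => ?_
      simp; ring)
  have d3 : HasDerivWithinAt (fun t => (μ / 3) • (h t * h t * h t))
      (μ • (h t * h t * k)) I t :=
    ((hm (hm hh hh) hh).const_smul (μ / 3)).congr_deriv (by
      refine BCF.ext fun x => ?_
      simp; ring)
  fin_cases a <;> fin_cases b
  exacts [hh.add (d1 0 0), d1 0 1, d2 0, d1 0 1, hh.add (d1 1 1), d2 1, d2 0, d2 1, d3]

variable {μ : ℝ}

/-- `X⁴`. -/
abbrev X4 (μ : ℝ) : Type := DV (DV (DV (DV (X0 μ))))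

/-- `Y⁴`. -/
abbrev Y4 (μ : ℝ) : Type := DV (DV (DV (DV (Y0 μ))))

/-- `qX` on `X⁴`. -/
abbrev qX4 (μ : ℝ) (a : Fin 3) : X4 μ →L[ℝ] H4 := DV.map (DV.map (DV.map (DV.map (qX μ a))))

/-- `pY` on `H⁴`. -/
abbrev pY4 (μ : ℝ) (a : Fin 3) : H4 →L[ℝ] Y4 μ := DV.map (DV.map (DV.map (DV.map (pY μ a))))

/-- The vector in the roughest space underlying a four times differentiable vector. -/
def base4 {E : Type*} [TransAct E] : DV (DV (DV (DV E))) →L[ℝ] E :=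
  DV.base.comp (DV.base.comp (DV.base.comp DV.base))

theorem base4_apply {E : Type*} [TransAct E] (p : DV (DV (DV (DV E)))) :
    base4 p = DV.base (DV.base (DV.base (DV.base p))) := rfl

/-- The operator `𝔗 : X⁰ → (X⁰)'` with depth `h` and bottom slope `s`. -/
def frak0 (μ : ℝ) (h : BCF) (s : Fin 2 → BCF) : X0 μ →L[ℝ] Y0 μ :=
  frakOp bmul (pY μ) (qX μ) (coefMat μ h s)

/-- The operator `𝔗 : X⁴ → Y⁴` with depth `h` and bottom slope `s`. -/
def frak4 (μ : ℝ) (h : DV CK) (s : Fin 2 → DV CK) : X4 μ →L[ℝ] Y4 μ :=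
  frakOp mul4 (pY4 μ) (qX4 μ) (coefDK μ h s)

theorem bijective_frak0 (hμ : 0 < μ) {h : BCF} {s : Fin 2 → BCF} {l : ℝ} (hl : 0 < l)
    (hh : ∀ x, l ≤ h x) : Function.Bijective (frak0 μ h s) :=
  bijective_of_isCoercive <| isCoercive_frakOp_zero hμ (c := min l (l ^ 3 / 12))
    (lt_min hl (by positivity)) fun x q => by
    simp only [coefMat_apply]
    exact coefMat_coercive hμ hl (hh x) _ q

theorem val_coefDK' (h : DV CK) (s : Fin 2 → DV CK) :
    (fun a b => CK.val (DV.base (coefDK μ h s a b)))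
      = coefMat μ (CK.val (DV.base h)) (fun j => CK.val (DV.base (s j))) :=
  funext fun a => funext fun b => val_coefDK h s a b

theorem base4_frak4 (h : DV CK) (s : Fin 2 → DV CK) (u : X4 μ) :
    base4 (frak4 μ h s u)
      = frak0 μ (CK.val (DV.base h)) (fun j => CK.val (DV.base (s j))) (base4 u) := by
  rw [frak0, ← val_coefDK', base4_apply, base4_apply, frak4]
  rw [base_frakOp mul3 mul4 _ _ fun a b f => DV.base_map₂ mul3 (coefDK μ h s a b) f,
    base_frakOp mul2 mul3 _ _ fun a b f => base_mul3 _ f,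
    base_frakOp mul1 mul2 _ _ fun a b f => base_mul2 _ f,
    base_frakOp bmul mul1 _ _ fun a b f => base_mul1 _ f]

/-- Elliptic regularity: `𝔗` is bijective from `X⁴` to `Y⁴`. -/
theorem bijective_frak4 (hμ : 0 < μ) {h : DV CK} {s : Fin 2 → DV CK} {l : ℝ} (hl : 0 < l)
    (hh : ∀ x, l ≤ CK.val (DV.base h) x) : Function.Bijective (frak4 μ h s) := by
  set m := coefDK μ h s
  have b0 := bijective_frak0 hμ (s := fun j => CK.val (DV.base (s j))) hl hh
  rw [frak0, ← val_coefDK'] at b0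
  have b1 := DiffOp.bijective_lift
    (DiffOp.frakOp bmul (pY μ) (qX μ) (fun a b => (DV.base (m a b)).toDV) fun a b =>
      CK.base_toDV _) b0 _ (base_frakOp bmul mul1 _ _ fun a b f => base_mul1 (DV.base (m a b)) f)
  have b2 := DiffOp.bijective_lift (DiffOp.frakOp mul1 _ _ m fun a b => rfl) b1 _
    (base_frakOp mul1 mul2 _ _ fun a b f => base_mul2 (DV.base (m a b)) f)
  have b3 := DiffOp.bijective_lift (DiffOp.frakOp mul2 _ _ m fun a b => rfl) b2 _
    (base_frakOp mul2 mul3 _ _ fun a b f => base_mul3 (DV.base (m a b)) f)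
  exact DiffOp.bijective_lift (DiffOp.frakOp mul3 _ _ m fun a b => rfl) b3 _
    (base_frakOp mul3 mul4 _ _ fun a b f => DV.base_map₂ mul3 (m a b) f)

/-! ### Multiplication by a function in `CK` on `X⁰` and on its dual -/

/-- Test fields span a dense subspace of `X⁰`. -/
theorem clm_ext_testX {E : Type*} [NormedAddCommGroup E] [NormedSpace ℝ E] (hμ : 0 < μ)
    {A B : X0 μ →L[ℝ] E}
    (h : ∀ (φ : Plane → Plane) (hφ : IsTest φ), A (testX μ φ hφ) = B (testX μ φ hφ)) : A = B := by
  set K : Submodule ℝ (X0 μ) := LinearMap.ker (A - B : X0 μ →L[ℝ] E).toLinearMap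
  have hclosed : IsClosed (K : Set (X0 μ)) := (A - B).isClosed_ker
  have : CompleteSpace K := hclosed.completeSpace_coe
  have hK : K = ⊤ := by
    rw [← Submodule.orthogonal_eq_bot_iff, Submodule.eq_bot_iff]
    intro w hw
    refine eq_zero_of_inner_testX hμ fun φ hφ => ?_
    refine (Submodule.mem_orthogonal K w).1 hw _ ?_
    change (A - B) _ = 0
    rw [sub_apply, h φ hφ, sub_self]
  ext u
  have : u ∈ K := hK ▸ Submodule.mem_top
  have h2 : (A - B) u = 0 := this
  rwa [sub_apply, sub_eq_zero] at h2

/-- `∇⬝(k u) = k ∇⬝u + ∇k ⬝ u`. -/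
def divMul (μ : ℝ) (k : CK) : X0 μ →L[ℝ] L2 :=
  (bmul (CK.val k)).comp (divX μ) + ∑ i, (bmul (sobolev (CK.der i k))).comp (vc μ i)

theorem divMul_apply (k : CK) (u : X0 μ) : divMul μ k u
    = bmul (CK.val k) (divX μ u) + ∑ i, bmul (sobolev (CK.der i k)) (vc μ i u) := by
  simp [divMul]

theorem sum_testL_bmul (hμ : 0 < μ) (k : CK) (u : X0 μ) {φ : Plane → ℝ} (hφ : IsTest φ) :
    ∑ i, testL (hφ.pderiv i) (bmul (CK.val k) (vc μ i u)) = -testL hφ (divMul μ k u) := by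
  have key : ∑ i, (testL (hφ.pderiv i)).comp ((bmul (CK.val k)).comp (vc μ i))
      = -(testL hφ).comp (divMul μ k) := by
    refine clm_ext_testX hμ fun ψ hψ => ?_
    have hgen : ∀ i, IsGen i (vc μ i (testX μ ψ hψ)) (vc μ i (testX μ (pd i ψ) (hψ.pderiv i))) :=
      fun i => (isGen_testX hψ i).map _
    have h1 : ∀ i, testL (hφ.pderiv i) (bmul (CK.val k) (vc μ i (testX μ ψ hψ)))
        = -testL hφ (bmul (sobolev (CK.der i k)) (vc μ i (testX μ ψ hψ))
          + bmul (CK.val k) (vc μ i (testX μ (pd i ψ) (hψ.pderiv i)))) := fun i => by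
      have := (hasWeakDeriv_single_iff.1
        (isGen_L2_iff.1 ((dsub.isGen k i).bilin bmul (hgen i)))).2.2 φ hφ
      rwa [← testL_apply, ← testL_apply] at this
    have h2 : divX μ (testX μ ψ hψ) = ∑ i, vc μ i (testX μ (pd i ψ) (hψ.pderiv i)) := by
      refine sub_eq_zero.1 (testL_separating fun χ hχ => ?_)
      have h3 := sum_testL_vc hμ (testX μ ψ hψ) hχ
      have h4 : ∀ i, testL (hχ.pderiv i) (vc μ i (testX μ ψ hψ))
          = -testL hχ (vc μ i (testX μ (pd i ψ) (hψ.pderiv i))) := fun i => by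
        have := (hasWeakDeriv_single_iff.1 (isGen_L2_iff.1 (hgen i))).2.2 χ hχ
        rwa [← testL_apply, ← testL_apply] at this
      simp only [h4, Finset.sum_neg_distrib, neg_inj] at h3
      rw [map_sub, map_sum, h3, sub_self]
    simp only [sum_apply, ContinuousLinearMap.comp_apply, neg_apply, h1, divMul_apply, h2, map_sum,
      map_add, Finset.sum_neg_distrib, Finset.sum_add_distrib]
    rw [add_comm]
  have := congrArg (fun A : X0 μ →L[ℝ] ℝ => A u) key
  simpa using this

/-- The field in `L²` with the single component `f` in direction `j`. -/
def singleV (j : Fin 2) : L2 →L[ℝ] L2V :=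
  ContinuousLinearMap.compLpL 2 volume (ContinuousLinearMap.toSpanSingleton ℝ (bv j))

theorem compV_singleV (i j : Fin 2) (f : L2) : compV i (singleV j f) = if i = j then f else 0 := by
  refine Lp.ext ?_
  have h0 : (singleV j f : Plane → Plane) =ᵐ[volume] fun x => f x • bv j :=
    ContinuousLinearMap.coeFn_compLpL _ f
  filter_upwards [coeFn_compV i (singleV j f), h0, Lp.coeFn_zero ℝ 2 (volume : Measure Plane)]
    with x h1 h2 h3
  rw [h1, h2]
  split_ifs with h
  · subst h; simp [bv]
  · rw [h3]; simp [bv, h]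

/-- The velocity field with components `k u₀, k u₁`. -/
def velMul (μ : ℝ) (k : CK) : X0 μ →L[ℝ] L2V :=
  ∑ j, (singleV j).comp ((bmul (CK.val k)).comp (vc μ j))

theorem compV_velMul (k : CK) (u : X0 μ) (i : Fin 2) :
    compV i (velMul μ k u) = bmul (CK.val k) (vc μ i u) := by
  fin_cases i <;> simp [velMul, compV_singleV]

theorem hasWeakDiv_velMul (hμ : 0 < μ) (k : CK) (u : X0 μ) :
    HasWeakDiv (velMul μ k u) (divMul μ k u) :=
  (hasWeakDiv_iff _ _).2 fun φ hφ => by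
    simp only [compV_velMul]
    exact sum_testL_bmul hμ k u hφ

/-- Multiplication by `k` on `X⁰`. -/
def mulXK (hμ : 0 < μ) (k : CK) : X0 μ →L[ℝ] X0 μ :=
  (((WithLp.prodContinuousLinearEquiv 2 ℝ L2V L2).symm : L2V × L2 →L[ℝ] WithLp 2 (L2V × L2)).comp
    ((velMul μ k).prod (√μ • divMul μ k))).codRestrict (X0sub μ) fun u =>
      (mkX hμ _ _ (hasWeakDiv_velMul hμ k u)).2

theorem mulXK_apply (hμ : 0 < μ) (k : CK) (u : X0 μ) :
    mulXK hμ k u = mkX hμ _ _ (hasWeakDiv_velMul hμ k u) := rfl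

theorem vc_mulXK (hμ : 0 < μ) (k : CK) (u : X0 μ) (j : Fin 2) :
    vc μ j (mulXK hμ k u) = bmul (CK.val k) (vc μ j u) := by
  rw [mulXK_apply, vc, ContinuousLinearMap.comp_apply, velX_mkX, compV_velMul]
  rfl

theorem divX_mulXK (hμ : 0 < μ) (k : CK) (u : X0 μ) :
    divX μ (mulXK hμ k u) = divMul μ k u := by
  rw [mulXK_apply, divX_mkX]

theorem velX_mulXK (hμ : 0 < μ) (k : CK) (u : X0 μ) :
    velX μ (mulXK hμ k u) =ᵐ[volume] fun x => CK.val k x • velX μ u x := by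
  have h0 : ∀ j, (fun x => velX μ (mulXK hμ k u) x j) =ᵐ[volume] fun x => CK.val k x * velX μ u x j :=
    fun j => by
    have := coeFn_vc j (mulXK hμ k u)
    rw [vc_mulXK] at this
    filter_upwards [this, coeFn_bmul (CK.val k) (vc μ j u), coeFn_vc j u] with x h1 h2 h3
    rw [← h1, h2, h3]
  filter_upwards [h0 0, h0 1] with x h1 h2
  ext j
  fin_cases j
  exacts [h1, h2]

/-- The multiplication operator of the definition of `𝔗` is the concrete one. -/
theorem mulX_eq (hμ : 0 < μ) {k : CK} {f : Plane → ℝ} (hf : f =ᵐ[volume] CK.val k) :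
    mulX μ f = mulXK hμ k := by
  have hex : ∃ M : X0 μ →L[ℝ] X0 μ, ∀ w, velX μ (M w) =ᵐ[volume] fun x => f x • velX μ w x :=
    ⟨mulXK hμ k, fun w => by
      filter_upwards [velX_mulXK hμ k w, hf] with x h1 h2
      rw [h1, h2]⟩
  rw [mulX, dif_pos hex]
  ext1 w
  refine velX_injective (Lp.ext ?_)
  filter_upwards [hex.choose_spec w, velX_mulXK hμ k w, hf] with x h1 h2 h3
  rw [h1, h2, h3]

/-! ### Multiplication by a function on `Y⁰` and on `Y⁴` -/

/-- `v ∈ (X⁰)'` is represented by `w = rieszX v`: `v = w - μ ∇∇⬝w`. -/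
theorem apply_eq_riesz (hμ : 0 < μ) (v : Y0 μ) (w : X0 μ) :
    v w = ∑ i, inner ℝ (vc μ i (rieszX μ v)) (vc μ i w)
      + μ * inner ℝ (divX μ (rieszX μ v)) (divX μ w) := by
  rw [← inner_rieszX, inner_X0 hμ]

/-- The field in `(X⁰)'` with components `f 0, f 1`. -/
abbrev eY (μ : ℝ) (j : Fin 2) : L2 →L[ℝ] Y0 μ := pY μ j.castSucc

theorem eY_apply (j : Fin 2) (f : L2) (w : X0 μ) : eY μ j f w = inner ℝ f (vc μ j w) := by
  fin_cases j <;> rfl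

theorem pY_two_apply (f : L2) (w : X0 μ) : pY μ 2 f w = inner ℝ f (divX μ w) := rfl

/-- `-k ∇q = -∇(k q) + q ∇k`, as a bilinear map. -/
def gradMul (μ : ℝ) : CK →L[ℝ] L2 →L[ℝ] Y0 μ :=
  (ContinuousLinearMap.compL ℝ L2 L2 (Y0 μ) (pY μ 2)).comp (bmul.comp CK.val)
    + ∑ j, (ContinuousLinearMap.compL ℝ L2 L2 (Y0 μ) (eY μ j)).comp
      (bmul.comp (sobolev.comp (CK.der j)))

theorem gradMul_apply (k : CK) (q : L2) : gradMul μ k q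
    = pY μ 2 (bmul (CK.val k) q) + ∑ j, eY μ j (bmul (sobolev (CK.der j k)) q) := by
  simp [gradMul]

/-- Multiplication by `k` on `(X⁰)'`. -/
def mulYK (μ : ℝ) : CK →L[ℝ] Y0 μ →L[ℝ] Y0 μ :=
  ∑ j, sandwich (bmul.comp CK.val) (eY μ j) ((vc μ j).comp (rieszX μ))
    + μ • ((ContinuousLinearMap.compL ℝ (Y0 μ) L2 (Y0 μ)).flip
      ((divX μ).comp (rieszX μ))).comp (gradMul μ)

theorem mulYK_eq (k : CK) (v : Y0 μ) : mulYK μ k v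
    = ∑ j, eY μ j (bmul (CK.val k) (vc μ j (rieszX μ v)))
      + μ • gradMul μ k (divX μ (rieszX μ v)) := by
  simp [mulYK]

theorem inner_bmul_comm (f : BCF) (a c : L2) : inner ℝ (bmul f a) c = inner ℝ a (bmul f c) := by
  rw [inner_bmul, real_inner_comm, inner_bmul]
  exact integral_congr_ae (Eventually.of_forall fun x => by ring)

theorem mulYK_apply (hμ : 0 < μ) (k : CK) (v : Y0 μ) (w : X0 μ) :
    mulYK μ k v w = v (mulXK hμ k w) := by
  rw [apply_eq_riesz hμ v, mulYK_eq, gradMul_apply]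
  simp only [add_apply, sum_apply, smul_apply, eY_apply, pY_two_apply, inner_bmul_comm, vc_mulXK,
    divX_mulXK, divMul_apply, inner_add_right, inner_sum, smul_eq_mul]

theorem mulY_eq (hμ : 0 < μ) {k : CK} {f : Plane → ℝ} (hf : f =ᵐ[volume] CK.val k) (v : Y0 μ) :
    mulY μ f v = mulYK μ k v := by
  ext w
  rw [mulYK_apply hμ, mulY, mulX_eq hμ hf]
  rfl

theorem mulYK_mulYK (hμ : 0 < μ) (k l : CK) (v : Y0 μ) :
    mulYK μ k (mulYK μ l v) = mulYK μ (mulK k l) v := by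
  ext w
  rw [mulYK_apply hμ, mulYK_apply hμ, mulYK_apply hμ]
  congr 1
  refine vc_ext fun j => ?_
  rw [vc_mulXK, vc_mulXK, vc_mulXK, val_mulK, mul_comm, bmul_mul]

theorem mulYK_one (hμ : 0 < μ) (v : Y0 μ) : mulYK μ oneK v = v := by
  ext w
  rw [mulYK_apply hμ]
  congr 1
  exact vc_ext fun j => by rw [vc_mulXK, val_oneK, bmul_one]

theorem mulYK_eY (hμ : 0 < μ) (k : CK) (j : Fin 2) (f : L2) :
    mulYK μ k (eY μ j f) = eY μ j (bmul (CK.val k) f) := by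
  ext w
  rw [mulYK_apply hμ, eY_apply, eY_apply, vc_mulXK, inner_bmul_comm]

variable {μ : ℝ}

theorem CK.val_der (h : DV CK) (j : Fin 2) :
    CK.val (DV.der j h) = sobolev (CK.der j (DV.base h)) :=
  ((DV.isGen h j).map CK.val).unique (dsub.isGen (DV.base h) j)

theorem CK.der_der_comm (h : DV CK) (i j : Fin 2) :
    CK.der i (DV.der j h) = CK.der j (DV.der i h) := by
  have h1 : ∀ j, IsGen j (CK.val (DV.base h)) (CK.val (DV.der j h)) := fun j =>
    (DV.isGen h j).map CK.val
  exact sobolev_injective ((dsub.isGen (DV.der j h) i).unique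
    ((h1 i).swap (h1 j) (dsub.isGen (DV.der i h) j)))

/-- The distributional gradient of an `H¹` function is its gradient. -/
theorem pY_two_base (hμ : 0 < μ) (F : H1) :
    pY μ 2 (DV.base F) = -∑ j, eY μ j (DV.der j F) := by
  refine Y0_ext hμ fun φ hφ => ?_
  have h1 : ∀ j, ∫ x, (DV.base F : L2) x * pd j (fun y => φ y j) x
      = -∫ x, (DV.der j F : L2) x * φ x j := fun j =>
    (hasWeakDeriv_single_iff.1 (isGen_L2_iff.1 (DV.isGen F j))).2.2 _ (hφ.comp_apply j)
  have h2 : ∀ j (f : L2), inner ℝ f (vc μ j (testX μ φ hφ)) = ∫ x, f x * φ x j := fun j f => by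
    rw [vc_testX, real_inner_comm, ← innerSL_apply_apply ℝ]
    exact testL_apply (hφ.comp_apply j) f
  have h3 : divX μ (testX μ φ hφ)
      = ∑ j, ((hφ.comp_apply j).pderiv j).memLp.toLp (pd j fun y => φ y j) := by
    rw [divX_testX hμ]
    refine Lp.ext ?_
    rw [Fin.sum_univ_two]
    filter_upwards [hφ.memLp_div.coeFn_toLp, Lp.coeFn_add
      (((hφ.comp_apply 0).pderiv 0).memLp.toLp (pd 0 fun y => φ y 0))
      (((hφ.comp_apply 1).pderiv 1).memLp.toLp (pd 1 fun y => φ y 1)),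
      ((hφ.comp_apply 0).pderiv 0).memLp.coeFn_toLp, ((hφ.comp_apply 1).pderiv 1).memLp.coeFn_toLp]
      with x e1 e2 e3 e4
    rw [e1, e2, Pi.add_apply, e3, e4, Fin.sum_univ_two]
  have h4 : ∀ j (f : L2), inner ℝ f (((hφ.comp_apply j).pderiv j).memLp.toLp
      (pd j fun y => φ y j)) = ∫ x, f x * pd j (fun y => φ y j) x := fun j f => by
    rw [real_inner_comm, ← innerSL_apply_apply ℝ]
    exact testL_apply ((hφ.comp_apply j).pderiv j) f
  rw [pY_two_apply, h3, inner_sum, neg_apply, sum_apply, ← Finset.sum_neg_distrib]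
  refine Finset.sum_congr rfl fun j _ => ?_
  rw [h4, h1, eY_apply, h2]

/-- Leibniz rule for `-k ∇q`. -/
theorem isGen_gradMul (hμ : 0 < μ) (h : DV CK) (q : H1) (i : Fin 2) :
    IsGen i (gradMul μ (DV.base h) (DV.base q))
      (gradMul μ (DV.base h) (DV.der i q)
        - ∑ j, eY μ j (bmul (CK.val (DV.der i h)) (DV.der j q))) := by
  have hq := DV.isGen q i
  have g1 : IsGen i (pY μ 2 (bmul (CK.val (DV.base h)) (DV.base q)))
      (pY μ 2 (bmul (CK.val (DV.der i h)) (DV.base q)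
        + bmul (CK.val (DV.base h)) (DV.der i q))) :=
    (((DV.isGen h i).map CK.val).bilin bmul hq).map _
  have g2 : ∀ j, IsGen i (eY μ j (bmul (sobolev (CK.der j (DV.base h))) (DV.base q)))
      (eY μ j (bmul (sobolev (CK.der i (DV.der j h))) (DV.base q)
        + bmul (sobolev (CK.der j (DV.base h))) (DV.der i q))) := fun j => by
    rw [← CK.val_der]
    exact ((dsub.isGen (DV.der j h) i).bilin bmul hq).map _
  have h3 := pY_two_base hμ (mul1 (DV.der i h) q)
  have h4 : ∀ j, DV.der j (mul1 (DV.der i h) q)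
      = bmul (sobolev (CK.der i (DV.der j h))) (DV.base q)
        + bmul (CK.val (DV.der i h)) (DV.der j q) := fun j => by
    rw [der_mul1, CK.der_der_comm]
  simp only [base_mul1, h4] at h3
  have g := g1.add ((g2 0).add (g2 1))
  simp only [gradMul_apply, Fin.sum_univ_two] at h3 ⊢
  refine g.congr_deriv ?_
  rw [map_add, h3]
  simp only [map_add]
  abel

/-- `-h ∇q` for `q ∈ H³`. -/
def gradMul3 (μ : ℝ) : DV CK →L[ℝ] H3 →L[ℝ] DV (DV (DV (Y0 μ))) :=
  (ContinuousLinearMap.compL ℝ H3 H3 _ (DV.map (DV.map (DV.map (pY μ 2))))).comp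
      (mul3.comp DV.base)
    + ∑ j, (ContinuousLinearMap.compL ℝ H3 H3 _ (DV.map (DV.map (DV.map (eY μ j))))).comp
      (mul3.comp (DV.der j))

theorem gradMul3_apply (h : DV CK) (q : H3) : gradMul3 μ h q
    = DV.map (DV.map (DV.map (pY μ 2))) (mul3 (DV.base h) q)
      + ∑ j, DV.map (DV.map (DV.map (eY μ j))) (mul3 (DV.der j h) q) := by
  simp [gradMul3]

theorem base_gradMul3 (h : DV CK) (q : H3) : DV.base (DV.base (DV.base (gradMul3 μ h q)))
    = gradMul μ (DV.base h) (DV.base (DV.base (DV.base q))) := by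
  simp only [gradMul3_apply, gradMul_apply, map_add, map_sum, DV.base_map, base_mul3, base_mul2,
    base_mul1, CK.val_der]

attribute [irreducible] gradMul3

/-- The derivative `∂ᵢ(-h ∇q) = -∂ᵢh ∇q - h ∇∂ᵢq`. -/
def gradMul3Der (μ : ℝ) (i : Fin 2) : DV CK →L[ℝ] H4 →L[ℝ] DV (DV (DV (Y0 μ))) :=
  (gradMul3 μ).bilinearComp (ContinuousLinearMap.id ℝ _) (DV.der i)
    - ∑ j, (ContinuousLinearMap.compL ℝ H4 H3 _ (DV.map (DV.map (DV.map (eY μ j))))).comp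
      (mul3.bilinearComp (DV.der i) (DV.der j))

theorem gradMul3Der_apply (i : Fin 2) (h : DV CK) (q : H4) : gradMul3Der μ i h q
    = gradMul3 μ h (DV.der i q)
      - ∑ j, DV.map (DV.map (DV.map (eY μ j))) (mul3 (DV.der i h) (DV.der j q)) := by
  simp [gradMul3Der]

attribute [irreducible] gradMul3Der

theorem isGen_gradMul3 (hμ : 0 < μ) (h : DV CK) (q : H4) (i : Fin 2) :
    IsGen i (gradMul3 μ h (DV.base q)) (gradMul3Der μ i h q) := by
  refine DV.isGen_of_base (DV.isGen_of_base (DV.isGen_of_base ?_))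
  have key := isGen_gradMul hμ h
    (DV.map DV.base (DV.map (DV.base.comp DV.base) q)) i
  simp only [DV.base_map, DV.der_map, ContinuousLinearMap.comp_apply] at key
  rw [base_gradMul3]
  refine key.congr_deriv ?_
  simp only [gradMul3Der_apply, map_sub, map_sum, base_gradMul3, DV.base_map, base_mul3,
    base_mul2, base_mul1]

/-- `-h ∇q` for `q ∈ H⁴`, as an element of `Y⁴`. -/
def gradMul4 (hμ : 0 < μ) : DV CK →L[ℝ] H4 →L[ℝ] Y4 μ :=
  DV.lift₂ ((gradMul3 μ).bilinearComp (ContinuousLinearMap.id ℝ _) DV.base)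
    (fun i => gradMul3Der μ i) fun h q i => isGen_gradMul3 hμ h q i

theorem base_gradMul4 (hμ : 0 < μ) (h : DV CK) (q : H4) :
    DV.base (gradMul4 hμ h q) = gradMul3 μ h (DV.base q) := DV.base_lift₂ _ _ _ h q

/-- Multiplication by `h` on `Y⁴`. -/
def mulY4 (hμ : 0 < μ) (h : DV CK) (v : Y4 μ) : Y4 μ :=
  ∑ j, pY4 μ j.castSucc (mul4 h (DV.map (DV.map (DV.map (DV.map ((vc μ j).comp (rieszX μ))))) v))
    + μ • gradMul4 hμ h (DV.map (DV.map (DV.map (DV.map ((divX μ).comp (rieszX μ))))) v)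

theorem base4_mulY4 (hμ : 0 < μ) (h : DV CK) (v : Y4 μ) :
    base4 (mulY4 hμ h v) = mulYK μ (DV.base h) (base4 v) := by
  simp only [mulYK_eq, mulY4, base4_apply, map_add, map_sum, map_smul, DV.base_map, base_gradMul4,
    base_gradMul3, DV.base_map₂, base_mul3, base_mul2, base_mul1, ContinuousLinearMap.comp_apply]

theorem continuousOn_mulY4 (hμ : 0 < μ) {I : Set ℝ} {h : ℝ → DV CK} {v : ℝ → Y4 μ}
    (hh : ContinuousOn h I) (hv : ContinuousOn v I) :
    ContinuousOn (fun t => mulY4 hμ (h t) (v t)) I := by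
  refine ContinuousOn.add (continuousOn_finsetSum _ fun j _ => ?_) (ContinuousOn.const_smul ?_ μ)
  · exact (pY4 μ j.castSucc).continuous.comp_continuousOn (mul4.continuous₂.comp_continuousOn
      (hh.prodMk ((ContinuousLinearMap.continuous _).comp_continuousOn hv)))
  · exact (gradMul4 hμ).continuous₂.comp_continuousOn
      (hh.prodMk ((ContinuousLinearMap.continuous _).comp_continuousOn hv))

variable {μ : ℝ}

/-! ### The operators of the systems as operators between the lifted spaces -/

theorem memLp_euclidean {f : Plane → Plane} {a : Fin 2 → L2}
    (h : ∀ j, (fun x => f x j) =ᵐ[volume] a j) :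
    ∃ w : L2V, f =ᵐ[volume] w ∧ ∀ j, compV j w = a j := by
  have hc : ∀ i, compV i (∑ j, singleV j (a j)) = a i := fun i => by
    fin_cases i <;> simp [compV_singleV]
  refine ⟨∑ j, singleV j (a j), ?_, hc⟩
  have h1 := coeFn_compV 0 (∑ j, singleV j (a j))
  have h2 := coeFn_compV 1 (∑ j, singleV j (a j))
  rw [hc] at h1 h2
  filter_upwards [h 0, h 1, h1, h2] with x e0 e1 e2 e3
  ext j
  fin_cases j
  exacts [e0.trans e2, e1.trans e3]

theorem toY_eq {f : Plane → Plane} {a : Fin 2 → L2} (h : ∀ j, (fun x => f x j) =ᵐ[volume] a j) :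
    toY μ f = ∑ j, eY μ j (a j) := by
  obtain ⟨w, hfw, hw⟩ := memLp_euclidean h
  have hf : MemLp f 2 (volume : Measure Plane) := (Lp.memLp w).ae_eq hfw.symm
  have e : hf.toLp f = w := Lp.ext (hf.coeFn_toLp.trans hfw)
  rw [toY, dif_pos hf, e]
  ext u
  simp only [sum_apply, eY_apply, ContinuousLinearMap.comp_apply, innerSL_apply_apply, inner_L2V, hw]
  rfl

theorem gradY_eq {F : Plane → ℝ} {a : L2} (h : F =ᵐ[volume] a) : gradY μ F = -pY μ 2 a := by
  have hF : MemLp F 2 (volume : Measure Plane) := (Lp.memLp a).ae_eq h.symm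
  have e : hF.toLp F = a := Lp.ext (hF.coeFn_toLp.trans h)
  rw [gradY, dif_pos hF, e]
  ext u
  simp [pY_two_apply]

theorem coeFn_bmul_sum (m : Fin 2 → BCF) (u : Fin 2 → L2) :
    ⇑(∑ j, bmul (m j) (u j)) =ᵐ[volume] fun x => ∑ j, m j x * u j x := by
  simp only [Fin.sum_univ_two]
  filter_upwards [Lp.coeFn_add (bmul (m 0) (u 0)) (bmul (m 1) (u 1)), coeFn_bmul (m 0) (u 0),
    coeFn_bmul (m 1) (u 1)] with x h1 h2 h3
  rw [h1, Pi.add_apply, h2, h3]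

theorem dotp_apply (u w : Plane → Plane) (x : Plane) : dotp u w x = u x 0 * w x 0 + u x 1 * w x 1 := by
  simp [dotp, PiLp.inner_apply, Fin.sum_univ_two, mul_comm]

theorem coefMat_sum {R : Type*} [CommRing R] [Algebra ℝ R] {M : Type*} [AddCommGroup M] [Module ℝ M]
    (A : R →ₗ[ℝ] Fin 3 → Fin 3 → M) (h : R) (s : Fin 2 → R) :
    ∑ a, ∑ b, A (coefMat μ h s a b) a b
      = ∑ j : Fin 2, A h j.castSucc j.castSucc
        + μ • ∑ j : Fin 2, ∑ i : Fin 2, A (h * s i * s j) j.castSucc i.castSucc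
        - (μ / 2) • (∑ j : Fin 2, A (h * h * s j) j.castSucc 2 + ∑ j : Fin 2, A (h * h * s j) 2 j.castSucc)
        + (μ / 3) • A (h * h * h) 2 2 := by
  have e : h * s 1 * s 0 = h * s 0 * s 1 := by ring
  simp only [Fin.sum_univ_three, Fin.sum_univ_two, coefMat, Matrix.cons_val_zero,
    Matrix.cons_val_one, Matrix.cons_val, map_add, map_smul, Pi.add_apply, Pi.smul_apply, e,
    Fin.castSucc_zero, Fin.castSucc_one]
  module

/-- The linear dependence of `P_a m Q_b u` on the coefficient `m`. -/
def coefTerm (u : X0 μ) : BCF →ₗ[ℝ] Fin 3 → Fin 3 → Y0 μ :=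
  LinearMap.pi fun a => LinearMap.pi fun b =>
    (((pY μ a).comp (bmul.flip (qX μ b u)) : BCF →L[ℝ] Y0 μ) : BCF →ₗ[ℝ] Y0 μ)

theorem coefTerm_apply (u : X0 μ) (m : BCF) (a b : Fin 3) :
    coefTerm u m a b = pY μ a (bmul m (qX μ b u)) := rfl

theorem qX_castSucc (j : Fin 2) : qX μ j.castSucc = vc μ j := by fin_cases j <;> rfl

theorem frak0_apply (h : BCF) (s : Fin 2 → BCF) (u : X0 μ) : frak0 μ h s u
    = ∑ j, eY μ j (bmul h (vc μ j u)) + μ • ∑ j, ∑ i, eY μ j (bmul (h * s i * s j) (vc μ i u))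
      - (μ / 2) • (∑ j, eY μ j (bmul (h * h * s j) (divX μ u))
        + ∑ j, pY μ 2 (bmul (h * h * s j) (vc μ j u)))
      + (μ / 3) • pY μ 2 (bmul (h * h * h) (divX μ u)) := by
  have := coefMat_sum (μ := μ) (coefTerm u) h s
  simp only [coefTerm_apply, qX_castSucc, qX_two] at this
  rw [← this, frak0, frakOp_apply]
  simp only [map_sum]

section Identification

variable {β : ℝ} {b hf : Plane → ℝ} {B : Fin 2 → BCF} {h : BCF}

theorem dotp_wgrad_ae (hB : ∀ j, wderiv j b =ᵐ[volume] B j) (u : X0 μ) :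
    dotp (wgrad b) (velX μ u) =ᵐ[volume] fun x => ∑ j, B j x * vc μ j u x := by
  filter_upwards [hB 0, hB 1, coeFn_vc 0 u, coeFn_vc 1 u] with x h1 h2 h3 h4
  simp [dotp_apply, wgrad, h1, h2, h3, h4]

theorem dotp_bslope (u : X0 μ) (x : Plane) :
    dotp (bslope β b) (velX μ u) x = β * dotp (wgrad b) (velX μ u) x := by
  simp only [dotp_apply, bslope, PiLp.smul_apply, smul_eq_mul]
  ring

theorem wgrad_ae (hB : ∀ j, wderiv j b =ᵐ[volume] B j) (j : Fin 2) :
    (fun x => wgrad b x j) =ᵐ[volume] B j := by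
  filter_upwards [hB j] with x hx
  rw [← hx]
  fin_cases j <;> simp [wgrad]

theorem gradY_cube (hk : hf =ᵐ[volume] h) (u : X0 μ) :
    gradY μ (hf ^ 3 * divX μ u) = -pY μ 2 (bmul (h * h * h) (divX μ u)) := by
  refine gradY_eq ?_
  filter_upwards [hk, coeFn_bmul (h * h * h) (divX μ u)] with x h1 h2
  rw [h2, Pi.mul_apply, Pi.pow_apply, h1]
  simp only [BCF.mul_apply]
  ring

theorem gradY_sq_slope (hk : hf =ᵐ[volume] h) (hB : ∀ j, wderiv j b =ᵐ[volume] B j) (u : X0 μ) :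
    gradY μ (hf ^ 2 * dotp (bslope β b) (velX μ u))
      = -∑ j, pY μ 2 (bmul (h * h * β • B j) (vc μ j u)) := by
  rw [← map_sum]
  refine gradY_eq ?_
  filter_upwards [hk, coeFn_bmul_sum (fun j => h * h * β • B j) fun j => vc μ j u,
    dotp_wgrad_ae hB u] with x h1 h2 h3
  rw [h2, Pi.mul_apply, Pi.pow_apply, h1, dotp_bslope, h3, Finset.mul_sum, Finset.mul_sum]
  refine Finset.sum_congr rfl fun j _ => ?_
  simp only [BCF.mul_apply, BCF.smul_apply]
  ring

theorem toY_sq_slope (hk : hf =ᵐ[volume] h) (hB : ∀ j, wderiv j b =ᵐ[volume] B j) (u : X0 μ) :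
    toY μ ((hf ^ 2 * divX μ u) • bslope β b)
      = ∑ j, eY μ j (bmul (h * h * β • B j) (divX μ u)) := by
  refine toY_eq fun j => ?_
  filter_upwards [hk, coeFn_bmul (h * h * β • B j) (divX μ u), wgrad_ae hB j] with x h1 h2 h3
  simp only [Pi.smul_apply', Pi.mul_apply, Pi.pow_apply, bslope, PiLp.smul_apply, smul_eq_mul]
  rw [h2, h1, h3]
  simp only [BCF.mul_apply, BCF.smul_apply]
  ring

theorem toY_slope_slope (hB : ∀ j, wderiv j b =ᵐ[volume] B j) (u : X0 μ) :
    toY μ (dotp (wgrad b) (velX μ u) • wgrad b)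
      = ∑ j, eY μ j (∑ i, bmul (B i * B j) (vc μ i u)) := by
  refine toY_eq fun j => ?_
  filter_upwards [coeFn_bmul_sum (fun i => B i * B j) fun j => vc μ j u, dotp_wgrad_ae hB u,
    wgrad_ae hB j] with x h1 h2 h3
  simp only [Pi.smul_apply', PiLp.smul_apply, smul_eq_mul]
  rw [h1, h2, h3, Finset.sum_mul]
  refine Finset.sum_congr rfl fun i _ => ?_
  rw [BCF.mul_apply]
  ring

theorem toY_depth_smul (hk : hf =ᵐ[volume] h) (u : X0 μ) :
    toY μ (hf • ⇑(velX μ u)) = ∑ j, eY μ j (bmul h (vc μ j u)) := by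
  refine toY_eq fun j => ?_
  filter_upwards [hk, coeFn_bmul h (vc μ j u), coeFn_vc j u] with x h1 h2 h3
  simp only [Pi.smul_apply', PiLp.smul_apply, smul_eq_mul]
  rw [h1, h2, h3]

theorem inv_ae {k l : CK} (hk : hf =ᵐ[volume] CK.val k) (hkl : mulK k l = oneK) :
    hf⁻¹ =ᵐ[volume] CK.val l := by
  filter_upwards [hk] with x hx
  have h1 := congrArg (fun m : CK => CK.val m x) hkl
  simp only [val_mulK, val_oneK, BCF.mul_apply, BCF.one_apply] at h1
  rw [Pi.inv_apply, hx]
  exact (eq_inv_of_mul_eq_one_right h1).symm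

theorem mulYK_cancel (hμ : 0 < μ) {k l : CK} (hkl : mulK k l = oneK) (v : Y0 μ) :
    mulYK μ k (mulYK μ l v) = v := by
  rw [mulYK_mulYK hμ, hkl, mulYK_one hμ]

theorem combine_terms {E : Type*} [AddCommGroup E] [Module ℝ E] (a₀ a₁ a₂ a₃ a₄ : E) (μ : ℝ) :
    a₀ + μ • (-(1 / 3 : ℝ) • -a₄ + (1 / 2 : ℝ) • (-a₃ - a₂) + a₁)
      = a₀ + μ • a₁ - (μ / 2) • (a₂ + a₃) + (μ / 3) • a₄ := by
  module

/-- The operator `𝔗[h,βb]` of the systems is `frak0`. -/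
theorem opFrakT_eq (hμ : 0 < μ) {k l : CK}
    (hk : hf =ᵐ[volume] CK.val k) (hkl : mulK k l = oneK)
    (hB : ∀ j, wderiv j b =ᵐ[volume] B j) (u : X0 μ) :
    opFrakT μ β b hf u = frak0 μ (CK.val k) (fun j => β • B j) u := by
  have e4 : β ^ 2 • mulYK μ k (toY μ (dotp (wgrad b) (velX μ u) • wgrad b))
      = ∑ j, ∑ i, eY μ j (bmul (CK.val k * β • B i * β • B j) (vc μ i u)) := by
    rw [toY_slope_slope hB, map_sum, Finset.smul_sum]
    refine Finset.sum_congr rfl fun j _ => ?_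
    rw [mulYK_eY hμ, map_sum, map_sum, Finset.smul_sum]
    refine Finset.sum_congr rfl fun i _ => ?_
    have e : CK.val k * β • B i * β • B j = β ^ 2 • (CK.val k * (B i * B j)) :=
      BCF.ext fun x => by
        simp only [BCF.mul_apply, BCF.smul_apply]
        ring
    rw [e, map_smul bmul, smul_apply, map_smul (eY μ j), bmul_mul (CK.val k)]
  have e5 : mulY μ hf (opT μ β b hf u) = mulYK μ k (opT μ β b hf u) := mulY_eq hμ hk _
  have e6 : ∀ v, mulYK μ k (mulY μ hf⁻¹ v) = v := fun v => by
    rw [mulY_eq hμ (inv_ae hk hkl) v, mulYK_cancel hμ hkl v]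
  have e7 : ∀ v w z : Y0 μ, mulYK μ k (-(1 / 3 : ℝ) • v + (1 / 2 : ℝ) • w + β ^ 2 • z)
      = -(1 / 3 : ℝ) • mulYK μ k v + (1 / 2 : ℝ) • mulYK μ k w + β ^ 2 • mulYK μ k z :=
    fun v w z => by
      simp only [(mulYK μ k).map_add, (mulYK μ k).map_smul]
  rw [opFrakT, e5, opT, e7, e6, e6, e4, gradY_cube hk, gradY_sq_slope hk hB, toY_sq_slope hk hB,
    toY_depth_smul hk, frak0_apply]
  exact combine_terms _ _ _ _ _ _

end Identification

variable {μ : ℝ}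

/-! ### The data of the systems as curves in the lifted spaces -/

theorem IsTower.exists_lift_four {T E : Type*} [TopologicalSpace T] [TransAct E] {s : Set T}
    {e : (Fin 2 → ℕ) → T → E} (h : IsTower 4 s e) :
    ∃ U : T → DV (DV (DV (DV E))), ContinuousOn U s ∧ ∀ t ∈ s, base4 (U t) = e 0 t := by
  obtain ⟨e₁, h₁, b₁⟩ := h.exists_lift
  obtain ⟨e₂, h₂, b₂⟩ := h₁.exists_lift
  obtain ⟨e₃, h₃, b₃⟩ := h₂.exists_lift
  obtain ⟨e₄, h₄, b₄⟩ := h₃.exists_lift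
  exact ⟨e₄ 0, h₄.1 0 (by simp), fun t ht => by
    rw [base4_apply, b₄ t ht, b₃ t ht, b₂ t ht, b₁ t ht]⟩

theorem HasDerivs.base4 {E : Type*} [TransAct E] {s : Set ℝ} {U : ℝ → DV (DV (DV (DV E)))}
    (h : ContinuousOn U s) : HasDerivs 4 s fun t => base4 (U t) :=
  (HasDerivs.zero h).base.base.base.base

theorem wderiv_ae {i : Fin 2} {f g : Plane → ℝ} (h : HasWeakDeriv (Pi.single i 1) f g) :
    wderiv i f =ᵐ[volume] g := by
  have hex : ∃ g, HasWeakDeriv (Pi.single i 1) f g := ⟨g, h⟩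
  rw [wderiv, dif_pos hex]
  exact hex.choose_spec.unique h

theorem coeFn_base4 (f : H4) : (base4 f : L2) =ᵐ[volume] CK.val (DV.base (incDK f)) := by
  rw [base_incDK, val_incK, base4_apply]
  exact coeFn_sobolev _

/-- The gradient of the bottom as a pair of `H⁴` functions. -/
theorem exists_bottom {b : Plane → ℝ} (hb : MemHdotSucc 4 b) :
    ∃ B : Fin 2 → H4, ∀ j, HasWeakDeriv (Pi.single j 1) b (base4 (B j) : L2) := by
  have h : ∀ j, ∃ B : H4, HasWeakDeriv (Pi.single j 1) b (base4 B : L2) := fun j => by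
    obtain ⟨g, hg, hg4⟩ := hb.2 j
    obtain ⟨e, he, he0⟩ := hg4.isTower
    obtain ⟨U, -, hU⟩ := he.exists_lift_four
    refine ⟨U (), hg.congr Filter.EventuallyEq.rfl ?_⟩
    rw [hU () (mem_univ _)]
    exact he0.symm
  choose B hB using h
  exact ⟨B, hB⟩

theorem hasWeakDeriv_depth {ε β : ℝ} {b : Plane → ℝ} {z : L2} {i : Fin 2} {p q : Plane → ℝ}
    (hz : HasWeakDeriv (Pi.single i 1) z p) (hb : HasWeakDeriv (Pi.single i 1) b q) :
    HasWeakDeriv (Pi.single i 1) (depth ε β b z) (fun x => ε * p x - β * q x) := by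
  have h1 : HasWeakDeriv (Pi.single i 1) (fun _ : Plane => (1 : ℝ)) (fun _ => 0) :=
    PD.hasWeakDeriv ⟨continuous_const, continuous_const, fun x => by
      simpa [HasLineDerivAt] using hasDerivAt_const (0 : ℝ) (1 : ℝ)⟩
  rw [hasWeakDeriv_single_iff] at hz hb h1 ⊢
  refine ⟨(h1.1.add (hz.1.smul ε)).sub (hb.1.smul β), (hz.2.1.smul ε).sub (hb.2.1.smul β),
    fun φ hφ => ?_⟩
  have hφ' := hφ.pderiv i
  have e1 : ∫ x, depth ε β b z x * pd i φ x = (∫ x, 1 * pd i φ x) + ε * (∫ x, z x * pd i φ x)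
      - β * ∫ x, b x * pd i φ x := by
    rw [← integral_const_mul, ← integral_const_mul, ← integral_add (integrable_mul_test h1.1 hφ')
      ((integrable_mul_test hz.1 hφ').const_mul ε)]
    refine Eq.trans ?_ (integral_sub ((integrable_mul_test h1.1 hφ').add
      ((integrable_mul_test hz.1 hφ').const_mul ε)) ((integrable_mul_test hb.1 hφ').const_mul β))
    refine integral_congr_ae (Eventually.of_forall fun x => ?_)
    simp only [depth]
    ring
  have e2 : ∫ x, (ε * p x - β * q x) * φ x = ε * (∫ x, p x * φ x) - β * ∫ x, q x * φ x := by
    rw [← integral_const_mul, ← integral_const_mul]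
    refine Eq.trans ?_ (integral_sub ((integrable_mul_test hz.2.1 hφ).const_mul ε)
      ((integrable_mul_test hb.2.1 hφ).const_mul β))
    refine integral_congr_ae (Eventually.of_forall fun x => ?_)
    simp only
    ring
  rw [e1, e2, h1.2.2 φ hφ, hz.2.2 φ hφ, hb.2.2 φ hφ]
  simp
  ring

theorem isGen_base4 (f : H4) (i : Fin 2) : IsGen i (base4 f) (DV.base (DV.base (DV.base (DV.der i f)))) :=
  (((DV.isGen f i).map DV.base).map DV.base).map DV.base

theorem le_of_ae_le {f : BCF} {c : ℝ} (h : ∀ᵐ x ∂(volume : Measure Plane), c ≤ f x) (x : Plane) :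
    c ≤ f x := by
  by_contra hx
  have ho : IsOpen {x | f x < c} := isOpen_lt f.continuous continuous_const
  have h0 : (volume : Measure Plane) {x | f x < c} = 0 := by
    rw [← nonpos_iff_eq_zero, ← (ae_iff.1 h)]
    exact measure_mono fun y (hy : f y < c) => not_le.2 hy
  have := (ho.measure_eq_zero_iff volume).1 h0
  exact (this ▸ not_le.1 hx : x ∈ (∅ : Set Plane))

/-- The water depth as an element of `DV CK`. -/
theorem exists_depth {ε β : ℝ} {b : Plane → ℝ} {B : Fin 2 → H4} {z : L2} {Z : H4}
    (hB : ∀ j, HasWeakDeriv (Pi.single j 1) b (base4 (B j) : L2)) (hZ : base4 Z = z) {C : ℝ}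
    (hC : ∀ᵐ x ∂(volume : Measure Plane), |depth ε β b z x| ≤ C) :
    ∃ h : DV CK, depth ε β b z =ᵐ[volume] CK.val (DV.base h) := by
  set d : Fin 2 → H3 := fun i => ε • DV.der i Z - β • DV.base (B i) with hd
  have hw : ∀ i, HasWeakDeriv (Pi.single i 1) (depth ε β b z) (sobolev (DV.base (d i))) := by
    intro i
    refine (hasWeakDeriv_depth (isGen_L2_iff.1 (hZ ▸ isGen_base4 Z i)) (hB i)).congr
      Filter.EventuallyEq.rfl ?_
    refine Filter.EventuallyEq.trans ?_ (coeFn_sobolev (DV.base (d i)))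
    simp only [hd, map_sub, map_smul, ← base4_apply]
    set p : L2 := DV.base (DV.base (DV.base (DV.der i Z)))
    filter_upwards [Lp.coeFn_sub (ε • p) (β • base4 (B i)), Lp.coeFn_smul ε p,
      Lp.coeFn_smul β (base4 (B i))] with x h1 h2 h3
    rw [h1, Pi.sub_apply, h2, h3]
    rfl
  obtain ⟨f, hf, hgen⟩ := exists_bcf_representative hC (p := fun i => sobolev (DV.base (d i)))
    (fun i => by
      simp only [← IsEq.map_tr (A := sobolev)]
      exact sobolev.continuous.comp (StrongAct.continuous_axis i _)) hw
  obtain ⟨k, hk, -⟩ := exists_DVCK hgen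
  exact ⟨k, hk ▸ hf⟩

/-- The smooth data of the problem: the lifts `Z` of the surface elevation, `B` of the bottom
gradient, `h` of the depth and `g` of its inverse. -/
structure FlowData (ε β T : ℝ) (b : Plane → ℝ) (ζ : ℝ → L2) where
  /-- The surface elevation. -/
  Z : ℝ → H4
  /-- The gradient of the bottom. -/
  B : Fin 2 → H4
  /-- The depth. -/
  h : ℝ → DV CK
  /-- The inverse of the depth. -/
  g : ℝ → DV CK
  /-- A lower bound for the depth. -/
  l : ℝ
  contZ : ContinuousOn Z (Icc 0 T)
  base_Z : ∀ t ∈ Icc 0 T, base4 (Z t) = ζ t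
  weak_B : ∀ j, HasWeakDeriv (Pi.single j 1) b (base4 (B j) : L2)
  h_eq : ∀ t, h t = h 0 + ε • incDK (Z t - Z 0)
  contg : ContinuousOn g (Icc 0 T)
  mul_g : ∀ t ∈ Icc 0 T, mulDK (h t) (g t) = oneDK
  l_pos : 0 < l
  l_le : ∀ t ∈ Icc 0 T, ∀ x, l ≤ CK.val (DV.base (h t)) x
  depth_ae : ∀ t ∈ Icc 0 T, depth ε β b (ζ t) =ᵐ[volume] CK.val (DV.base (h t))

theorem exists_flowData {ε β T : ℝ} (hT : 0 < T) {b : Plane → ℝ} (hb : MemHdotSucc 4 b)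
    {ζ : ℝ → L2} (hζ : ContH 4 T ζ) {hlow hupp : ℝ} (hlow_pos : 0 < hlow)
    (hdepth : ∀ t ∈ Icc 0 T, ∀ᵐ x ∂(volume : Measure Plane),
      hlow < depth ε β b (ζ t) x ∧ depth ε β b (ζ t) x < hupp) :
    Nonempty (FlowData ε β T b ζ) := by
  have h0 : (0 : ℝ) ∈ Icc 0 T := ⟨le_rfl, hT.le⟩
  obtain ⟨e, he, he0⟩ := hζ.isTower
  obtain ⟨Z, hZc, hZ⟩ := he.exists_lift_four
  have hZ' : ∀ t ∈ Icc 0 T, base4 (Z t) = ζ t := fun t ht => (hZ t ht).trans (he0 t ht)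
  obtain ⟨B, hB⟩ := exists_bottom hb
  obtain ⟨k, hk⟩ := exists_depth (ε := ε) (β := β) hB (hZ' 0 h0) (C := hupp) <| by
    filter_upwards [hdepth 0 h0] with x hx
    rw [abs_of_pos (hlow_pos.trans hx.1)]
    exact hx.2.le
  set h : ℝ → DV CK := fun t => k + ε • incDK (Z t - Z 0) with hh
  have hh0 : h 0 = k := by simp only [hh, sub_self, map_zero, smul_zero, add_zero]
  have hhc : ContinuousOn h (Icc 0 T) := continuousOn_const.add
    ((incDK.continuous.comp_continuousOn (hZc.sub continuousOn_const)).const_smul ε)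
  have hae : ∀ t ∈ Icc 0 T, depth ε β b (ζ t) =ᵐ[volume] CK.val (DV.base (h t)) := by
    intro t ht
    have e1 : CK.val (DV.base (h t)) = CK.val (DV.base k)
        + ε • (CK.val (DV.base (incDK (Z t))) - CK.val (DV.base (incDK (Z 0)))) := by
      simp only [hh, map_add, map_smul, map_sub]
    have e2 := coeFn_base4 (Z t)
    have e3 := coeFn_base4 (Z 0)
    rw [hZ' t ht] at e2
    rw [hZ' 0 h0] at e3
    filter_upwards [hk, e2, e3] with x x1 x2 x3
    rw [e1, BCF.add_apply, BCF.smul_apply, BCF.sub_apply, ← x1, ← x2, ← x3, depth, depth]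
    ring
  have hl : ∀ t ∈ Icc 0 T, ∀ x, hlow ≤ CK.val (DV.base (h t)) x := fun t ht =>
    le_of_ae_le <| by
      filter_upwards [hae t ht, hdepth t ht] with x x1 x2
      rw [← x1]
      exact x2.1.le
  have hinv : ∀ t ∈ Icc 0 T, ∃ g, mulDK (h t) g = oneDK := fun t ht =>
    exists_inverse_DVCK (h t) hlow_pos (hl t ht)
  choose! g hg using hinv
  exact ⟨{
    Z := Z, B := B, h := h, g := g, l := hlow, contZ := hZc, base_Z := hZ', weak_B := hB
    h_eq := fun t => by rw [hh0]
    contg := continuousOn_inverse_apply (mulDK.continuous.comp_continuousOn hhc)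
      (fun t ht => bijective_mulDK (hg t ht)) (f := fun _ => oneDK) continuousOn_const hg
    mul_g := hg, l_pos := hlow_pos, l_le := hl, depth_ae := hae }⟩

namespace FlowData

variable {ε β T : ℝ} {b : Plane → ℝ} {ζ : ℝ → L2} (D : FlowData ε β T b ζ)

theorem conth : ContinuousOn D.h (Icc 0 T) := by
  have : D.h = fun t => D.h 0 + ε • incDK (D.Z t - D.Z 0) := funext D.h_eq
  rw [this]
  exact continuousOn_const.add
    ((incDK.continuous.comp_continuousOn (D.contZ.sub continuousOn_const)).const_smul ε)

/-- The bottom slope `β ∇b`. -/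
def s (j : Fin 2) : DV CK := β • incDK (D.B j)

/-- The gradient of the bottom as a bounded continuous function. -/
def Bc (j : Fin 2) : BCF := CK.val (DV.base (incDK (D.B j)))

theorem val_s : (fun j => CK.val (DV.base (D.s j))) = fun j => β • D.Bc j :=
  funext fun j => by simp only [s, Bc, map_smul]

theorem wderiv_b (j : Fin 2) : wderiv j b =ᵐ[volume] D.Bc j :=
  (wderiv_ae (D.weak_B j)).trans (coeFn_base4 (D.B j))

variable {D} {t : ℝ} (ht : t ∈ Icc 0 T)
include ht

theorem mulK_hg : mulK (DV.base (D.h t)) (DV.base (D.g t)) = oneK := by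
  rw [← DV.base_map₂, D.mul_g t ht, base_oneDK]

theorem mulK_gh : mulK (DV.base (D.g t)) (DV.base (D.h t)) = oneK := by
  rw [mulK_comm, mulK_hg ht]

theorem opFrakT_eq (hμ : 0 < μ) (u : X0 μ) : opFrakT μ β b (depth ε β b (ζ t)) u
    = frak0 μ (CK.val (DV.base (D.h t))) (fun j => β • D.Bc j) u :=
  _root_.opFrakT_eq hμ (D.depth_ae t ht) (mulK_hg ht) D.wderiv_b u

theorem mulY_eq (hμ : 0 < μ) (v : Y0 μ) :
    mulY μ (depth ε β b (ζ t)) v = mulYK μ (DV.base (D.h t)) v :=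
  _root_.mulY_eq hμ (D.depth_ae t ht) v

theorem mulY_inv_eq (hμ : 0 < μ) (v : Y0 μ) :
    mulY μ (depth ε β b (ζ t))⁻¹ v = mulYK μ (DV.base (D.g t)) v :=
  _root_.mulY_eq hμ (inv_ae (D.depth_ae t ht) (mulK_hg ht)) v

theorem bijective_frak0 (hμ : 0 < μ) :
    Function.Bijective (frak0 μ (CK.val (DV.base (D.h t))) (fun j => β • D.Bc j)) :=
  _root_.bijective_frak0 hμ D.l_pos (D.l_le t ht)

theorem bijective_mulYK (hμ : 0 < μ) : Function.Bijective (mulYK μ (DV.base (D.h t))) :=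
  Function.bijective_iff_has_inverse.2 ⟨mulYK μ (DV.base (D.g t)),
    fun v => mulYK_cancel hμ (mulK_gh ht) v, fun v => mulYK_cancel hμ (mulK_hg ht) v⟩

omit ht in
theorem base4_frak4 (u : X4 μ) : base4 (frak4 μ (D.h t) D.s u)
    = frak0 μ (CK.val (DV.base (D.h t))) (fun j => β • D.Bc j) (base4 u) := by
  rw [_root_.base4_frak4, val_s]

theorem bijective_frak4 (hμ : 0 < μ) : Function.Bijective (frak4 μ (D.h t) D.s) :=
  _root_.bijective_frak4 hμ D.l_pos (D.l_le t ht)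

end FlowData

variable {μ : ℝ}

/-! ### Time derivatives -/

/-- A continuous curve that is differentiable in a weaker norm, with a derivative that is continuous
in the stronger one, is differentiable in the stronger norm. -/
theorem hasDerivWithinAt_of_comp {E F : Type*} [NormedAddCommGroup E] [NormedSpace ℝ E]
    [CompleteSpace E] [NormedAddCommGroup F] [NormedSpace ℝ F] (J : E →L[ℝ] F)
    (hJ : Function.Injective J) {f Z : ℝ → E} {T : ℝ} (hT : 0 ≤ T)
    (hZ : ContinuousOn Z (Icc 0 T))
    (hd : ∀ t ∈ Icc 0 T, HasDerivWithinAt (fun t => J (f t)) (J (Z t)) (Icc 0 T) t) :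
    ∀ t ∈ Icc 0 T, HasDerivWithinAt f (Z t) (Icc 0 T) t := by
  have h0 : (0 : ℝ) ∈ Icc 0 T := ⟨le_rfl, hT⟩
  set Z' : ℝ → E := IccExtend hT (fun t => Z t) with hZ'
  have hc : Continuous Z' := (continuousOn_iff_continuous_domRestrict.1 hZ).Icc_extend'
  have hZZ : ∀ t ∈ Icc 0 T, Z' t = Z t := fun t ht => by
    rw [hZ', IccExtend_of_mem _ _ ht]
  set G : ℝ → E := fun t => f 0 + ∫ r in (0 : ℝ)..t, Z' r with hG
  have hGd : ∀ t ∈ Icc 0 T, HasDerivWithinAt G (Z t) (Icc 0 T) t := fun t ht => by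
    have := ((hc.integral_hasStrictDerivAt 0 t).hasDerivAt.const_add (f 0)).hasDerivWithinAt
      (s := Icc 0 T)
    rwa [hZZ t ht] at this
  have hGf : ∀ t ∈ Icc 0 T, f t = G t := fun t ht => by
    refine hJ (sub_eq_zero.1 ?_)
    have hdiff : ∀ r ∈ Icc 0 T, HasDerivWithinAt (fun r => J (f r) - J (G r)) 0 (Icc 0 T) r :=
      fun r hr => ((hd r hr).sub (J.hasFDerivAt.comp_hasDerivWithinAt r (hGd r hr))).congr_deriv
        (sub_self _)
    have := (convex_Icc 0 T).norm_image_sub_le_of_norm_hasDerivWithin_le (C := 0) hdiff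
      (fun r _ => by simp) h0 ht
    simpa [hG, sub_eq_zero] using this
  exact fun t ht => (hGd t ht).congr hGf (hGf t ht)

theorem HasWeakDiv.unique {w : Plane → Plane} {d d' : Plane → ℝ} (h : HasWeakDiv w d)
    (h' : HasWeakDiv w d') : d =ᵐ[volume] d' :=
  ae_eq_of_forall_test h.2.1 h'.2.1 fun φ hφ =>
    neg_injective ((h.2.2 φ hφ).symm.trans (h'.2.2 φ hφ))

/-- `∇⬝(h u)` as an `H³` function. -/
def fluxDiv (μ : ℝ) (h : DV CK) (u : X4 μ) : H3 :=
  mul3 (DV.base h) (DV.base (qX4 μ 2 u))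
    + ∑ j : Fin 2, mul3 (DV.der j h) (DV.base (qX4 μ j.castSucc u))

theorem base_fluxDiv (h : DV CK) (u : X4 μ) :
    DV.base (DV.base (DV.base (fluxDiv μ h u))) = divMul μ (DV.base h) (base4 u) := by
  have h1 : ∀ a, DV.base (DV.base (DV.base (DV.base (qX4 μ a u)))) = qX μ a (base4 u) := fun a => by
    rw [base4_apply]
    simp only [DV.base_map]
  simp only [fluxDiv, map_add, map_sum, base_mul3, base_mul2, base_mul1, h1, divMul_apply,
    CK.val_der, qX_castSucc, qX_two]

theorem continuousOn_fluxDiv {s : Set ℝ} {h : ℝ → DV CK} {u : ℝ → X4 μ}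
    (hh : ContinuousOn h s) (hu : ContinuousOn u s) :
    ContinuousOn (fun t => fluxDiv μ (h t) (u t)) s := by
  refine ContinuousOn.add ?_ (continuousOn_finsetSum _ fun j _ => ?_)
  · exact mul3.continuous₂.comp_continuousOn ((DV.base.continuous.comp_continuousOn hh).prodMk
      ((DV.base.comp (qX4 μ 2)).continuous.comp_continuousOn hu))
  · exact mul3.continuous₂.comp_continuousOn (((DV.der j).continuous.comp_continuousOn hh).prodMk
      ((DV.base.comp (qX4 μ j.castSucc)).continuous.comp_continuousOn hu))

namespace FlowData

variable {ε β T : ℝ} {b : Plane → ℝ} {ζ : ℝ → L2} (D : FlowData ε β T b ζ)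

/-- The time derivative of the depth, `-ε ∇⬝(h u)`. -/
def k (u : ℝ → X4 μ) (t : ℝ) : CK := ε • incK (-fluxDiv μ (D.h t) (u t))

theorem val_k (u : ℝ → X4 μ) (t : ℝ) : CK.val (D.k u t) =ᵐ[volume]
    fun x => -(ε * divMul μ (DV.base (D.h t)) (base4 (u t)) x) := by
  have h1 := coeFn_sobolev (DV.base (-fluxDiv μ (D.h t) (u t)))
  rw [map_neg DV.base (fluxDiv μ (D.h t) (u t)), map_neg, map_neg, base_fluxDiv] at h1
  filter_upwards [h1, Lp.coeFn_neg (divMul μ (DV.base (D.h t)) (base4 (u t)))] with x x1 x2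
  rw [k, map_smul, val_incK, BCF.smul_apply, map_neg DV.base (fluxDiv μ (D.h t) (u t)), ← x1, x2, Pi.neg_apply]
  ring

variable {D}

/-- Conservation of mass, as an equation in `L²`. -/
theorem eq_neg_divMul (hμ : 0 < μ) {t : ℝ} (ht : t ∈ Icc 0 T) {u : X0 μ} {ζt : L2}
    (h : HasWeakDiv (depth ε β b (ζ t) • ⇑(velX μ u)) (-⇑ζt)) :
    ζt = -divMul μ (DV.base (D.h t)) u := by
  have h1 := hasWeakDiv_velMul hμ (DV.base (D.h t)) u
  have h2 : (velMul μ (DV.base (D.h t)) u : Plane → Plane)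
      =ᵐ[volume] depth ε β b (ζ t) • ⇑(velX μ u) := by
    have := velX_mulXK hμ (DV.base (D.h t)) u
    rw [mulXK_apply, velX_mkX] at this
    filter_upwards [this, D.depth_ae t ht] with x x1 x2
    rw [x1, Pi.smul_apply', x2]
  have h3 := (h1.congr h2 Filter.EventuallyEq.rfl).unique h
  refine Lp.ext ?_
  filter_upwards [h3, Lp.coeFn_neg (divMul μ (DV.base (D.h t)) u)] with x x1 x2
  rw [x2, Pi.neg_apply, x1, Pi.neg_apply, neg_neg]

/-- The depth is a differentiable curve in `CK`. -/
theorem hasDerivWithinAt_h (hμ : 0 < μ) (hT : 0 ≤ T) {u : ℝ → X4 μ}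
    (hu : ContinuousOn u (Icc 0 T))
    (h : ∀ t ∈ Icc 0 T, ∃ ζt : L2, HasDerivWithinAt ζ ζt (Icc 0 T) t ∧
      HasWeakDiv (depth ε β b (ζ t) • ⇑(velX μ (base4 (u t)))) (-⇑ζt)) :
    ∀ t ∈ Icc 0 T, HasDerivWithinAt (fun t => DV.base (D.h t)) (D.k u t) (Icc 0 T) t := by
  have h1 := hasDerivWithinAt_of_comp (DV.base.comp (DV.base.comp DV.base) : H3 →L[ℝ] L2)
    (DV.base_injective.comp (DV.base_injective.comp DV.base_injective))
    (f := fun t => DV.base (D.Z t)) (Z := fun t => -fluxDiv μ (D.h t) (u t)) hT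
    (continuousOn_fluxDiv D.conth hu).neg fun t ht => by
      obtain ⟨ζt, h2, h3⟩ := h t ht
      rw [eq_neg_divMul (D := D) hμ ht h3] at h2
      rw [map_neg]
      simp only [ContinuousLinearMap.comp_apply, base_fluxDiv]
      exact h2.congr (fun r hr => D.base_Z r hr) (D.base_Z t ht)
  intro t ht
  have h2 := (((incK.hasFDerivAt.comp_hasDerivWithinAt t
    ((h1 t ht).sub_const (DV.base (D.Z 0)))).const_smul ε).const_add (DV.base (D.h 0)))
  have h3 : ∀ r, DV.base (D.h r)
      = DV.base (D.h 0) + ε • incK (DV.base (D.Z r) - DV.base (D.Z 0)) := fun r => by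
    conv_lhs => rw [D.h_eq]
    simp only [map_add, map_smul, base_incDK, map_sub]
  exact h2.congr_of_eventuallyEq (Eventually.of_forall h3) (h3 t)

end FlowData

/-- The time derivative of the relation `h v = 𝔗 u`. -/
theorem hasDerivWithinAt_relation {T t : ℝ} (hT : 0 < T) (ht : t ∈ Icc 0 T) {h : ℝ → CK} {k : CK}
    {s : Fin 2 → BCF} {u : ℝ → X0 μ} {v : ℝ → Y0 μ} {u' : X0 μ} {v' : Y0 μ}
    (hh : HasDerivWithinAt h k (Icc 0 T) t)
    (huv : ∀ t ∈ Icc 0 T, mulYK μ (h t) (v t) = frak0 μ (CK.val (h t)) s (u t))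
    (hu : HasDerivWithinAt u u' (Icc 0 T) t) (hv : HasDerivWithinAt v v' (Icc 0 T) t) :
    mulYK μ k (v t) + mulYK μ (h t) v'
      = frakOp bmul (pY μ) (qX μ) (coefMatDeriv μ (CK.val (h t)) (CK.val k) s) (u t)
        + frak0 μ (CK.val (h t)) s u' := by
  have h1 := ((mulYK μ).hasFDerivAt.comp_hasDerivWithinAt t hh).clm_apply hv
  have h2 := (hasDerivWithinAt_frakOp bmul (pY μ) (qX μ) fun a b =>
    hasDerivWithinAt_coefMat (μ := μ) (s := s)
      ((CK.val).hasFDerivAt.comp_hasDerivWithinAt t hh) a b).clm_apply hu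
  have h3 := h1.congr (f₁ := fun t => frak0 μ (CK.val (h t)) s (u t))
    (fun r hr => (huv r hr).symm) (huv t ht).symm
  exact (uniqueDiffOn_Icc hT t ht).eq_deriv _ h3 h2

variable {μ : ℝ}

/-! ### Calculus of almost everywhere defined functions -/

/-- `f` is, up to a null set, a bounded uniformly continuous function whose gradient `f'` is
bounded and uniformly continuous. -/
def IsC (f : Plane → ℝ) (f' : Fin 2 → Plane → ℝ) : Prop :=
  ∃ F : DV BCF, f =ᵐ[volume] (DV.base F : BCF) ∧ ∀ i, f' i =ᵐ[volume] (DV.der i F : BCF)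

/-- `f` is as in `IsC`, and belongs moreover to `H¹`, with gradient `f'`. -/
def IsS (f : Plane → ℝ) (f' : Fin 2 → Plane → ℝ) : Prop :=
  IsC f f' ∧ ∃ F : H1, f =ᵐ[volume] (DV.base F : L2) ∧ ∀ i, f' i =ᵐ[volume] (DV.der i F : L2)

section Predicates

variable {f g : Plane → ℝ} {f' g' : Fin 2 → Plane → ℝ}

theorem IsC.congr (h : IsC f f') (e : g =ᵐ[volume] f) (e' : ∀ i, g' i =ᵐ[volume] f' i) : IsC g g' := by
  obtain ⟨F, h1, h2⟩ := h
  exact ⟨F, e.trans h1, fun i => (e' i).trans (h2 i)⟩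

theorem IsS.congr (h : IsS f f') (e : g =ᵐ[volume] f) (e' : ∀ i, g' i =ᵐ[volume] f' i) : IsS g g' := by
  obtain ⟨h0, F, h1, h2⟩ := h
  exact ⟨h0.congr e e', F, e.trans h1, fun i => (e' i).trans (h2 i)⟩

theorem IsC.add (h : IsC f f') (k : IsC g g') : IsC (f + g) (fun i => f' i + g' i) := by
  obtain ⟨F, h1, h2⟩ := h
  obtain ⟨G, k1, k2⟩ := k
  refine ⟨F + G, ?_, fun i => ?_⟩
  · rw [map_add]
    exact h1.add k1
  · rw [map_add]
    exact (h2 i).add (k2 i)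

theorem IsC.smul (c : ℝ) (h : IsC f f') : IsC (c • f) (fun i => c • f' i) := by
  obtain ⟨F, h1, h2⟩ := h
  refine ⟨c • F, ?_, fun i => ?_⟩
  · rw [map_smul]
    exact h1.const_smul c
  · rw [map_smul]
    exact (h2 i).const_smul c

theorem IsC.mul (h : IsC f f') (k : IsC g g') : IsC (f * g) (fun i => f' i * g + f * g' i) := by
  obtain ⟨F, h1, h2⟩ := h
  obtain ⟨G, k1, k2⟩ := k
  refine ⟨DV.map₂ (ContinuousLinearMap.mul ℝ BCF) F G, ?_, fun i => ?_⟩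
  · rw [DV.base_map₂]
    exact h1.mul k1
  · rw [DV.der_map₂]
    exact ((h2 i).mul k1).add (h1.mul (k2 i))

theorem coeFn_map_add {a b : L2} (hf : f =ᵐ[volume] a) (hg : g =ᵐ[volume] b) :
    f + g =ᵐ[volume] (a + b : L2) :=
  (hf.add hg).trans (Lp.coeFn_add a b).symm

theorem coeFn_map_smul (c : ℝ) {a : L2} (hf : f =ᵐ[volume] a) : c • f =ᵐ[volume] (c • a : L2) :=
  (hf.const_smul c).trans (Lp.coeFn_smul c a).symm

theorem coeFn_map_bmul {a : BCF} {b : L2} (hf : f =ᵐ[volume] a) (hg : g =ᵐ[volume] b) :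
    f * g =ᵐ[volume] bmul a b :=
  (hf.mul hg).trans (coeFn_bmul a b).symm

theorem IsS.add (h : IsS f f') (k : IsS g g') : IsS (f + g) (fun i => f' i + g' i) := by
  obtain ⟨h0, F, h1, h2⟩ := h
  obtain ⟨k0, G, k1, k2⟩ := k
  refine ⟨h0.add k0, F + G, ?_, fun i => ?_⟩
  · rw [map_add]
    exact coeFn_map_add h1 k1
  · rw [map_add]
    exact coeFn_map_add (h2 i) (k2 i)

theorem IsS.smul (c : ℝ) (h : IsS f f') : IsS (c • f) (fun i => c • f' i) := by
  obtain ⟨h0, F, h1, h2⟩ := h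
  refine ⟨h0.smul c, c • F, ?_, fun i => ?_⟩
  · rw [map_smul]
    exact coeFn_map_smul c h1
  · rw [map_smul]
    exact coeFn_map_smul c (h2 i)

theorem IsC.mulS (h : IsC f f') (k : IsS g g') : IsS (f * g) (fun i => f' i * g + f * g' i) := by
  obtain ⟨k0, G, k1, k2⟩ := k
  refine ⟨h.mul k0, ?_⟩
  obtain ⟨F, h1, h2⟩ := h
  refine ⟨DV.map₂ bmul F G, ?_, fun i => ?_⟩
  · rw [DV.base_map₂]
    exact coeFn_map_bmul h1 k1
  · rw [DV.der_map₂]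
    exact coeFn_map_add (coeFn_map_bmul (h2 i) k1) (coeFn_map_bmul h1 (k2 i))

theorem IsS.mul (h : IsS f f') (k : IsS g g') : IsS (f * g) (fun i => f' i * g + f * g' i) :=
  h.1.mulS k

theorem IsC.symm {f'' : Fin 2 → Fin 2 → Plane → ℝ} (h : IsC f f') (h' : ∀ i, IsC (f' i) (f'' i))
    (i j : Fin 2) : f'' i j =ᵐ[volume] f'' j i := by
  obtain ⟨F, h1, h2⟩ := h
  choose G k1 k2 using h'
  have e : ∀ i, DV.der i F = DV.base (G i) := fun i => BCF.ext_ae ((h2 i).symm.trans (k1 i))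
  have h3 : ∀ i j, IsGen j (DV.der i F) (DV.der j (G i)) := fun i j => e i ▸ DV.isGen (G i) j
  have h4 : DV.der j (G i) = DV.der i (G j) :=
    ((DV.isGen F i).swap (DV.isGen F j) (h3 i j)).unique (h3 j i)
  exact (k2 i j).trans (by rw [h4]; exact (k2 j i).symm)

theorem IsS.hasWeakDeriv (h : IsS f f') (i : Fin 2) : HasWeakDeriv (Pi.single i 1) f (f' i) := by
  obtain ⟨-, F, h1, h2⟩ := h
  exact (isGen_L2_iff.1 (DV.isGen F i)).congr h1.symm (h2 i).symm

theorem IsS.wderiv (h : IsS f f') (i : Fin 2) : wderiv i f =ᵐ[volume] f' i :=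
  wderiv_ae (h.hasWeakDeriv i)

theorem IsS.exists_L2 (h : IsS f f') : ∃ a : L2, f =ᵐ[volume] a := by
  obtain ⟨-, F, h1, -⟩ := h
  exact ⟨_, h1⟩

theorem IsS.exists_L2_deriv (h : IsS f f') (i : Fin 2) : ∃ a : L2, f' i =ᵐ[volume] a := by
  obtain ⟨-, F, -, h2⟩ := h
  exact ⟨_, h2 i⟩

theorem IsC.mul_L2 (h : IsC f f') (hg : ∃ a : L2, g =ᵐ[volume] a) :
    ∃ a : L2, f * g =ᵐ[volume] a := by
  obtain ⟨F, h1, -⟩ := h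
  obtain ⟨a, ha⟩ := hg
  exact ⟨_, coeFn_map_bmul h1 ha⟩

theorem IsS.of_H3 (F : H3) : IsS (DV.base (DV.base (DV.base F)) : L2)
    (fun i => (DV.base (DV.base (DV.der i F)) : L2)) := by
  refine ⟨⟨DV.map sobolev F, ?_, fun i => ?_⟩, DV.base (DV.base F), ae_eq_rfl, fun i => ?_⟩
  · rw [DV.base_map]
    exact coeFn_sobolev _
  · rw [DV.der_map]
    exact coeFn_sobolev _
  · simp only [DV.base_der]
    exact ae_eq_rfl

theorem IsC.of_CK (k : CK) : IsC (CK.val k) (fun i => sobolev (CK.der i k)) :=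
  ⟨DV.mk (CK.val k) (fun i => sobolev (CK.der i k)) fun i => dsub.isGen k i,
    by rw [DV.base_mk], fun i => by rw [DV.der_mk]⟩

end Predicates

/-! ### Fields as elements of `(X⁰)'` -/

/-- `v ∈ (X⁰)'` is the `L²` field with components `V`. -/
def IsFieldY (μ : ℝ) (v : Y0 μ) (V : Fin 2 → Plane → ℝ) : Prop :=
  ∃ a : Fin 2 → L2, (∀ j, V j =ᵐ[volume] a j) ∧ v = ∑ j, eY μ j (a j)

section Fields

variable {v w : Y0 μ} {V W : Fin 2 → Plane → ℝ}

theorem IsFieldY.congr (h : IsFieldY μ v V) (e : ∀ j, W j =ᵐ[volume] V j) : IsFieldY μ v W := by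
  obtain ⟨a, ha, hv⟩ := h
  exact ⟨a, fun j => (e j).trans (ha j), hv⟩

theorem IsFieldY.eq (h : IsFieldY μ v V) (k : IsFieldY μ w W) (e : ∀ j, V j =ᵐ[volume] W j) : v = w := by
  obtain ⟨a, ha, rfl⟩ := h
  obtain ⟨b, hb, rfl⟩ := k
  have : a = b := funext fun j => Lp.ext ((ha j).symm.trans ((e j).trans (hb j)))
  rw [this]

theorem IsFieldY.add (h : IsFieldY μ v V) (k : IsFieldY μ w W) :
    IsFieldY μ (v + w) (fun j => V j + W j) := by
  obtain ⟨a, ha, rfl⟩ := h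
  obtain ⟨b, hb, rfl⟩ := k
  refine ⟨fun j => a j + b j, fun j => coeFn_map_add (ha j) (hb j), ?_⟩
  simp only [fun j => (eY μ j).map_add (a j) (b j), Finset.sum_add_distrib]

theorem IsFieldY.smul (c : ℝ) (h : IsFieldY μ v V) : IsFieldY μ (c • v) (fun j => c • V j) := by
  obtain ⟨a, ha, rfl⟩ := h
  refine ⟨fun j => c • a j, fun j => coeFn_map_smul c (ha j), ?_⟩
  simp only [fun j => (eY μ j).map_smul c (a j), Finset.smul_sum]

theorem IsFieldY.sub (h : IsFieldY μ v V) (k : IsFieldY μ w W) :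
    IsFieldY μ (v - w) (fun j => V j + (-1 : ℝ) • W j) := by
  have := h.add (k.smul (-1))
  rwa [neg_one_smul, ← sub_eq_add_neg] at this

theorem IsFieldY.mulYK (hμ : 0 < μ) (k : CK) (h : IsFieldY μ v V) :
    IsFieldY μ (mulYK μ k v) (fun j => CK.val k * V j) := by
  obtain ⟨a, ha, rfl⟩ := h
  refine ⟨fun j => bmul (CK.val k) (a j), fun j => coeFn_map_bmul ae_eq_rfl (ha j), ?_⟩
  rw [map_sum]
  simp only [mulYK_eY hμ]

theorem IsFieldY.toY {f : Plane → Plane} (h : ∀ j, (fun x => f x j) =ᵐ[volume] V j)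
    (hV : ∀ j, ∃ a : L2, V j =ᵐ[volume] a) : IsFieldY μ (toY μ f) V := by
  choose a ha using hV
  exact ⟨a, ha, toY_eq fun j => (h j).trans (ha j)⟩

theorem IsFieldY.eY_sum {m : Fin 2 → L2} (h : ∀ j, V j =ᵐ[volume] m j) :
    IsFieldY μ (∑ j, eY μ j (m j)) V :=
  ⟨m, h, rfl⟩

theorem IsFieldY.pY_two (hμ : 0 < μ) {q : L2} {f : Plane → ℝ} {f' : Fin 2 → Plane → ℝ}
    (h : IsS f f') (hq : q =ᵐ[volume] f) : IsFieldY μ (pY μ 2 q) (fun j => (-1 : ℝ) • f' j) := by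
  obtain ⟨-, F, h1, h2⟩ := h
  have : q = DV.base F := Lp.ext (hq.trans h1)
  refine ⟨fun j => (-1 : ℝ) • DV.der j F, fun j => coeFn_map_smul _ (h2 j), ?_⟩
  rw [this, pY_two_base hμ]
  simp only [neg_one_smul, map_neg, Finset.sum_neg_distrib]

theorem IsFieldY.gradY (hμ : 0 < μ) {f g : Plane → ℝ} {f' : Fin 2 → Plane → ℝ}
    (h : IsS f f') (hg : g =ᵐ[volume] f) : IsFieldY μ (gradY μ g) f' := by
  obtain ⟨a, ha⟩ := h.exists_L2
  rw [gradY_eq (hg.trans ha), ← neg_one_smul ℝ]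
  refine ((IsFieldY.pY_two hμ h ha.symm).smul (-1)).congr fun j => ?_
  simp

theorem IsFieldY.hasCurl {V' : Fin 2 → Fin 2 → Plane → ℝ} (h : IsFieldY μ v V)
    (hV : ∀ j, IsS (V j) (V' j)) : HasCurl μ v (V' 1 0 - V' 0 1) := by
  obtain ⟨a, ha, rfl⟩ := h
  have hw := fun i j => hasWeakDeriv_single_iff.1 ((hV i).hasWeakDeriv j)
  refine ⟨(hw 1 0).2.1.sub (hw 0 1).2.1, fun φ hφ => ?_⟩
  have hc : ∀ j, (eY μ j (a j)) (testX μ _ hφ.rotGrad)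
      = ∫ x, V j x * (!₂[pd 1 φ x, -pd 0 φ x] : Plane) j := fun j => by
    rw [eY_apply, vc_testX, L2.inner_def]
    refine integral_congr_ae ?_
    filter_upwards [ha j, (hφ.rotGrad.comp_apply j).memLp.coeFn_toLp] with x h1 h2
    rw [h1, h2]
    simp [mul_comm]
  have e1 := (hw 1 0).2.2 φ hφ
  have e2 := (hw 0 1).2.2 φ hφ
  have h1 := integral_sub (integrable_mul_test (hw 1 0).2.1 hφ) (integrable_mul_test (hw 0 1).2.1 hφ)
  have h2 : ∀ x, (V' 1 0 - V' 0 1) x * φ x = V' 1 0 x * φ x - V' 0 1 x * φ x := fun x => by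
    simp [sub_mul]
  have h3 : ∫ x, V 1 x * -pd 0 φ x = -∫ x, V 1 x * pd 0 φ x := by
    rw [← integral_neg]
    simp
  rw [Fin.sum_univ_two, add_apply, hc, hc]
  simp only [h2, h1]
  simp only [Matrix.cons_val_zero, Matrix.cons_val_one, Matrix.cons_val_fin_one, h3, e1, e2]
  ring

theorem IsFieldY.curlY {V' : Fin 2 → Fin 2 → Plane → ℝ} (h : IsFieldY μ v V)
    (hV : ∀ j, IsS (V j) (V' j)) : curlY μ v =ᵐ[volume] V' 1 0 - V' 0 1 := by
  have hex : ∃ κ, HasCurl μ v κ := ⟨_, h.hasCurl hV⟩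
  rw [_root_.curlY, dif_pos hex]
  have h1 := hex.choose_spec
  have h2 := h.hasCurl hV
  exact ae_eq_of_forall_test h1.1 h2.1 fun φ hφ => (h1.2 φ hφ).trans (h2.2 φ hφ).symm

end Fields

theorem divX_eq_of_isGen (hμ : 0 < μ) {u : X0 μ} {a : Fin 2 → L2}
    (h : ∀ i, IsGen i (vc μ i u) (a i)) : divX μ u = ∑ i, a i := by
  refine sub_eq_zero.1 (testL_separating fun χ hχ => ?_)
  have h3 := sum_testL_vc hμ u hχ
  have h4 : ∀ i, testL (hχ.pderiv i) (vc μ i u) = -testL hχ (a i) := fun i => by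
    have := (hasWeakDeriv_single_iff.1 (isGen_L2_iff.1 (h i))).2.2 χ hχ
    rwa [← testL_apply, ← testL_apply] at this
  simp only [h4, Finset.sum_neg_distrib, neg_inj] at h3
  rw [map_sub, map_sum, h3, sub_self]

variable {μ : ℝ}

/-! ### The two evolution equations at a fixed time -/

/-- The derivatives, at a fixed time, of the depth `h` (with inverse `g`), of the velocity `u`, of
its divergence, of the gradient `B` of the bottom and of `W = B ⬝ u`. -/
structure Jets (μ : ℝ) (b hf : Plane → ℝ) (h g : CK) (B : Fin 2 → BCF) (u : X0 μ) where
  /-- The gradient of the depth. -/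
  hx : Fin 2 → Plane → ℝ
  /-- The second derivatives of the depth. -/
  hxx : Fin 2 → Fin 2 → Plane → ℝ
  /-- The gradient of the velocity. -/
  ux : Fin 2 → Fin 2 → Plane → ℝ
  /-- The gradient of the divergence. -/
  dx : Fin 2 → Plane → ℝ
  /-- The second derivatives of the divergence. -/
  dxx : Fin 2 → Fin 2 → Plane → ℝ
  /-- The second derivatives of the bottom. -/
  Bx : Fin 2 → Fin 2 → Plane → ℝ
  /-- The slope of the bottom in the direction of the velocity. -/
  W : Plane → ℝ
  /-- The gradient of `W`. -/
  Wx : Fin 2 → Plane → ℝ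
  /-- The second derivatives of `W`. -/
  Wxx : Fin 2 → Fin 2 → Plane → ℝ
  isC_h : IsC (CK.val h) hx
  isC_hx : ∀ i, IsC (hx i) (hxx i)
  isS_u : ∀ j, IsS (vc μ j u) (ux j)
  isS_d : IsS (divX μ u) dx
  isS_dx : ∀ i, IsS (dx i) (dxx i)
  isS_B : ∀ j, IsS (B j) (Bx j)
  isS_W : IsS W Wx
  isS_Wx : ∀ i, IsS (Wx i) (Wxx i)
  hf_ae : hf =ᵐ[volume] CK.val h
  mul_g : mulK h g = oneK
  b_ae : ∀ j, wderiv j b =ᵐ[volume] B j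
  d_ae : divX μ u =ᵐ[volume] fun x => ux 0 0 x + ux 1 1 x
  Bx_symm : Bx 0 1 =ᵐ[volume] Bx 1 0
  W_ae : ∀ x, W x = B 0 x * vc μ 0 u x + B 1 x * vc μ 1 u x
  Wx_ae : ∀ i x, Wx i x = Bx 0 i x * vc μ 0 u x + B 0 x * ux 0 i x
    + (Bx 1 i x * vc μ 1 u x + B 1 x * ux 1 i x)

namespace Jets

variable {β : ℝ} {b hf : Plane → ℝ} {h g : CK} {B : Fin 2 → BCF} {u : X0 μ}
  (J : Jets μ b hf h g B u)

theorem adv_ae {f f₀ : Plane → ℝ} {f' : Fin 2 → Plane → ℝ} (hf : IsS f f') (e : f₀ =ᵐ[volume] f) :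
    adv (velX μ u) f₀ =ᵐ[volume] vc μ 0 u * f' 0 + vc μ 1 u * f' 1 := by
  have hf₀ := hf.congr e fun i => ae_eq_rfl
  filter_upwards [hf₀.wderiv 0, hf₀.wderiv 1, coeFn_vc 0 u, coeFn_vc 1 u] with x h1 h2 h3 h4
  rw [Pi.add_apply, Pi.mul_apply, Pi.mul_apply, h3, h4, adv, dotp_apply, wgrad]
  simp [h1, h2]

include J in
theorem val_ne_zero (x : Plane) : CK.val h x ≠ 0 := fun h0 => by
  have h1 := congrArg (fun m : CK => CK.val m x) J.mul_g
  simp only [val_mulK, val_oneK, BCF.mul_apply, BCF.one_apply, h0, zero_mul] at h1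
  exact zero_ne_one h1

theorem dotp_b : dotp (wgrad b) (velX μ u) =ᵐ[volume] J.W := by
  filter_upwards [dotp_wgrad_ae J.b_ae u] with x hx
  rw [hx, J.W_ae, Fin.sum_univ_two]

theorem adv_b : adv (velX μ u) b =ᵐ[volume] J.W := by
  filter_upwards [J.dotp_b] with x hx
  rw [← hx, adv, dotp_apply, dotp_apply]
  ring

/-- `(u⬝∇)(∇⬝u) - (∇⬝u)²`. -/
def q : Plane → ℝ := vc μ 0 u * J.dx 0 + vc μ 1 u * J.dx 1 + (-1 : ℝ) • (divX μ u * divX μ u)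

/-- `(u⬝∇)²b`. -/
def a : Plane → ℝ := vc μ 0 u * J.Wx 0 + vc μ 1 u * J.Wx 1

/-- The gradient of `q`. -/
def qx (i : Fin 2) : Plane → ℝ :=
  J.ux 0 i * J.dx 0 + vc μ 0 u * J.dxx 0 i + (J.ux 1 i * J.dx 1 + vc μ 1 u * J.dxx 1 i)
    + (-1 : ℝ) • (J.dx i * divX μ u + divX μ u * J.dx i)

/-- The gradient of `a`. -/
def ax (i : Fin 2) : Plane → ℝ :=
  J.ux 0 i * J.Wx 0 + vc μ 0 u * J.Wxx 0 i + (J.ux 1 i * J.Wx 1 + vc μ 1 u * J.Wxx 1 i)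

theorem isS_q : IsS J.q J.qx :=
  (((J.isS_u 0).mul (J.isS_dx 0)).add ((J.isS_u 1).mul (J.isS_dx 1))).add
    ((J.isS_d.mul J.isS_d).smul (-1))

theorem isS_a : IsS J.a J.ax :=
  ((J.isS_u 0).mul (J.isS_Wx 0)).add ((J.isS_u 1).mul (J.isS_Wx 1))

theorem quadDiv_ae : quadDiv μ u =ᵐ[volume] J.q := by
  filter_upwards [adv_ae (u := u) J.isS_d ae_eq_rfl] with x hx
  simp only [quadDiv, q, Pi.sub_apply, Pi.add_apply, Pi.pow_apply, Pi.smul_apply, Pi.mul_apply, hx,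
    smul_eq_mul]
  ring

theorem adv2_ae : adv2 μ b u =ᵐ[volume] J.a := adv_ae J.isS_W J.adv_b

/-- The components of `v`. -/
def v (β : ℝ) (j : Fin 2) : Plane → ℝ :=
  vc μ j u + (μ * β ^ 2) • (J.W * B j) + (-(μ / 2) * β) • (CK.val h * (B j * divX μ u))
    + (μ * β) • (J.hx j * J.W) + (μ * β / 2) • (CK.val h * J.Wx j)
    + (-μ) • (CK.val h * (J.hx j * divX μ u)) + (-(μ / 3)) • (CK.val h * (CK.val h * J.dx j))

/-- The gradient of `v`. -/
def vx (β : ℝ) (j i : Fin 2) : Plane → ℝ :=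
  J.ux j i + (μ * β ^ 2) • (J.Wx i * B j + J.W * J.Bx j i)
    + (-(μ / 2) * β) • (J.hx i * (B j * divX μ u)
      + CK.val h * (J.Bx j i * divX μ u + B j * J.dx i))
    + (μ * β) • (J.hxx j i * J.W + J.hx j * J.Wx i)
    + (μ * β / 2) • (J.hx i * J.Wx j + CK.val h * J.Wxx j i)
    + (-μ) • (J.hx i * (J.hx j * divX μ u)
      + CK.val h * (J.hxx j i * divX μ u + J.hx j * J.dx i))
    + (-(μ / 3)) • (J.hx i * (CK.val h * J.dx j)
      + CK.val h * (J.hx i * J.dx j + CK.val h * J.dxx j i))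

theorem isS_v (j : Fin 2) : IsS (J.v β j) (J.vx β j) :=
  ((((((J.isS_u j).add ((J.isS_W.mul (J.isS_B j)).smul _)).add
    ((J.isC_h.mulS ((J.isS_B j).mul J.isS_d)).smul _)).add
    (((J.isC_hx j).mulS J.isS_W).smul _)).add
    ((J.isC_h.mulS (J.isS_Wx j)).smul _)).add
    ((J.isC_h.mulS ((J.isC_hx j).mulS J.isS_d)).smul _)).add
    ((J.isC_h.mulS (J.isC_h.mulS (J.isS_dx j))).smul _)

/-- The field given by the terms that are common to `𝔗` and its derivative with respect to the
depth. -/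
theorem isFieldY_terms (hμ : 0 < μ) {m n r : BCF} {c c' : ℝ} {p' r' : Fin 2 → Plane → ℝ}
    (hp : IsS (n * J.W) p') (hr : IsS (r * divX μ u) r') :
    IsFieldY μ (∑ j, eY μ j (bmul m (vc μ j u))
        + μ • ∑ j, ∑ i, eY μ j (bmul (m * β • B i * β • B j) (vc μ i u))
        - c • (∑ j, eY μ j (bmul (n * β • B j) (divX μ u))
          + ∑ j, pY μ 2 (bmul (n * β • B j) (vc μ j u)))
        + c' • pY μ 2 (bmul r (divX μ u)))
      (fun j => m * vc μ j u + μ • (β ^ 2 • (m * J.W * B j))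
        + (-1 : ℝ) • (c • (β • (n * B j * divX μ u) + (-1 : ℝ) • β • p' j))
        + c' • ((-1 : ℝ) • r' j)) := by
  refine (((IsFieldY.eY_sum fun j => (coeFn_bmul m (vc μ j u)).symm).add
    (IsFieldY.smul μ ?_)).sub (IsFieldY.smul c (IsFieldY.add ?_ ?_))).add
    (IsFieldY.smul c' (IsFieldY.pY_two hμ hr (coeFn_bmul r (divX μ u))))
  · simp only [← map_sum]
    refine IsFieldY.eY_sum fun j => ?_
    filter_upwards [coeFn_bmul_sum (fun i => m * β • B i * β • B j) fun i => vc μ i u] with x hx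
    rw [hx, Fin.sum_univ_two]
    simp only [Pi.smul_apply, Pi.mul_apply, smul_eq_mul, BCF.mul_apply, BCF.smul_apply, J.W_ae]
    ring
  · refine IsFieldY.eY_sum fun j => ?_
    filter_upwards [coeFn_bmul (n * β • B j) (divX μ u)] with x hx
    rw [hx]
    simp only [Pi.smul_apply, Pi.mul_apply, smul_eq_mul, BCF.mul_apply, BCF.smul_apply]
    ring
  · rw [← map_sum]
    refine IsFieldY.pY_two hμ (hp.smul β) ?_
    filter_upwards [coeFn_bmul_sum (fun j => n * β • B j) fun i => vc μ i u] with x hx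
    rw [hx, Fin.sum_univ_two]
    simp only [Pi.smul_apply, Pi.mul_apply, smul_eq_mul, BCF.mul_apply, BCF.smul_apply, J.W_ae]
    ring

/-- The components of `v = h⁻¹ 𝔗 u`. -/
theorem isFieldY_v (hμ : 0 < μ) {v₀ : Y0 μ}
    (hv : mulYK μ h v₀ = frak0 μ (CK.val h) (fun j => β • B j) u) : IsFieldY μ v₀ (J.v β) := by
  have e : v₀ = mulYK μ g (frak0 μ (CK.val h) (fun j => β • B j) u) := by
    rw [← hv, mulYK_cancel hμ (by rw [mulK_comm, J.mul_g])]
  have h1 := J.isFieldY_terms (β := β) hμ (m := CK.val h) (n := CK.val h * CK.val h)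
    (r := CK.val h * CK.val h * CK.val h) (c := μ / 2) (c' := μ / 3)
    ((J.isC_h.mulS (J.isC_h.mulS J.isS_W)).congr (Eventually.of_forall fun x => ?_)
      fun i => ae_eq_rfl)
    ((J.isC_h.mulS (J.isC_h.mulS (J.isC_h.mulS J.isS_d))).congr (Eventually.of_forall fun x => ?_)
      fun i => ae_eq_rfl)
  · rw [e, frak0_apply]
    refine (h1.mulYK hμ g).congr fun j => Eventually.of_forall fun x => ?_
    have hg : CK.val h x * CK.val g x = 1 := by
      have h1 := congrArg (fun m : CK => CK.val m x) J.mul_g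
      simpa only [val_mulK, val_oneK, BCF.mul_apply, BCF.one_apply] using h1
    simp only [v, Pi.smul_apply, Pi.mul_apply, Pi.add_apply, smul_eq_mul, BCF.mul_apply]
    generalize CK.val h x = h at hg ⊢
    generalize CK.val g x = g at hg ⊢
    linear_combination (-(vc μ j u x + (μ * β ^ 2) * (J.W x * B j x)
      + (-(μ / 2) * β) * (h * (B j x * divX μ u x))
    + (μ * β) * (J.hx j x * J.W x) + (μ * β / 2) * (h * J.Wx j x)
    + (-μ) * (h * (J.hx j x * divX μ u x)) + (-(μ / 3)) * (h * (h * J.dx j x)))) * hg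
  · simp only [Pi.mul_apply, BCF.mul_apply]
    ring
  · simp only [Pi.mul_apply, BCF.mul_apply]
    ring

end Jets

variable {μ : ℝ}

/-! ### The nonlinear terms as fields -/

namespace Jets

variable {β : ℝ} {b hf : Plane → ℝ} {h g : CK} {B : Fin 2 → BCF} {u : X0 μ}
  (J : Jets μ b hf h g B u)

/-- `ℛ + ℛ_b`, without denominators. -/
def r (β : ℝ) : Plane → ℝ :=
  CK.val h * (J.hx 0 * (vc μ 0 u * divX μ u) + J.hx 1 * (vc μ 1 u * divX μ u))
    + (1 / 3 : ℝ) • (CK.val h * (CK.val h * (vc μ 0 u * J.dx 0 + vc μ 1 u * J.dx 1)))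
    + (1 / 2 : ℝ) • (CK.val h * (CK.val h * (divX μ u * divX μ u)))
    + (-β) • (J.hx 0 * (vc μ 0 u * J.W) + J.hx 1 * (vc μ 1 u * J.W))
    + (-β / 2) • (CK.val h * J.a) + (-β / 2) • (CK.val h * (J.W * divX μ u))
    + (-β ^ 2 / 2) • (J.W * J.W)

/-- The gradient of `r`. -/
def rx (β : ℝ) (i : Fin 2) : Plane → ℝ :=
  J.hx i * (J.hx 0 * (vc μ 0 u * divX μ u) + J.hx 1 * (vc μ 1 u * divX μ u))
    + CK.val h * (J.hxx 0 i * (vc μ 0 u * divX μ u)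
        + J.hx 0 * (J.ux 0 i * divX μ u + vc μ 0 u * J.dx i)
      + (J.hxx 1 i * (vc μ 1 u * divX μ u) + J.hx 1 * (J.ux 1 i * divX μ u + vc μ 1 u * J.dx i)))
    + (1 / 3 : ℝ) • (J.hx i * (CK.val h * (vc μ 0 u * J.dx 0 + vc μ 1 u * J.dx 1))
      + CK.val h * (J.hx i * (vc μ 0 u * J.dx 0 + vc μ 1 u * J.dx 1)
        + CK.val h * (J.ux 0 i * J.dx 0 + vc μ 0 u * J.dxx 0 i
          + (J.ux 1 i * J.dx 1 + vc μ 1 u * J.dxx 1 i))))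
    + (1 / 2 : ℝ) • (J.hx i * (CK.val h * (divX μ u * divX μ u))
      + CK.val h * (J.hx i * (divX μ u * divX μ u)
        + CK.val h * (J.dx i * divX μ u + divX μ u * J.dx i)))
    + (-β) • (J.hxx 0 i * (vc μ 0 u * J.W) + J.hx 0 * (J.ux 0 i * J.W + vc μ 0 u * J.Wx i)
      + (J.hxx 1 i * (vc μ 1 u * J.W) + J.hx 1 * (J.ux 1 i * J.W + vc μ 1 u * J.Wx i)))
    + (-β / 2) • (J.hx i * J.a + CK.val h * J.ax i)
    + (-β / 2) • (J.hx i * (J.W * divX μ u) + CK.val h * (J.Wx i * divX μ u + J.W * J.dx i))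
    + (-β ^ 2 / 2) • (J.Wx i * J.W + J.W * J.Wx i)

theorem isS_r : IsS (J.r β) (J.rx β) := by
  have hu := J.isS_u
  have hd := J.isS_d
  have hW := J.isS_W
  have hh := J.isC_h
  have hhx := J.isC_hx
  exact ((((((hh.mulS (((hhx 0).mulS ((hu 0).mul hd)).add ((hhx 1).mulS ((hu 1).mul hd)))).add
    ((hh.mulS (hh.mulS (((hu 0).mul (J.isS_dx 0)).add ((hu 1).mul (J.isS_dx 1))))).smul _)).add
    ((hh.mulS (hh.mulS (hd.mul hd))).smul _)).add
    ((((hhx 0).mulS ((hu 0).mul hW)).add ((hhx 1).mulS ((hu 1).mul hW))).smul _)).add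
    ((hh.mulS J.isS_a).smul _)).add ((hh.mulS (hW.mul hd)).smul _)).add ((hW.mul hW).smul _)

theorem r_ae : opR μ hf u + opRb μ β b hf u =ᵐ[volume] J.r β := by
  have e1 : hf ^ 3 * ⇑(divX μ u) =ᵐ[volume] ⇑(CK.val h) * (⇑(CK.val h) * (⇑(CK.val h) * ⇑(divX μ u))) := by
    filter_upwards [J.hf_ae] with x hx
    simp only [Pi.mul_apply, Pi.pow_apply, hx]
    ring
  have e2 : hf ^ 2 * dotp (bslope β b) (velX μ u)
      =ᵐ[volume] β • (⇑(CK.val h) * (⇑(CK.val h) * J.W)) := by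
    filter_upwards [J.hf_ae, J.dotp_b] with x hx hb
    simp only [Pi.mul_apply, Pi.pow_apply, Pi.smul_apply, smul_eq_mul, hx, dotp_bslope, hb]
    ring
  have hh := J.isC_h
  filter_upwards [adv_ae (u := u) (hh.mulS (hh.mulS (hh.mulS J.isS_d))) e1,
    adv_ae (u := u) ((hh.mulS (hh.mulS J.isS_W)).smul β) e2, J.hf_ae, J.dotp_b] with x h1 h2 h3 h4
  have h0 := J.val_ne_zero x
  simp only [r, a, Pi.add_apply, opR, opRb, dotp_bslope, h1, h2, h3, h4, Pi.mul_apply,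
    Pi.smul_apply, smul_eq_mul]
  field_simp
  ring

/-- The terms of the momentum equation for `v`, without `∇ζ`. -/
def fluxV (ε μ β : ℝ) (b hf : Plane → ℝ) (u : X0 μ) (v₀ : Y0 μ) : Y0 μ :=
  ε • toY μ (curlY μ v₀ • perp (velX μ u)) + (ε / 2) • gradY μ (fun x => ‖velX μ u x‖ ^ 2)
    - (μ * ε) • gradY μ (opR μ hf u + opRb μ β b hf u)

theorem isFieldY_fluxV (hμ : 0 < μ) (ε : ℝ) {v₀ : Y0 μ} (hv : IsFieldY μ v₀ (J.v β)) :
    IsFieldY μ (fluxV ε μ β b hf u v₀) (fun j =>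
      ε • (![(-1 : ℝ) • (vc μ 1 u : Plane → ℝ), vc μ 0 u] j * (J.vx β 1 0 - J.vx β 0 1))
        + (ε / 2) • (J.ux 0 j * vc μ 0 u + vc μ 0 u * J.ux 0 j
          + (J.ux 1 j * vc μ 1 u + vc μ 1 u * J.ux 1 j))
        + (-1 : ℝ) • (μ * ε) • J.rx β j) := by
  refine ((IsFieldY.smul ε (IsFieldY.toY ?_ ?_)).add (IsFieldY.smul _ (IsFieldY.gradY hμ
    (((J.isS_u 0).mul (J.isS_u 0)).add ((J.isS_u 1).mul (J.isS_u 1))) ?_))).sub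
    (IsFieldY.smul _ (IsFieldY.gradY hμ J.isS_r J.r_ae))
  · intro j
    filter_upwards [hv.curlY J.isS_v, coeFn_vc 0 u, coeFn_vc 1 u] with x h1 h2 h3
    fin_cases j <;> simp [perp, h1, h2, h3, mul_comm]
  · have hc : ∃ a : L2, J.vx β 1 0 - J.vx β 0 1 =ᵐ[volume] a := by
      obtain ⟨a, ha⟩ := (J.isS_v (β := β) 1).exists_L2_deriv 0
      obtain ⟨c, hc⟩ := (J.isS_v (β := β) 0).exists_L2_deriv 1
      exact ⟨a - c, (ha.sub hc).trans (Lp.coeFn_sub a c).symm⟩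
    intro j
    fin_cases j
    · exact ((J.isS_u 1).smul (-1)).1.mul_L2 hc
    · exact (J.isS_u 0).1.mul_L2 hc
  · filter_upwards [coeFn_vc 0 u, coeFn_vc 1 u] with x h1 h2
    rw [EuclideanSpace.norm_sq_eq, Fin.sum_univ_two]
    simp only [Real.norm_eq_abs, sq_abs, Pi.add_apply, Pi.mul_apply, h1, h2]
    ring

/-- The terms of the momentum equation for `u`, without `∇ζ` and `∂ₜu`. -/
def fluxU (ε μ β : ℝ) (b hf : Plane → ℝ) (u : X0 μ) : Y0 μ :=
  ε • toY μ (advV (velX μ u) (velX μ u)) + (μ * ε) • (opQ μ hf u + opQb μ β b hf u)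

include J in
theorem mulYK_inv (hμ : 0 < μ) (w : Y0 μ) : mulYK μ h (mulY μ hf⁻¹ w) = w := by
  rw [mulY_eq hμ (inv_ae J.hf_ae J.mul_g), mulYK_cancel hμ J.mul_g]

include J in
theorem mulYK_fluxU (hμ : 0 < μ) (ε : ℝ) : mulYK μ h (fluxU ε μ β b hf u)
    = ε • mulYK μ h (toY μ (advV (velX μ u) (velX μ u)))
      + (μ * ε) • (-(1 / 3 : ℝ) • gradY μ (hf ^ 3 * quadDiv μ u)
        + ((β / 2) • (gradY μ (hf ^ 2 * adv2 μ b u) - toY μ ((hf ^ 2 * quadDiv μ u) • wgrad b))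
          + β ^ 2 • mulYK μ h (toY μ (adv2 μ b u • wgrad b)))) := by
  rw [fluxU, opQ, opQb]
  simp only [(mulYK μ h).map_add, (mulYK μ h).map_smul, J.mulYK_inv hμ]

theorem isFieldY_fluxU (hμ : 0 < μ) (ε : ℝ) :
    IsFieldY μ (mulYK μ h (fluxU ε μ β b hf u)) (fun j =>
      ε • (CK.val h * (vc μ 0 u * J.ux j 0 + vc μ 1 u * J.ux j 1))
      + (μ * ε) • (-(1 / 3 : ℝ) • (J.hx j * (CK.val h * (CK.val h * J.q))
          + CK.val h * (J.hx j * (CK.val h * J.q)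
            + CK.val h * (J.hx j * J.q + CK.val h * J.qx j)))
        + ((β / 2) • (J.hx j * (CK.val h * J.a) + CK.val h * (J.hx j * J.a + CK.val h * J.ax j)
            + (-1 : ℝ) • (CK.val h * (CK.val h * (J.q * B j))))
          + β ^ 2 • (CK.val h * (J.a * B j))))) := by
  have hh := J.isC_h
  have hadv : ∀ j, (fun x => advV (velX μ u) (velX μ u) x j)
      =ᵐ[volume] vc μ 0 u * J.ux j 0 + vc μ 1 u * J.ux j 1 := fun j => by
    filter_upwards [adv_ae (u := u) (J.isS_u j) (coeFn_vc j u).symm] with x hx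
    rw [← hx]
    fin_cases j <;> simp [advV]
  have huu : ∀ j, ∃ a : L2, ⇑(vc μ 0 u) * J.ux j 0 + ⇑(vc μ 1 u) * J.ux j 1 =ᵐ[volume] a := fun j => by
    obtain ⟨a, ha⟩ := (J.isS_u 0).1.mul_L2 ((J.isS_u j).exists_L2_deriv 0)
    obtain ⟨c, hc⟩ := (J.isS_u 1).1.mul_L2 ((J.isS_u j).exists_L2_deriv 1)
    exact ⟨a + c, coeFn_map_add ha hc⟩
  rw [J.mulYK_fluxU hμ]
  refine (IsFieldY.smul ε (IsFieldY.mulYK hμ h (IsFieldY.toY hadv huu))).add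
    (IsFieldY.smul _ ((IsFieldY.smul _ (IsFieldY.gradY hμ
      (hh.mulS (hh.mulS (hh.mulS J.isS_q))) ?_)).add
      ((IsFieldY.smul _ ((IsFieldY.gradY hμ (hh.mulS (hh.mulS J.isS_a)) ?_).sub
        (IsFieldY.toY ?_ fun j => (hh.mulS (hh.mulS (J.isS_q.mul (J.isS_B j)))).exists_L2))).add
      (IsFieldY.smul _ (IsFieldY.mulYK hμ h
        (IsFieldY.toY ?_ fun j => (J.isS_a.mul (J.isS_B j)).exists_L2))))))
  · filter_upwards [J.hf_ae, J.quadDiv_ae] with x h1 h2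
    simp only [Pi.mul_apply, Pi.pow_apply, h1, h2]
    ring
  · filter_upwards [J.hf_ae, J.adv2_ae] with x h1 h2
    simp only [Pi.mul_apply, Pi.pow_apply, h1, h2]
    ring
  · intro j
    filter_upwards [J.hf_ae, J.quadDiv_ae, wgrad_ae J.b_ae j] with x h1 h2 h3
    simp only [Pi.smul_apply', Pi.mul_apply, Pi.pow_apply, PiLp.smul_apply, smul_eq_mul, h1, h2, h3]
    ring
  · intro j
    filter_upwards [J.adv2_ae, wgrad_ae J.b_ae j] with x h2 h3
    simp only [Pi.smul_apply', Pi.mul_apply, PiLp.smul_apply, smul_eq_mul, h2, h3]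

theorem coefMatDeriv_sum {R : Type*} [CommRing R] [Algebra ℝ R] {M : Type*} [AddCommGroup M]
    [Module ℝ M] (A : R →ₗ[ℝ] Fin 3 → Fin 3 → M) (h k : R) (s : Fin 2 → R) :
    ∑ a, ∑ b, A (coefMatDeriv μ h k s a b) a b
      = ∑ j : Fin 2, A k j.castSucc j.castSucc
        + μ • ∑ j : Fin 2, ∑ i : Fin 2, A (k * s i * s j) j.castSucc i.castSucc
        - μ • (∑ j : Fin 2, A (h * k * s j) j.castSucc 2 + ∑ j : Fin 2, A (h * k * s j) 2 j.castSucc)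
        + μ • A (h * h * k) 2 2 := by
  have e : k * s 1 * s 0 = k * s 0 * s 1 := by ring
  simp only [Fin.sum_univ_three, Fin.sum_univ_two, coefMatDeriv, Matrix.cons_val_zero,
    Matrix.cons_val_one, Matrix.cons_val, map_add, map_smul, Pi.add_apply, Pi.smul_apply, e,
    Fin.castSucc_zero, Fin.castSucc_one]
  module

theorem frakOp_deriv_apply (h k : BCF) (s : Fin 2 → BCF) (u : X0 μ) :
    frakOp bmul (pY μ) (qX μ) (coefMatDeriv μ h k s) u
      = ∑ j, eY μ j (bmul k (vc μ j u)) + μ • ∑ j, ∑ i, eY μ j (bmul (k * s i * s j) (vc μ i u))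
        - μ • (∑ j, eY μ j (bmul (h * k * s j) (divX μ u))
          + ∑ j, pY μ 2 (bmul (h * k * s j) (vc μ j u)))
        + μ • pY μ 2 (bmul (h * h * k) (divX μ u)) := by
  have := coefMatDeriv_sum (μ := μ) (coefTerm u) h k s
  simp only [coefTerm_apply, qX_castSucc, qX_two] at this
  rw [← this, frakOp_apply]
  simp only [map_sum]

/-- The time derivative of the depth, in terms of the jets. -/
def k (ε : ℝ) : Plane → ℝ :=
  (-ε) • (J.hx 0 * vc μ 0 u + J.hx 1 * vc μ 1 u + CK.val h * divX μ u)

/-- The gradient of `k`. -/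
def kx (ε : ℝ) (i : Fin 2) : Plane → ℝ :=
  (-ε) • (J.hxx 0 i * vc μ 0 u + J.hx 0 * J.ux 0 i + (J.hxx 1 i * vc μ 1 u + J.hx 1 * J.ux 1 i)
    + (J.hx i * divX μ u + CK.val h * J.dx i))

theorem isS_k (ε : ℝ) : IsS (J.k ε) (J.kx ε) :=
  ((((J.isC_hx 0).mulS (J.isS_u 0)).add ((J.isC_hx 1).mulS (J.isS_u 1))).add
    (J.isC_h.mulS J.isS_d)).smul (-ε)

theorem isFieldY_deriv (hμ : 0 < μ) {ε : ℝ} {k : CK} (hk : CK.val k =ᵐ[volume] J.k ε) :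
    IsFieldY μ (frakOp bmul (pY μ) (qX μ) (coefMatDeriv μ (CK.val h) (CK.val k) (fun j => β • B j)) u)
      (fun j => CK.val k * vc μ j u + μ • (β ^ 2 • (CK.val k * J.W * B j))
        + (-1 : ℝ) • (μ • (β • (⇑(CK.val h * CK.val k) * B j * divX μ u) + (-1 : ℝ) • β •
          (J.hx j * (J.k ε * J.W) + CK.val h * (J.kx ε j * J.W + J.k ε * J.Wx j))))
        + μ • ((-1 : ℝ) • (J.hx j * (CK.val h * (J.k ε * divX μ u))
          + CK.val h * (J.hx j * (J.k ε * divX μ u)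
            + CK.val h * (J.kx ε j * divX μ u + J.k ε * J.dx j))))) := by
  rw [frakOp_deriv_apply]
  refine J.isFieldY_terms hμ
    ((J.isC_h.mulS ((J.isS_k ε).mul J.isS_W)).congr ?_ fun i => ae_eq_rfl)
    ((J.isC_h.mulS (J.isC_h.mulS ((J.isS_k ε).mul J.isS_d))).congr ?_ fun i => ae_eq_rfl)
  · filter_upwards [hk] with x hx
    simp only [Pi.mul_apply, BCF.mul_apply, hx]
    ring
  · filter_upwards [hk] with x hx
    simp only [Pi.mul_apply, BCF.mul_apply, hx]
    ring

end Jets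

variable {μ : ℝ}

/-! ### The identity between the two momentum equations -/

namespace Jets

variable {β : ℝ} {b hf : Plane → ℝ} {h g : CK} {B : Fin 2 → BCF} {u : X0 μ}
  (J : Jets μ b hf h g B u)

/-- The difference between `h` times the nonlinear terms of the two momentum equations is made of
the terms that come from the time derivative of `h` in `h v = 𝔗 u`. -/
theorem flux_identity (hμ : 0 < μ) {ε : ℝ} {k : CK} (hk : CK.val k =ᵐ[volume] J.k ε) {v₀ : Y0 μ}
    (hv : mulYK μ h v₀ = frak0 μ (CK.val h) (fun j => β • B j) u) :
    frakOp bmul (pY μ) (qX μ) (coefMatDeriv μ (CK.val h) (CK.val k) (fun j => β • B j)) u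
        + mulYK μ h (fluxV ε μ β b hf u v₀)
      = mulYK μ k v₀ + mulYK μ h (fluxU ε μ β b hf u) := by
  have hv₀ := J.isFieldY_v hμ hv
  refine IsFieldY.eq ((J.isFieldY_deriv hμ hk).add ((J.isFieldY_fluxV hμ ε hv₀).mulYK hμ h))
    ((hv₀.mulYK hμ k).add (J.isFieldY_fluxU hμ ε)) fun j => ?_
  filter_upwards [hk, J.d_ae, J.Bx_symm, J.isC_h.symm J.isC_hx 1 0,
    J.isS_d.1.symm (fun i => (J.isS_dx i).1) 1 0, J.isS_W.1.symm (fun i => (J.isS_Wx i).1) 1 0]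
    with x e1 e2 e3 e4 e5 e6
  have w := J.W_ae x
  have w0 := J.Wx_ae 0 x
  have w1 := J.Wx_ae 1 x
  have hkm : (CK.val h * CK.val k) x = CK.val h x * CK.val k x := rfl
  -- `W` and its gradient, the divergence and `k` are eliminated; what remains is an identity of
  -- polynomials in independent jets.
  fin_cases j <;>
  · simp only [Jets.k, kx, v, vx, rx, q, qx, a, ax, Pi.add_apply, Pi.sub_apply, Pi.mul_apply,
      Pi.smul_apply, smul_eq_mul, Matrix.cons_val_zero, Matrix.cons_val_one, Fin.zero_eta, Fin.mk_one,
      Fin.isValue, Matrix.cons_val_fin_one, hkm] at e1 ⊢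
    rw [e3] at w1
    rw [e2] at e1
    simp only [e1, e2, e3, e4, e5, e6, w, w0, w1]
    ring

end Jets

variable {μ : ℝ}

/-! ### The jets of the solution -/

theorem IsS.of_H4 (F : H4) : IsS (base4 F : L2)
    (fun i => (DV.base (DV.base (DV.base (DV.der i F))) : L2)) := by
  refine (IsS.of_H3 (DV.base F)).congr ae_eq_rfl fun i => ?_
  simp only [DV.base_der]
  exact ae_eq_rfl

theorem IsC.eq_sobolev {k : CK} {f' : Fin 2 → Plane → ℝ} (h : IsC (CK.val k) f') (i : Fin 2) :
    f' i =ᵐ[volume] sobolev (CK.der i k) := by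
  obtain ⟨F, h1, h2⟩ := h
  have e : CK.val k = DV.base F := BCF.ext_ae h1
  have h3 : DV.der i F = sobolev (CK.der i k) := (DV.isGen F i).unique (e ▸ dsub.isGen k i)
  exact h3 ▸ h2 i

theorem Jets.k_ae {b hf : Plane → ℝ} {h g : CK} {B : Fin 2 → BCF} {u : X0 μ}
    (J : Jets μ b hf h g B u) (ε : ℝ) :
    (fun x => -(ε * divMul μ h u x)) =ᵐ[volume] J.k ε := by
  rw [divMul_apply, Fin.sum_univ_two]
  filter_upwards [Lp.coeFn_add (bmul (CK.val h) (divX μ u)) (bmul (sobolev (CK.der 0 h)) (vc μ 0 u)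
      + bmul (sobolev (CK.der 1 h)) (vc μ 1 u)),
    Lp.coeFn_add (bmul (sobolev (CK.der 0 h)) (vc μ 0 u)) (bmul (sobolev (CK.der 1 h)) (vc μ 1 u)),
    coeFn_bmul (CK.val h) (divX μ u), coeFn_bmul (sobolev (CK.der 0 h)) (vc μ 0 u),
    coeFn_bmul (sobolev (CK.der 1 h)) (vc μ 1 u), J.isC_h.eq_sobolev 0, J.isC_h.eq_sobolev 1]
    with x h1 h2 h3 h4 h5 h6 h7
  rw [h1, Pi.add_apply, h2, Pi.add_apply, h3, h4, h5]
  simp only [Jets.k, Pi.smul_apply, Pi.add_apply, Pi.mul_apply, smul_eq_mul, h6, h7]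
  ring

/-- The second weak derivatives of a function are symmetric. -/
theorem IsS.symm_of_hasWeakDeriv {b : Plane → ℝ} {B : Fin 2 → Plane → ℝ}
    {B' : Fin 2 → Fin 2 → Plane → ℝ} (h : ∀ j, HasWeakDeriv (Pi.single j 1) b (B j))
    (hB : ∀ j, IsS (B j) (B' j)) (i j : Fin 2) : B' i j =ᵐ[volume] B' j i := by
  have h1 := fun j => hasWeakDeriv_single_iff.1 (h j)
  have h2 := fun i j => hasWeakDeriv_single_iff.1 ((hB i).hasWeakDeriv j)
  refine ae_eq_of_forall_test (h2 i j).2.1 (h2 j i).2.1 fun φ hφ => ?_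
  rw [← neg_inj, ← (h2 i j).2.2 φ hφ, ← (h2 j i).2.2 φ hφ, ← neg_inj,
    ← (h1 i).2.2 _ (hφ.pderiv j), ← (h1 j).2.2 _ (hφ.pderiv i), hφ.pd_comm]

namespace FlowData

variable {ε β T : ℝ} {b : Plane → ℝ} {ζ : ℝ → L2} {D : FlowData ε β T b ζ}

theorem exists_jets (hμ : 0 < μ) {t : ℝ} (ht : t ∈ Icc 0 T) (w : X4 μ) :
    Nonempty (Jets μ b (depth ε β b (ζ t)) (DV.base (D.h t)) (DV.base (D.g t)) D.Bc (base4 w)) := by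
  have eq4 : ∀ a, base4 (qX4 μ a w) = qX μ a (base4 w) := fun a => by
    simp only [base4_apply, DV.base_map]
  set L : H4 → Fin 2 → L2 := fun F i => DV.base (DV.base (DV.base (DV.der i F))) with hL
  set L' : H4 → Fin 2 → Fin 2 → L2 := fun F i j => DV.base (DV.base (DV.der j (DV.der i F))) with hL'
  have hLL : ∀ F i, IsS (L F i) (fun j => L' F i j) := fun F i => IsS.of_H3 (DV.der i F)
  have hu : ∀ j, IsS (vc μ j (base4 w)) (fun i => L (qX4 μ j.castSucc w) i) := fun j => by
    rw [← qX_castSucc, ← eq4]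
    exact IsS.of_H4 _
  have hd : IsS (divX μ (base4 w)) (fun i => L (qX4 μ 2 w) i) := by
    rw [← qX_two, ← eq4]
    exact IsS.of_H4 _
  have hB : ∀ j, IsS (D.Bc j) (fun i => L (D.B j) i) := fun j =>
    (IsS.of_H4 (D.B j)).congr (coeFn_base4 (D.B j)).symm fun i => ae_eq_rfl
  have hgen : ∀ i, IsGen i (vc μ i (base4 w)) (L (qX4 μ i.castSucc w) i) := fun i => by
    rw [← qX_castSucc, ← eq4]
    exact isGen_base4 _ i
  have hWx : ∀ i, ∃ f', IsS (L (D.B 0) i * vc μ 0 (base4 w) + D.Bc 0 * L (qX4 μ 0 w) i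
      + (L (D.B 1) i * vc μ 1 (base4 w) + D.Bc 1 * L (qX4 μ 1 w) i)) f' := fun i =>
    ⟨_, (((hLL _ i).mul (hu 0)).add ((hB 0).mul (hLL _ i))).add
      (((hLL _ i).mul (hu 1)).add ((hB 1).mul (hLL _ i)))⟩
  choose Wxx hWxx using hWx
  exact ⟨{
    hx := fun i => CK.val (DV.der i (D.h t))
    hxx := fun i j => sobolev (CK.der j (DV.der i (D.h t)))
    ux := fun j i => L (qX4 μ j.castSucc w) i
    dx := fun i => L (qX4 μ 2 w) i
    dxx := fun i j => L' (qX4 μ 2 w) i j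
    Bx := fun j i => L (D.B j) i
    W := D.Bc 0 * vc μ 0 (base4 w) + D.Bc 1 * vc μ 1 (base4 w)
    Wx := fun i => L (D.B 0) i * vc μ 0 (base4 w) + D.Bc 0 * L (qX4 μ 0 w) i
      + (L (D.B 1) i * vc μ 1 (base4 w) + D.Bc 1 * L (qX4 μ 1 w) i)
    Wxx := Wxx
    isC_h := (IsC.of_CK _).congr ae_eq_rfl fun i => by rw [CK.val_der]
    isC_hx := fun i => IsC.of_CK _
    isS_u := hu
    isS_d := hd
    isS_dx := fun i => hLL _ i
    isS_B := hB
    isS_W := ((hB 0).mul (hu 0)).add ((hB 1).mul (hu 1))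
    isS_Wx := hWxx
    hf_ae := D.depth_ae t ht
    mul_g := mulK_hg ht
    b_ae := D.wderiv_b
    d_ae := by
      rw [divX_eq_of_isGen hμ hgen, Fin.sum_univ_two]
      exact Lp.coeFn_add _ _
    Bx_symm := (IsS.symm_of_hasWeakDeriv D.weak_B fun j => IsS.of_H4 (D.B j)) 0 1
    W_ae := fun x => rfl
    Wx_ae := fun i x => rfl }⟩

end FlowData

variable {μ : ℝ}

/-! ### Equivalence of the momentum equations -/

section Relation

variable {T t : ℝ} {h : ℝ → CK} {k : CK} {s : Fin 2 → BCF} {u : ℝ → X0 μ} {v : ℝ → Y0 μ}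

/-- If `h v = 𝔗 u` and `u` is differentiable in time, so is `v`. -/
theorem exists_hasDerivWithinAt_dual (ht : t ∈ Icc 0 T) (hh : HasDerivWithinAt h k (Icc 0 T) t)
    (hbij : ∀ t ∈ Icc 0 T, Function.Bijective (mulYK μ (h t)))
    (huv : ∀ t ∈ Icc 0 T, mulYK μ (h t) (v t) = frak0 μ (CK.val (h t)) s (u t)) {u' : X0 μ}
    (hu : HasDerivWithinAt u u' (Icc 0 T) t) : ∃ v', HasDerivWithinAt v v' (Icc 0 T) t := by
  have h1 := (hasDerivWithinAt_frakOp bmul (pY μ) (qX μ) fun a b =>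
    hasDerivWithinAt_coefMat (μ := μ) (s := s)
      ((CK.val).hasFDerivAt.comp_hasDerivWithinAt t hh) a b).clm_apply hu
  exact hasDerivWithinAt_inverse_apply ht ((mulYK μ).hasFDerivAt.comp_hasDerivWithinAt t hh) hbij
    h1 huv

/-- If `h v = 𝔗 u` and `v` is differentiable in time, so is `u`. -/
theorem exists_hasDerivWithinAt_primal (ht : t ∈ Icc 0 T) (hh : HasDerivWithinAt h k (Icc 0 T) t)
    (hbij : ∀ t ∈ Icc 0 T, Function.Bijective (frak0 μ (CK.val (h t)) s))
    (huv : ∀ t ∈ Icc 0 T, mulYK μ (h t) (v t) = frak0 μ (CK.val (h t)) s (u t)) {v' : Y0 μ}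
    (hv : HasDerivWithinAt v v' (Icc 0 T) t) : ∃ u', HasDerivWithinAt u u' (Icc 0 T) t := by
  have h1 := (hasDerivWithinAt_frakOp bmul (pY μ) (qX μ) fun a b =>
    hasDerivWithinAt_coefMat (μ := μ) (s := s)
      ((CK.val).hasFDerivAt.comp_hasDerivWithinAt t hh) a b)
  have h2 := ((mulYK μ).hasFDerivAt.comp_hasDerivWithinAt t hh).clm_apply hv
  exact hasDerivWithinAt_inverse_apply ht h1 hbij h2 fun t ht => (huv t ht).symm

end Relation

theorem ContY.congr {n : ℕ} {T : ℝ} {v w : ℝ → Y0 μ} (h : ContY μ n T v)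
    (e : ∀ t ∈ Icc 0 T, w t = v t) : ContY μ n T w := fun α hα => by
  obtain ⟨D, hD, hD'⟩ := h α hα
  exact ⟨D, hD, fun t ht => e t ht ▸ hD' t ht⟩

theorem ContX.congr {n : ℕ} {T : ℝ} {v w : ℝ → X0 μ} (h : ContX μ n T v)
    (e : ∀ t ∈ Icc 0 T, w t = v t) : ContX μ n T w := fun α hα => by
  obtain ⟨D, hD, hD'⟩ := h α hα
  exact ⟨D, hD, fun t ht => e t ht ▸ hD' t ht⟩

theorem cancel_common {E : Type*} [AddCommGroup E] {A B k f g p : E}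
    (h₁ : k + B = p + A) (h₂ : p + f = k + g) : A + g = B + f := by
  have e1 : B = p + A - k := by rw [← h₁]; abel
  have e2 : f = k + g - p := by rw [← h₂]; abel
  rw [e1, e2]
  abel

namespace FlowData

variable {ε β T : ℝ} {b : Plane → ℝ} {ζ : ℝ → L2} {D : FlowData ε β T b ζ}

theorem mulYK_toY_velX (hμ : 0 < μ) {t : ℝ} (ht : t ∈ Icc 0 T) (u : X0 μ) :
    mulYK μ (DV.base (D.h t)) (toY μ (velX μ u)) = toY μ (depth ε β b (ζ t) • ⇑(velX μ u)) := by
  rw [toY_depth_smul (D.depth_ae t ht), toY_eq fun j => (coeFn_vc j u).symm, map_sum]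
  simp only [mulYK_eY hμ]

/-- `h (Id + μ 𝒯) = 𝔗`. -/
theorem mulYK_inertia (hμ : 0 < μ) {t : ℝ} (ht : t ∈ Icc 0 T) (u : X0 μ) :
    mulYK μ (DV.base (D.h t)) (toY μ (velX μ u) + μ • opT μ β b (depth ε β b (ζ t)) u)
      = frak0 μ (CK.val (DV.base (D.h t))) (fun j => β • D.Bc j) u := by
  rw [← FlowData.opFrakT_eq ht hμ, opFrakT, FlowData.mulY_eq ht hμ, ← mulYK_toY_velX hμ ht u,
    (mulYK μ _).map_add, (mulYK μ _).map_smul]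

/-- The momentum equations for `u` and for `v` are equivalent. -/
theorem momentum_eq (hμ : 0 < μ) (hT : 0 < T) {w : ℝ → X4 μ} {u : ℝ → X0 μ} {v : ℝ → Y0 μ}
    (hwu : ∀ t ∈ Icc 0 T, base4 (w t) = u t)
    (huv : ∀ t ∈ Icc 0 T, mulYK μ (DV.base (D.h t)) (v t)
      = frak0 μ (CK.val (DV.base (D.h t))) (fun j => β • D.Bc j) (u t))
    {t : ℝ} (ht : t ∈ Icc 0 T)
    (hh : HasDerivWithinAt (fun t => DV.base (D.h t)) (D.k w t) (Icc 0 T) t)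
    {u' : X0 μ} {v' : Y0 μ}
    (hu : HasDerivWithinAt u u' (Icc 0 T) t) (hv : HasDerivWithinAt v v' (Icc 0 T) t) :
    toY μ (velX μ u') + μ • opT μ β b (depth ε β b (ζ t)) u'
        + Jets.fluxU ε μ β b (depth ε β b (ζ t)) (u t)
      = v' + Jets.fluxV ε μ β b (depth ε β b (ζ t)) (u t) (v t) := by
  refine (bijective_mulYK (D := D) ht hμ).1 ?_
  obtain ⟨J⟩ := exists_jets (D := D) hμ ht (w t)
  have hk : CK.val (D.k w t) =ᵐ[volume] J.k ε := (D.val_k w t).trans (J.k_ae ε)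
  have h1 := J.flux_identity hμ hk (v₀ := v t) ((huv t ht).trans (by rw [hwu t ht]))
  have h2 := hasDerivWithinAt_relation hT ht hh huv hu hv
  rw [hwu t ht] at h1
  rw [(mulYK μ (DV.base (D.h t))).map_add (_ + _), mulYK_inertia (D := D) hμ ht,
    (mulYK μ (DV.base (D.h t))).map_add v']
  exact cancel_common h2 h1

end FlowData

variable {μ : ℝ}

/-! ### Equivalence of the two systems -/

theorem momentum_u_iff {E : Type*} [AddCommGroup E] {A G x y : E} :
    A + G + x + y = 0 ↔ A + (x + y) + G = 0 := by
  rw [show A + G + x + y = A + (x + y) + G by abel]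

theorem momentum_v_iff {E : Type*} [AddCommGroup E] {A G x y z : E} :
    A + x + G + y = z ↔ A + (x + y - z) + G = 0 := by
  rw [← sub_eq_zero, show A + x + G + y - z = A + (x + y - z) + G by abel]

namespace FlowData

variable {ε β T : ℝ} {b : Plane → ℝ} {ζ : ℝ → L2} (D : FlowData ε β T b ζ)

include D

theorem mulY_vOf (hμ : 0 < μ) {t : ℝ} (ht : t ∈ Icc 0 T) (u : X0 μ) :
    mulYK μ (DV.base (D.h t)) (vOf ε β μ b (ζ t) u)
      = frak0 μ (CK.val (DV.base (D.h t))) (fun j => β • D.Bc j) u := by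
  rw [vOf, FlowData.mulY_inv_eq (D := D) ht hμ, FlowData.opFrakT_eq (D := D) ht hμ,
    mulYK_cancel hμ (mulK_hg ht)]

theorem opFrakT_velOf (hμ : 0 < μ) {t : ℝ} (ht : t ∈ Icc 0 T) (v : Y0 μ) :
    opFrakT μ β b (depth ε β b (ζ t)) (velOf ε β μ b (ζ t) v) = mulY μ (depth ε β b (ζ t)) v := by
  have e : opFrakT μ β b (depth ε β b (ζ t))
      = frak0 μ (CK.val (DV.base (D.h t))) (fun j => β • D.Bc j) :=
    funext fun u => FlowData.opFrakT_eq ht hμ u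
  refine Function.rightInverse_invFun (e ▸ (FlowData.bijective_frak0 (D := D) ht hμ).2) _

theorem opFrakT_injective (hμ : 0 < μ) {t : ℝ} (ht : t ∈ Icc 0 T) :
    Function.Injective (opFrakT μ β b (depth ε β b (ζ t))) := by
  have e : opFrakT μ β b (depth ε β b (ζ t))
      = frak0 μ (CK.val (DV.base (D.h t))) (fun j => β • D.Bc j) :=
    funext fun u => FlowData.opFrakT_eq ht hμ u
  exact e ▸ (FlowData.bijective_frak0 (D := D) ht hμ).1

theorem velOf_vOf (hμ : 0 < μ) {t : ℝ} (ht : t ∈ Icc 0 T) (u : X0 μ) :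
    velOf ε β μ b (ζ t) (vOf ε β μ b (ζ t) u) = u :=
  D.opFrakT_injective hμ ht <| by
    rw [D.opFrakT_velOf hμ ht, FlowData.mulY_eq (D := D) ht hμ, D.mulY_vOf hμ ht,
      FlowData.opFrakT_eq (D := D) ht hμ]

/-- From the system for `u` to the system for `v`. -/
theorem solvesGNv (hμ : 0 < μ) (hT : 0 < T) {u : ℝ → X0 μ} (hu : ContX μ 4 T u)
    (hs : SolvesGNu ε β μ T b ζ u) :
    (∀ t ∈ Icc 0 T, ∀ v₀ : Y0 μ,
        mulY μ (depth ε β b (ζ t)) v₀ = opFrakT μ β b (depth ε β b (ζ t)) (u t) ↔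
          v₀ = vOf ε β μ b (ζ t) (u t)) ∧
      ContY μ 4 T (fun t => vOf ε β μ b (ζ t) (u t)) ∧
      SolvesGNv ε β μ T b ζ (fun t => vOf ε β μ b (ζ t) (u t)) := by
  obtain ⟨e, he, he0⟩ := hu.isTower
  obtain ⟨w, hw, hwe⟩ := he.exists_lift_four
  have hwu : ∀ t ∈ Icc 0 T, base4 (w t) = u t := fun t ht => (hwe t ht).trans (he0 t ht)
  have huv : ∀ t ∈ Icc 0 T, mulYK μ (DV.base (D.h t)) (vOf ε β μ b (ζ t) (u t))
      = frak0 μ (CK.val (DV.base (D.h t))) (fun j => β • D.Bc j) (u t) :=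
    fun t ht => D.mulY_vOf hμ ht (u t)
  have hcont : ContinuousOn (fun t => mulY4 hμ (D.g t) (frak4 μ (D.h t) D.s (w t))) (Icc 0 T) :=
    continuousOn_mulY4 hμ D.contg
      ((continuousOn_frakOp _ _ _ fun a c => continuousOn_coefDK D.conth a c).clm_apply hw)
  have hh := D.hasDerivWithinAt_h hμ hT.le hw fun t ht => by
    obtain ⟨ζt, ut, h1, -, h2, -⟩ := hs t ht
    exact ⟨ζt, h1, by rwa [hwu t ht]⟩
  refine ⟨fun t ht v₀ => ?_, ?_, fun t ht => ?_⟩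
  · rw [FlowData.mulY_eq (D := D) ht hμ, FlowData.opFrakT_eq (D := D) ht hμ, ← huv t ht]
    exact (bijective_mulYK (D := D) ht hμ).1.eq_iff
  · refine ((HasDerivs.base4 hcont).contY hμ).congr fun t ht => ?_
    rw [base4_mulY4, FlowData.base4_frak4, hwu t ht, ← huv t ht, mulYK_cancel hμ (mulK_gh ht)]
  · obtain ⟨ζt, ut, h1, h2, h3, h4⟩ := hs t ht
    obtain ⟨vt, hvt⟩ := exists_hasDerivWithinAt_dual ht (hh t ht)
      (fun t ht => bijective_mulYK ht hμ) huv h2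
    have h5 := D.momentum_eq hμ hT hwu huv ht (hh t ht) h2 hvt
    rw [momentum_u_iff] at h4
    refine ⟨ζt, vt, h1, hvt, ?_, ?_⟩
    · rwa [D.velOf_vOf hμ ht]
    · rw [D.velOf_vOf hμ ht, momentum_v_iff, ← h4]
      exact congrArg (· + gradY μ (ζ t)) h5.symm

/-- From the system for `v` to the system for `u`. -/
theorem solvesGNu (hμ : 0 < μ) (hT : 0 < T) {v : ℝ → Y0 μ} (hv : ContY μ 4 T v)
    (hs : SolvesGNv ε β μ T b ζ v) :
    (∀ t ∈ Icc 0 T, ∀ u₀ : X0 μ,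
        opFrakT μ β b (depth ε β b (ζ t)) u₀ = mulY μ (depth ε β b (ζ t)) (v t) ↔
          u₀ = velOf ε β μ b (ζ t) (v t)) ∧
      ContX μ 4 T (fun t => velOf ε β μ b (ζ t) (v t)) ∧
      SolvesGNu ε β μ T b ζ (fun t => velOf ε β μ b (ζ t) (v t)) := by
  obtain ⟨e, he, he0⟩ := hv.isTower hμ
  obtain ⟨y, hy, hye⟩ := he.exists_lift_four
  have hyv : ∀ t ∈ Icc 0 T, base4 (y t) = v t := fun t ht => (hye t ht).trans (he0 t ht)
  have huv : ∀ t ∈ Icc 0 T, mulYK μ (DV.base (D.h t)) (v t)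
      = frak0 μ (CK.val (DV.base (D.h t))) (fun j => β • D.Bc j) (velOf ε β μ b (ζ t) (v t)) :=
    fun t ht => by
      rw [← FlowData.opFrakT_eq ht hμ, D.opFrakT_velOf hμ ht, FlowData.mulY_eq (D := D) ht hμ]
  have hex : ∀ t ∈ Icc 0 T, ∃ w, frak4 μ (D.h t) D.s w = mulY4 hμ (D.h t) (y t) := fun t ht =>
    (FlowData.bijective_frak4 (D := D) ht hμ).2 _
  choose! w hw using hex
  have hcont : ContinuousOn w (Icc 0 T) :=
    continuousOn_inverse_apply
      (continuousOn_frakOp _ _ _ fun a c => continuousOn_coefDK D.conth a c)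
      (fun t ht => FlowData.bijective_frak4 (D := D) ht hμ) (continuousOn_mulY4 hμ D.conth hy) hw
  have hwu : ∀ t ∈ Icc 0 T, base4 (w t) = velOf ε β μ b (ζ t) (v t) := fun t ht =>
    (FlowData.bijective_frak0 (D := D) ht hμ).1 <| by
      rw [← huv t ht, ← FlowData.base4_frak4, hw t ht, base4_mulY4, hyv t ht]
  have hh := D.hasDerivWithinAt_h hμ hT.le hcont fun t ht => by
    obtain ⟨ζt, vt, h1, -, h2, -⟩ := hs t ht
    exact ⟨ζt, h1, by rwa [hwu t ht]⟩
  refine ⟨fun t ht u₀ => ?_, (HasDerivs.base4 hcont).contX.congr fun t ht => (hwu t ht).symm,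
    fun t ht => ?_⟩
  · rw [← D.opFrakT_velOf hμ ht]
    exact (D.opFrakT_injective hμ ht).eq_iff
  · obtain ⟨ζt, vt, h1, h2, h3, h4⟩ := hs t ht
    obtain ⟨ut, hut⟩ := exists_hasDerivWithinAt_primal ht (hh t ht)
      (fun t ht => FlowData.bijective_frak0 ht hμ) huv h2
    have h5 := D.momentum_eq hμ hT hwu huv ht (hh t ht) hut h2
    rw [momentum_v_iff] at h4
    refine ⟨ζt, ut, h1, hut, h3, ?_⟩
    rw [momentum_u_iff, ← h4]
    exact congrArg (· + gradY μ (ζ t)) h5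

end FlowData

end

theorem propositionP (ε β μ T : ℝ) (hε : 0 ≤ ε) (hβ : 0 ≤ β) (hμ : 0 < μ) (hT : 0 < T)
    (b : Plane → ℝ) (hb : MemHdotSucc 4 b)
    (ζ : ℝ → L2) (hζ : ContH 4 T ζ)
    (hlow hupp : ℝ) (hlow_pos : 0 < hlow)
    (hdepth : ∀ t ∈ Set.Icc 0 T, ∀ᵐ x ∂(MeasureTheory.volume : MeasureTheory.Measure Plane),
      hlow < depth ε β b (ζ t) x ∧ depth ε β b (ζ t) x < hupp) :
    (∀ u : ℝ → X0 μ, ContX μ 4 T u → SolvesGNu ε β μ T b ζ u →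
      (∀ t ∈ Set.Icc 0 T, ∀ v₀ : Y0 μ,
        mulY μ (depth ε β b (ζ t)) v₀ = opFrakT μ β b (depth ε β b (ζ t)) (u t) ↔
          v₀ = vOf ε β μ b (ζ t) (u t)) ∧
      ContY μ 4 T (fun t => vOf ε β μ b (ζ t) (u t)) ∧
      SolvesGNv ε β μ T b ζ (fun t => vOf ε β μ b (ζ t) (u t))) ∧
    (∀ v : ℝ → Y0 μ, ContY μ 4 T v → SolvesGNv ε β μ T b ζ v →
      (∀ t ∈ Set.Icc 0 T, ∀ u₀ : X0 μ,
        opFrakT μ β b (depth ε β b (ζ t)) u₀ = mulY μ (depth ε β b (ζ t)) (v t) ↔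
          u₀ = velOf ε β μ b (ζ t) (v t)) ∧
      ContX μ 4 T (fun t => velOf ε β μ b (ζ t) (v t)) ∧
      SolvesGNu ε β μ T b ζ (fun t => velOf ε β μ b (ζ t) (v t))) := by
  obtain ⟨D⟩ := exists_flowData hT hb hζ hlow_pos hdepth
  exact ⟨fun u hu hs => D.solvesGNv hμ hT hu hs, fun v hv hs => D.solvesGNu hμ hT hv hs⟩
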